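/- Let $q\in\mathbb C$ with $0<|q|<1$, let $M\ge 0$ be an integer, and write $(a)_\infty=\prod_{i\ge0}(1-aq^i)$, $\int_0^{\tau}f(t)\,d_qt=(1-q)\sum_{n\ge0}f(\tau q^n)\tau q^n$, $\int_{\tau_1}^{\tau_2}=\int_0^{\tau_2}-\int_0^{\tau_1}$. Let $X$ be the variety of $(a,b)=(a_1,\dots,a_{M+3};b_1,\dots,b_{M+3})\in(\mathbb C\setminus\{0\})^{2M+6}$ with $a_1\cdots a_{M+3}=q^2b_1\cdots b_{M+3}$, and call $(a,b)\in X$ generic if $a_i/a_j\notin q^{\mathbb Z}$ for all $i\ne j$ and $a_i/b_j\notin q^{\mathbb Z}$ for all $i,j$. Put $$\varphi_{i,j}=\int_{q/a_i}^{q/a_j}\prod_{k=1}^{M+3}\frac{(a_kt)_\infty}{(b_kt)_\infty}\,d_qt .$$ Let $T_{a_i},T_{b_i}$ be the $q$-shifts $a_i\mapsto qa_i$, $b_i\mapsto qb_i$; the admissible shifts are the elements of the group generated by $T_{a_k}T_{a_l}^{-1}$, $T_{b_k}T_{b_l}^{-1}$, $T_{a_k}T_{b_l}$ (they preserve $X$).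 The system $q$-$RP^M$ for an unknown $y$ consists of $\hat E_My=0$, where, with $T=T_{a_1}T_{b_1}$, $\hat a=(a_2,\dots,a_{M+3})$, $\hat b=(b_2,\dots,b_{M+3})$ and $e_k$ the elementary symmetric polynomials, $$\hat E_M=b_1^{M+2}T^{-1}\prod_{i=0}^{M}\Bigl(1-\tfrac{a_1q^i}{b_1}T\Bigr)+\sum_{k=1}^{M+1}(-1)^kb_1^{M+2-k}\bigl[e_k(\hat a)T^{-1}-qe_k(\hat b)\bigr]\prod_{i=0}^{M-k}\Bigl(1-\tfrac{a_1q^i}{b_1}T\Bigr)\prod_{i=0}^{k-2}(1-q^{-i}T)+(-1)^Ma_2\cdots a_{M+3}T^{-1}\prod_{i=0}^{M}(1-q^{-i}T),$$ of the equations, for all $k,l\in\{2,\dots,M+3\}$ (with $k\neq l$ where $l$ occurs), $$\begin{aligned} &[(a_1-a_kq)T_{a_k}T_{a_l}^{-1}-(a_l-a_kq)T_{a_k}T_{a_1}^{-1}+(a_l-a_1)]y=0,\\ &[(b_1-a_1)T_{a_1}T_{a_k}^{-1}-(q^{-1}a_k-a_1)T_{a_1}T_{b_1}+(q^{-1}a_k-b_1)]y=0,\\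 &[(b_1-q^{-1}b_l)T_{b_k}T_{b_l}^{-1}-(b_k-q^{-1}b_l)T_{b_1}T_{b_l}^{-1}+(b_k-b_1)]y=0,\\ &[(a_1-b_1)T_{b_k}T_{b_1}^{-1}-(b_kq-b_1)(T_{a_1}T_{b_1})^{-1}+(b_kq-a_1)]y=0,\\ &[(b_1-a_k)T_{a_k}T_{b_l}-(b_l-a_k)T_{a_k}T_{b_1}+(b_l-b_1)]y=0,\\ &[(b_l-a_1)T_{a_k}^{-1}T_{b_l}^{-1}-(b_l-a_k)T_{a_1}^{-1}T_{b_l}^{-1}+(a_1-a_k)]y=0, \end{aligned}$$ and of $\bigl(q\prod_{k=1}^{M+3}T_{a_k}T_{b_k}-1\bigr)y=0$. A pseudo-constant is a function $C$ with $T_{a_k}T_{a_l}^{-1}C=T_{b_k}T_{b_l}^{-1}C=T_{a_k}T_{b_l}C=C$ for all $k,l$. Then $\varphi_{2,M+3},\varphi_{3,M+3},\dots,\varphi_{M+2,M+3}$ form a basis of the space of solutions of $q$-$RP^M$ over the pseudo-constants, in both of the following senses. (1) Let $U\subseteq X$ be any set of generic parameters that is stable under the admissible shifts (for instance the orbit of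 one generic point, where the pseudo-constants are just $\mathbb C$, or the set of all generic parameters). In the space of all functions $U\to\mathbb C$, the solutions of $q$-$RP^M$ form a free module over the ring of pseudo-constants $U\to\mathbb C$, with basis the restrictions to $U$ of $\varphi_{2,M+3},\dots,\varphi_{M+2,M+3}$. (2) The functions $\varphi_{2,M+3},\dots,\varphi_{M+2,M+3}$ extend from the generic parameters to meromorphic functions on $X$ (elements of the field of fractions of the ring of holomorphic functions on $X$), and these form a basis of the space of meromorphic solutions of $q$-$RP^M$ on $X$ over the field $K$ of meromorphic pseudo-constants on $X$. -/

import Mathlib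

open Topology

noncomputable section

/-! ## Parameters, `q`-shifted factorials and Jackson integrals

The parameters `a_1, …, a_{M+3}` and `b_1, …, b_{M+3}` are indexed by `Fin (M + 3)`, so that the
index `i` of the mathematical text is the element `i - 1` of `Fin (M + 3)`. In particular the
distinguished index `1` is `0 : Fin (M + 3)` and the index `M + 3` is `Fin.last (M + 2)`. -/

/-- The ambient space of parameters `(a, b)`. -/
abbrev Param (M : ℕ) : Type := (Fin (M + 3) → ℂ) × (Fin (M + 3) → ℂ)

/-- `(a)_∞ = ∏_{i ≥ 0} (1 - a q^i)`. -/
def qPoch (q a : ℂ) : ℂ := ∏' i : ℕ, (1 - a * q ^ i)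

/-- The Jackson integral `∫_0^τ f(t) d_q t`. -/
def jacksonZero (q : ℂ) (f : ℂ → ℂ) (τ : ℂ) : ℂ :=
  (1 - q) * ∑' n : ℕ, f (τ * q ^ n) * (τ * q ^ n)

/-- The Jackson integral `∫_{τ₁}^{τ₂} f(t) d_q t`. -/
def jackson (q : ℂ) (f : ℂ → ℂ) (τ₁ τ₂ : ℂ) : ℂ :=
  jacksonZero q f τ₂ - jacksonZero q f τ₁

/-- The Jackson integral of Riemann--Papperitz type
`φ_{i,j} = ∫_{q/a_i}^{q/a_j} ∏_k (a_k t)_∞ / (b_k t)_∞ d_q t`. -/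
def rpIntegral {M : ℕ} (q : ℂ) (i j : Fin (M + 3)) (p : Param M) : ℂ :=
  jackson q (fun t => ∏ k, qPoch q (p.1 k * t) / qPoch q (p.2 k * t)) (q / p.1 i) (q / p.1 j)

/-- The parameter variety: nonzero parameters with
`a_1 ⋯ a_{M+3} = q² b_1 ⋯ b_{M+3}`. -/
def paramVariety (q : ℂ) (M : ℕ) : Set (Param M) :=
  {p | (∀ i, p.1 i ≠ 0) ∧ (∀ i, p.2 i ≠ 0) ∧ ∏ i, p.1 i = q ^ 2 * ∏ i, p.2 i}

/-- Generic parameters: points of the parameter variety with `a_i / a_j ∉ q^ℤ` for `i ≠ j` and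
`a_i / b_j ∉ q^ℤ` for all `i, j`. -/
def genericParams (q : ℂ) (M : ℕ) : Set (Param M) :=
  {p | p ∈ paramVariety q M ∧ (∀ i j, i ≠ j → ∀ n : ℤ, p.1 i ≠ q ^ n * p.1 j) ∧
    ∀ i j, ∀ n : ℤ, p.1 i ≠ q ^ n * p.2 j}

/-! ## Admissible `q`-shifts -/

/-- Exponents `(m, n)` of the `q`-shifts `∏ T_{a_i}^{m_i} ∏ T_{b_i}^{n_i}` which preserve the
condition `a_1 ⋯ a_{M+3} = q² b_1 ⋯ b_{M+3}`. -/
def AdmShift (M : ℕ) : AddSubgroup ((Fin (M + 3) → ℤ) × (Fin (M + 3) → ℤ)) where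
  carrier := {v | ∑ i, v.1 i = ∑ i, v.2 i}
  zero_mem' := by simp
  add_mem' := by
    intro v w hv hw
    simp only [Set.mem_ofPred_eq, Prod.fst_add, Prod.snd_add, Pi.add_apply,
      Finset.sum_add_distrib] at *
    rw [hv, hw]
  neg_mem' := by
    intro v hv
    simp only [Set.mem_ofPred_eq, Prod.fst_neg, Prod.snd_neg, Pi.neg_apply,
      Finset.sum_neg_distrib] at *
    rw [hv]

/-- The exponent of `T_{a_k} T_{a_l}⁻¹`. -/
def shAA {M : ℕ} (k l : Fin (M + 3)) : AdmShift M :=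
  ⟨(Pi.single k 1 - Pi.single l 1, 0), by simp [AdmShift]⟩

/-- The exponent of `T_{b_k} T_{b_l}⁻¹`. -/
def shBB {M : ℕ} (k l : Fin (M + 3)) : AdmShift M :=
  ⟨(0, Pi.single k 1 - Pi.single l 1), by simp [AdmShift]⟩

/-- The exponent of `T_{a_k} T_{b_l}`. -/
def shAB {M : ℕ} (k l : Fin (M + 3)) : AdmShift M :=
  ⟨(Pi.single k 1, Pi.single l 1), by simp [AdmShift]⟩

/-- The action of a shift on parameters: `a_i ↦ q^{m_i} a_i`, `b_i ↦ q^{n_i} b_i`. -/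
def shiftPoint {M : ℕ} (q : ℂ) (v : AdmShift M) (p : Param M) : Param M :=
  (fun i => q ^ (v.1.1 i) * p.1 i, fun i => q ^ (v.1.2 i) * p.2 i)

/-- A set of parameters which is stable under all admissible shifts. -/
def ShiftStable {M : ℕ} (q : ℂ) (U : Set (Param M)) : Prop :=
  ∀ (v : AdmShift M) (p : Param M), p ∈ U → shiftPoint q v p ∈ U

/-- The shift operator `f ↦ f ∘ shiftPoint q v` on functions on a shift-stable set. -/
def shiftFun {M : ℕ} {q : ℂ} {U : Set (Param M)} (hU : ShiftStable q U) (v : AdmShift M) :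
    (U → ℂ) →ₐ[ℂ] (U → ℂ) where
  toFun f := fun p => f ⟨shiftPoint q v p, hU v p p.2⟩
  map_one' := rfl
  map_mul' _ _ := rfl
  map_zero' := rfl
  map_add' _ _ := rfl
  commutes' _ := rfl

/-! ## The system `q`-`RP^M`

It is formulated for an algebra `R` of "functions" on which the admissible shifts act by `σ` and in
which the coordinates are the elements `a i`, `b i`. -/

section System

variable {M : ℕ} {R : Type*} [CommRing R] [Algebra ℂ R]

/-- The predicate `T_{a_k} T_{a_l}⁻¹ C = T_{b_k} T_{b_l}⁻¹ C = T_{a_k} T_{b_l} C = C` for all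
`k, l`. -/
def IsPseudoConstant (σ : AdmShift M → R →ₐ[ℂ] R) (C : R) : Prop :=
  ∀ k l : Fin (M + 3), σ (shAA k l) C = C ∧ σ (shBB k l) C = C ∧ σ (shAB k l) C = C

/-- The ring of pseudo-constants. -/
def pseudoConstants (σ : AdmShift M → R →ₐ[ℂ] R) : Subring R where
  carrier := {C | IsPseudoConstant σ C}
  zero_mem' := fun k l => by simp
  one_mem' := fun k l => by simp
  add_mem' := fun {x y} hx hy k l => by
    simp only [map_add, (hx k l).1, (hx k l).2.1, (hx k l).2.2, (hy k l).1, (hy k l).2.1,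
      (hy k l).2.2, and_self]
  mul_mem' := fun {x y} hx hy k l => by
    simp only [map_mul, (hx k l).1, (hx k l).2.1, (hx k l).2.2, (hy k l).1, (hy k l).2.1,
      (hy k l).2.2, and_self]
  neg_mem' := fun {x} hx k l => by
    simp only [map_neg, (hx k l).1, (hx k l).2.1, (hx k l).2.2, and_self]

/-- The product `∏_{i=0}^{n-1} (1 - c q^i T)` (factors in increasing order of `i`), where `c` acts
by multiplication. -/
def prodOp (q : ℂ) (c : R) (T : Module.End ℂ R) (n : ℕ) : Module.End ℂ R :=
  ((List.range n).map fun i => 1 - LinearMap.mulLeft ℂ (q ^ i • c) * T).prod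

/-- The operator `Ê_M` in `T = T_{a_1} T_{b_1}`. Products of operators are compositions. -/
def hatE [Div R] (q : ℂ) (σ : AdmShift M → R →ₐ[ℂ] R) (a b : Fin (M + 3) → R) :
    Module.End ℂ R :=
  let T : Module.End ℂ R := (σ (shAB 0 0)).toLinearMap
  let Tinv : Module.End ℂ R := (σ (-shAB 0 0)).toLinearMap
  let mul : R → Module.End ℂ R := fun c => LinearMap.mulLeft ℂ c
  let ea : ℕ → R := fun k => (Finset.univ.val.map fun i : Fin (M + 2) => a i.succ).esymm k
  let eb : ℕ → R := fun k => (Finset.univ.val.map fun i : Fin (M + 2) => b i.succ).esymm k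
  mul (b 0 ^ (M + 2)) * Tinv * prodOp q (a 0 / b 0) T (M + 1)
  + ∑ k ∈ Finset.Icc 1 (M + 1), mul ((-1) ^ k * b 0 ^ (M + 2 - k)) *
      (mul (ea k) * Tinv - mul (q • eb k)) *
        prodOp q (a 0 / b 0) T (M + 1 - k) * prodOp q⁻¹ 1 T (k - 1)
  + mul ((-1) ^ M * ∏ i : Fin (M + 2), a i.succ) * Tinv * prodOp q⁻¹ 1 T (M + 1)

/-- `y` is a solution of the system `q`-`RP^M`. -/
structure IsSolutionRP [Div R] (q : ℂ) (σ : AdmShift M → R →ₐ[ℂ] R) (a b : Fin (M + 3) → R)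
    (y : R) : Prop where
  eqE : hatE q σ a b y = 0
  eqAA : ∀ k l : Fin (M + 3), k ≠ 0 → l ≠ 0 → k ≠ l →
    (a 0 - q • a k) * σ (shAA k l) y - (a l - q • a k) * σ (shAA k 0) y + (a l - a 0) * y = 0
  eqA : ∀ k : Fin (M + 3), k ≠ 0 →
    (b 0 - a 0) * σ (shAA 0 k) y - (q⁻¹ • a k - a 0) * σ (shAB 0 0) y
      + (q⁻¹ • a k - b 0) * y = 0
  eqBB : ∀ k l : Fin (M + 3), k ≠ 0 → l ≠ 0 → k ≠ l →
    (b 0 - q⁻¹ • b l) * σ (shBB k l) y - (b k - q⁻¹ • b l) * σ (shBB 0 l) y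
      + (b k - b 0) * y = 0
  eqB : ∀ k : Fin (M + 3), k ≠ 0 →
    (a 0 - b 0) * σ (shBB k 0) y - (q • b k - b 0) * σ (-shAB 0 0) y
      + (q • b k - a 0) * y = 0
  eqAB : ∀ k l : Fin (M + 3), k ≠ 0 → l ≠ 0 → k ≠ l →
    (b 0 - a k) * σ (shAB k l) y - (b l - a k) * σ (shAB k 0) y + (b l - b 0) * y = 0
  eqABinv : ∀ k l : Fin (M + 3), k ≠ 0 → l ≠ 0 → k ≠ l →
    (b l - a 0) * σ (-shAB k l) y - (b l - a k) * σ (-shAB 0 l) y + (a 0 - a k) * y = 0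
  eqAll : q • σ (∑ k, shAB k k) y - y = 0

end System

/-- The function `a_i` on a set of parameters. -/
def coordA {M : ℕ} (U : Set (Param M)) (i : Fin (M + 3)) : U → ℂ := fun p => p.1.1 i

/-- The function `b_i` on a set of parameters. -/
def coordB {M : ℕ} (U : Set (Param M)) (i : Fin (M + 3)) : U → ℂ := fun p => p.1.2 i

/-! ## Meromorphic functions on the parameter variety -/

/-- The ring of holomorphic functions on the parameter variety: functions which locally are
restrictions of analytic functions on the ambient space. -/
def Holo (q : ℂ) (M : ℕ) : Subalgebra ℂ (paramVariety q M → ℂ) where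
  carrier := {f | ∀ p : paramVariety q M, ∃ F : Param M → ℂ,
    AnalyticAt ℂ F p ∧ f =ᶠ[𝓝 p] fun x => F x}
  mul_mem' := by
    intro f g hf hg p
    obtain ⟨F, hF, hfF⟩ := hf p
    obtain ⟨G, hG, hgG⟩ := hg p
    exact ⟨F * G, hF.mul hG, hfF.mul hgG⟩
  add_mem' := by
    intro f g hf hg p
    obtain ⟨F, hF, hfF⟩ := hf p
    obtain ⟨G, hG, hgG⟩ := hg p
    exact ⟨F + G, hF.add hG, hfF.add hgG⟩
  algebraMap_mem' := fun c p => ⟨fun _ => c, analyticAt_const, Filter.Eventually.of_forall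
    fun _ => rfl⟩

theorem analyticAt_coordA {M : ℕ} (i : Fin (M + 3)) (p : Param M) :
    AnalyticAt ℂ (fun x : Param M => x.1 i) p :=
  analyticAt_pi_iff.1 analyticAt_fst i

theorem analyticAt_coordB {M : ℕ} (i : Fin (M + 3)) (p : Param M) :
    AnalyticAt ℂ (fun x : Param M => x.2 i) p :=
  analyticAt_pi_iff.1 analyticAt_snd i

/-- The coordinate `a_i` as a holomorphic function. -/
def holoA (q : ℂ) {M : ℕ} (i : Fin (M + 3)) : Holo q M :=
  ⟨coordA _ i, fun _ => ⟨fun x => x.1 i,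
    analyticAt_coordA i _, Filter.Eventually.of_forall fun _ => rfl⟩⟩

/-- The coordinate `b_i` as a holomorphic function. -/
def holoB (q : ℂ) {M : ℕ} (i : Fin (M + 3)) : Holo q M :=
  ⟨coordB _ i, fun _ => ⟨fun x => x.2 i,
    analyticAt_coordB i _, Filter.Eventually.of_forall fun _ => rfl⟩⟩

theorem shiftStable_paramVariety (q : ℂ) [NeZero q] (M : ℕ) :
    ShiftStable q (paramVariety q M) := by
  rintro v p ⟨h1, h2, h3⟩
  have hq : q ≠ 0 := NeZero.ne q
  refine ⟨fun i => mul_ne_zero (zpow_ne_zero _ hq) (h1 i),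
    fun i => mul_ne_zero (zpow_ne_zero _ hq) (h2 i), ?_⟩
  have hs : ∀ w : Fin (M + 3) → ℤ, ∏ i, q ^ w i = q ^ ∑ i, w i := by
    intro w
    induction (Finset.univ : Finset (Fin (M + 3))) using Finset.induction_on with
    | empty => simp
    | insert i s hi ih => rw [Finset.prod_insert hi, Finset.sum_insert hi, ih, zpow_add₀ hq]
  have hv : ∑ i, v.1.1 i = ∑ i, v.1.2 i := v.2
  simp only [shiftPoint, Finset.prod_mul_distrib, hs, h3, hv]
  ring

theorem shiftPoint_neg {M : ℕ} (q : ℂ) [NeZero q] (v : AdmShift M) (p : Param M) :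
    shiftPoint q v (shiftPoint q (-v) p) = p := by
  have hq : q ≠ 0 := NeZero.ne q
  ext i <;> simp [shiftPoint, zpow_ne_zero _ hq]

theorem analyticAt_shiftPoint {M : ℕ} (q : ℂ) (v : AdmShift M) (p : Param M) :
    AnalyticAt ℂ (shiftPoint q v) p := by
  refine AnalyticAt.prod ?_ ?_
  · refine analyticAt_pi_iff.2 fun i => analyticAt_const.mul ?_
    exact analyticAt_coordA i _
  · refine analyticAt_pi_iff.2 fun i => analyticAt_const.mul ?_
    exact analyticAt_coordB i _

theorem shiftFun_mem_holo (q : ℂ) [NeZero q] {M : ℕ} (v : AdmShift M) (f : Holo q M) :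
    shiftFun (shiftStable_paramVariety q M) v f.1 ∈ Holo q M := by
  intro p
  obtain ⟨F, hF, hfF⟩ := f.2 ⟨shiftPoint q v p, shiftStable_paramVariety q M v p p.2⟩
  refine ⟨fun x => F (shiftPoint q v x), hF.comp_of_eq (analyticAt_shiftPoint q v p.1) rfl, ?_⟩
  have hc : Continuous fun x : paramVariety q M =>
      (⟨shiftPoint q v x, shiftStable_paramVariety q M v x x.2⟩ : paramVariety q M) := by
    refine Continuous.subtype_mk ?_ _
    refine (continuous_iff_continuousAt.2 fun x => ?_ : Continuous (shiftPoint q v)).comp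
      continuous_subtype_val
    exact (analyticAt_shiftPoint q v x).continuousAt
  exact hc.continuousAt.eventually hfF

/-- The shift operators on holomorphic functions. -/
def shiftHolo (q : ℂ) [NeZero q] {M : ℕ} (v : AdmShift M) : Holo q M →ₐ[ℂ] Holo q M :=
  ((shiftFun (shiftStable_paramVariety q M) v).comp (Holo q M).val).codRestrict (Holo q M)
    (fun f => shiftFun_mem_holo q v f)

theorem shiftHolo_injective (q : ℂ) [NeZero q] {M : ℕ} (v : AdmShift M) :
    Function.Injective (shiftHolo q v) := by
  intro f g h
  ext p
  have h2 := congrArg (fun u : Holo q M => u.1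
    ⟨shiftPoint q (-v) p, shiftStable_paramVariety q M (-v) p p.2⟩) h
  have h3 : (⟨shiftPoint q v (shiftPoint q (-v) p), shiftStable_paramVariety q M v _
      (shiftStable_paramVariety q M (-v) p p.2)⟩ : paramVariety q M) = p :=
    Subtype.ext (shiftPoint_neg q v p)
  change f.1 _ = g.1 _ at h2
  rwa [h3] at h2

/-- A retraction of the open set of nonzero parameters onto the parameter variety. -/
def retract {M : ℕ} (q : ℂ) (p : Param M) : Param M :=
  (p.1, fun i => if i = 0 then (∏ j, p.1 j) / (q ^ 2 * ∏ j : Fin (M + 2), p.2 j.succ) else p.2 i)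

theorem retract_mem {M : ℕ} (q : ℂ) [NeZero q] (p : Param M) (h1 : ∀ i, p.1 i ≠ 0)
    (h2 : ∀ i, p.2 i ≠ 0) : retract q p ∈ paramVariety q M := by
  have hq : q ≠ 0 := NeZero.ne q
  have ha : ∏ j, p.1 j ≠ 0 := Finset.prod_ne_zero_iff.2 fun i _ => h1 i
  have hb : ∏ j : Fin (M + 2), p.2 j.succ ≠ 0 := Finset.prod_ne_zero_iff.2 fun i _ => h2 _
  refine ⟨h1, fun i => ?_, ?_⟩
  · by_cases hi : i = 0
    · simp only [retract, hi, if_true]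
      exact div_ne_zero ha (mul_ne_zero (pow_ne_zero _ hq) hb)
    · simpa [retract, hi] using h2 i
  · simp only [retract]
    rw [Fin.prod_univ_succ (n := M + 2) (f := fun i : Fin (M + 3) => if i = 0 then _ else _)]
    simp only [if_true, Fin.succ_ne_zero, if_false]
    field_simp

theorem retract_eq {M : ℕ} (q : ℂ) [NeZero q] (p : Param M) (hp : p ∈ paramVariety q M) :
    retract q p = p := by
  obtain ⟨h1, h2, h3⟩ := hp
  have hq : q ≠ 0 := NeZero.ne q
  have hb : ∏ j : Fin (M + 2), p.2 j.succ ≠ 0 := Finset.prod_ne_zero_iff.2 fun i _ => h2 _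
  refine Prod.ext rfl (funext fun i => ?_)
  by_cases hi : i = 0
  · subst hi
    simp only [retract, if_true]
    rw [h3, Fin.prod_univ_succ]
    field_simp
  · simp [retract, hi]

theorem analyticAt_retract {M : ℕ} (q : ℂ) [NeZero q] (p : Param M) (h2 : ∀ i, p.2 i ≠ 0) :
    AnalyticAt ℂ (retract q) p := by
  have hq : q ≠ 0 := NeZero.ne q
  have hb : ∏ j : Fin (M + 2), p.2 j.succ ≠ 0 := Finset.prod_ne_zero_iff.2 fun i _ => h2 _
  have hA : ∀ i, AnalyticAt ℂ (fun x : Param M => x.1 i) p := fun i =>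
    analyticAt_coordA i _
  have hB : ∀ i, AnalyticAt ℂ (fun x : Param M => x.2 i) p := fun i =>
    analyticAt_coordB i _
  refine AnalyticAt.prod analyticAt_fst (analyticAt_pi_iff.2 fun i => ?_)
  by_cases hi : i = 0
  · simp only [hi, if_true]
    refine AnalyticAt.div (Finset.analyticAt_fun_prod _ fun j _ => hA j)
      (analyticAt_const.mul (Finset.analyticAt_fun_prod _ fun j _ => hB _)) ?_
    exact mul_ne_zero (pow_ne_zero _ hq) hb
  · simpa only [hi, if_false] using hB i

theorem holo_exists_extension (q : ℂ) [NeZero q] {M : ℕ} (f : Holo q M) :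
    ∃ F : Param M → ℂ, AnalyticOnNhd ℂ F {p | (∀ i, p.1 i ≠ 0) ∧ ∀ i, p.2 i ≠ 0} ∧
      ∀ p : Param M, ∀ h : retract q p ∈ paramVariety q M, F p = f.1 ⟨retract q p, h⟩ := by
  classical
  refine ⟨fun p => if h : retract q p ∈ paramVariety q M then f.1 ⟨retract q p, h⟩ else 0,
    ?_, fun p h => dif_pos h⟩
  rintro p ⟨h1, h2⟩
  have hr := retract_mem q p h1 h2
  obtain ⟨G, hG, hfG⟩ := f.2 ⟨retract q p, hr⟩
  have han := analyticAt_retract q p h2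
  refine (hG.comp_of_eq han rfl : AnalyticAt ℂ (fun x => G (retract q x)) p).congr ?_
  rw [Filter.EventuallyEq, nhds_subtype_eq_comap, Filter.eventually_comap] at hfG
  have hmem : ∀ᶠ x : Param M in 𝓝 p, (∀ i, x.1 i ≠ 0) ∧ ∀ i, x.2 i ≠ 0 := by
    refine Filter.Eventually.and ?_ ?_
    · refine Filter.eventually_all.2 fun i => ?_
      exact ((continuous_apply i).comp continuous_fst).continuousAt.eventually_ne (h1 i)
    · refine Filter.eventually_all.2 fun i => ?_
      exact ((continuous_apply i).comp continuous_snd).continuousAt.eventually_ne (h2 i)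
  filter_upwards [han.continuousAt.eventually hfG, hmem] with x hx hx2
  have hxr := retract_mem q x hx2.1 hx2.2
  rw [dif_pos hxr]
  exact (hx ⟨_, hxr⟩ rfl).symm

/-- The parameter variety is connected and nonempty, so its holomorphic functions form an
integral domain. -/
instance instIsDomainHolo (q : ℂ) [NeZero q] (M : ℕ) : IsDomain (Holo q M) := by
  have hq : q ≠ 0 := NeZero.ne q
  set Ω : Set (Param M) := {p | (∀ i, p.1 i ≠ 0) ∧ ∀ i, p.2 i ≠ 0} with hΩ
  have hconn : IsPreconnected Ω := by
    have h0 : IsPreconnected ({0}ᶜ : Set ℂ) :=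
      (isConnected_compl_singleton_of_one_lt_rank (by simp) 0).isPreconnected
    have h1 : IsPreconnected (Set.univ.pi fun _ : Fin (M + 3) => ({0}ᶜ : Set ℂ)) :=
      isPreconnected_univ_pi fun _ => h0
    have h2 := h1.prod h1
    convert h2 using 1
    ext p
    simp [hΩ]
  have hnz : Nontrivial (Holo q M) := by
    refine ⟨⟨0, 1, fun h => ?_⟩⟩
    have hr := retract_mem (M := M) q (1, 1) (by simp) (by simp)
    have := congrArg (fun u : Holo q M => u.1 ⟨_, hr⟩) h
    exact zero_ne_one this
  have hnd : NoZeroDivisors (Holo q M) := by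
    refine ⟨fun {f g} hfg => ?_⟩
    by_contra hcon
    push Not at hcon
    obtain ⟨hf, hg⟩ := hcon
    obtain ⟨F, hF, hFf⟩ := holo_exists_extension q f
    obtain ⟨G, hG, hGg⟩ := holo_exists_extension q g
    obtain ⟨p, hp⟩ : ∃ p, f.1 p ≠ 0 := by
      by_contra h
      push Not at h
      exact hf (Subtype.ext (funext h))
    have hpΩ : p.1 ∈ Ω := ⟨p.2.1, p.2.2.1⟩
    have hrp : ∀ x : paramVariety q M, ∀ h : retract q x.1 ∈ paramVariety q M,
        (⟨retract q x.1, h⟩ : paramVariety q M) = x :=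
      fun x _ => Subtype.ext (retract_eq q x.1 x.2)
    have hFp : F p.1 ≠ 0 := by
      have hm : retract q p.1 ∈ paramVariety q M := retract_mem q _ p.2.1 p.2.2.1
      rw [hFf p.1 hm, hrp p hm]
      exact hp
    have hmem : ∀ᶠ x in 𝓝 p.1, x ∈ Ω := by
      refine Filter.Eventually.and ?_ ?_
      · refine Filter.eventually_all.2 fun i => ?_
        exact ((continuous_apply i).comp continuous_fst).continuousAt.eventually_ne (p.2.1 i)
      · refine Filter.eventually_all.2 fun i => ?_
        exact ((continuous_apply i).comp continuous_snd).continuousAt.eventually_ne (p.2.2.1 i)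
    have hG0 : G =ᶠ[𝓝 p.1] 0 := by
      filter_upwards [(hF p.1 hpΩ).continuousAt.eventually_ne hFp, hmem] with x hx hxΩ
      have hm := retract_mem q x hxΩ.1 hxΩ.2
      have h0 : f.1 ⟨_, hm⟩ * g.1 ⟨_, hm⟩ = 0 :=
        congrArg (fun u : Holo q M => u.1 ⟨_, hm⟩) hfg
      rw [← hFf x hm, ← hGg x hm] at h0
      exact (mul_eq_zero.1 h0).resolve_left hx
    have hGΩ := hG.eqOn_zero_of_preconnected_of_eventuallyEq_zero hconn hpΩ hG0
    apply hg
    refine Subtype.ext (funext fun x => ?_)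
    have hm : retract q x.1 ∈ paramVariety q M := retract_mem q _ x.2.1 x.2.2.1
    have h1 := hGΩ (⟨x.2.1, x.2.2.1⟩ : x.1 ∈ Ω)
    rw [hGg x.1 hm, hrp x hm] at h1
    exact h1
  exact NoZeroDivisors.to_isDomain _

/-- The field of meromorphic functions on the parameter variety. The variety is isomorphic to
`(ℂ \ {0}) ^ (2 M + 5)`, hence Stein, so every meromorphic function on it is a quotient of
holomorphic ones. -/
def Mero (q : ℂ) (M : ℕ) : Type := FractionRing (Holo q M)

instance instFieldMero (q : ℂ) [NeZero q] (M : ℕ) : Field (Mero q M) :=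
  inferInstanceAs (Field (FractionRing (Holo q M)))

instance instAlgebraHoloMero (q : ℂ) [NeZero q] (M : ℕ) : Algebra (Holo q M) (Mero q M) :=
  inferInstanceAs (Algebra (Holo q M) (FractionRing (Holo q M)))

instance instAlgebraMero (q : ℂ) [NeZero q] (M : ℕ) : Algebra ℂ (Mero q M) :=
  ((algebraMap (Holo q M) (Mero q M)).comp (algebraMap ℂ (Holo q M))).toAlgebra

instance instIsScalarTowerMero (q : ℂ) [NeZero q] (M : ℕ) :
    IsScalarTower ℂ (Holo q M) (Mero q M) :=
  IsScalarTower.of_algebraMap_eq fun _ => rfl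

instance instIsFractionRingMero (q : ℂ) [NeZero q] (M : ℕ) :
    IsFractionRing (Holo q M) (Mero q M) :=
  inferInstanceAs (IsFractionRing (Holo q M) (FractionRing (Holo q M)))

/-- The coordinate `a_i` as a meromorphic function. -/
def meroA (q : ℂ) [NeZero q] {M : ℕ} (i : Fin (M + 3)) : Mero q M :=
  algebraMap (Holo q M) (Mero q M) (holoA q i)

/-- The coordinate `b_i` as a meromorphic function. -/
def meroB (q : ℂ) [NeZero q] {M : ℕ} (i : Fin (M + 3)) : Mero q M :=
  algebraMap (Holo q M) (Mero q M) (holoB q i)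

/-- The shift operators on meromorphic functions. -/
def shiftMero (q : ℂ) [NeZero q] {M : ℕ} (v : AdmShift M) : Mero q M →ₐ[ℂ] Mero q M :=
  IsFractionRing.liftAlgHom (R := ℂ) (A := Holo q M) (K := Mero q M) (L := Mero q M)
    (g := (IsScalarTower.toAlgHom ℂ (Holo q M) (Mero q M)).comp (shiftHolo q v))
    ((IsFractionRing.injective (Holo q M) (Mero q M)).comp (shiftHolo_injective q v))

/-- The field of pseudo-constants inside the meromorphic functions. -/
def meroPseudoConstants (q : ℂ) [NeZero q] (M : ℕ) : Subfield (Mero q M) where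
  toSubring := pseudoConstants (shiftMero q)
  inv_mem' := fun x hx k l => by
    simp only [map_inv₀, (hx k l).1, (hx k l).2.1, (hx k l).2.2, and_self]

/-- The meromorphic function `Φ` has no poles at generic parameters, and its values there are those
of `f`. -/
def Represents {q : ℂ} [NeZero q] {M : ℕ} (Φ : Mero q M) (f : Param M → ℂ) : Prop :=
  ∃ g h : Holo q M, Φ = algebraMap (Holo q M) (Mero q M) g / algebraMap (Holo q M) (Mero q M) h ∧
    ∀ p : paramVariety q M, p.1 ∈ genericParams q M → h.1 p ≠ 0 ∧ f p.1 = g.1 p / h.1 p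

end

/-! Write T = T_{a_1} T_{b_1}. The ratio a_1/b_1 is T-invariant, so Ê_M = P(T) T⁻¹ for a polynomial
P (`hatPoly`) of degree at most M + 1, whose coefficients of degree 0 and M + 1 factor explicitly
and do not vanish at generic parameters (`coeff_zero_hatPoly`, `coeff_top_hatPoly`). Thus Ê_M y = 0
is a recurrence of order exactly M + 1 along T, and the equations for T_{a_1} T_{a_k}⁻¹ and T_{b_k}
T_{b_1}⁻¹ express the other generating shifts of y through y, Ty and T⁻¹y. As for linear
differential equations, M + 1 solutions with invertible Casorati determinant are then a basis over
the pseudo-constants (`linearIndependent_of_casorati`, `isSolutionRP_iff_mem_span`). It remains to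
see that the Jackson integrals are solutions and that their Casorati determinant vanishes nowhere.

Solutions. The integrand f vanishes at t = q^n/a_i for n ≤ 0, so ∫_0^{q/a_i} is a sum over the whole
lattice q^ℤ/a_i, which no shift moves (`jacksonZero_scaleParam`). T_{a_k}⁻¹ and T_{b_k} multiply f
by linear polynomials in t, and each three-term equation is an identity between such polynomials.
Along T the integrand satisfies a first order recurrence, on which P acts in closed form
(`IsQGeometric.sum_coeff_hatPoly`); the result is a q-difference of an explicit primitive. For i ≠ 1
the lattice sum therefore collapses to a boundary value at t = 0 that does not depend on i, and
differences of two such sums are killed by Ê_M (`sum_coeff_latticeSum`).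

Nonvanishing. If the determinant vanished at a point, a nontrivial combination y of the integrals
with complex coefficients would vanish at M + 1 consecutive points of its orbit. Then y vanishes on
the whole orbit (`IsOrbitSolution.eq_zero`): the recurrence gives the T-line, the contiguity
relations give the neighbouring lines, and the closed form for P makes these steps reversible. So
some relation ∑ d_i ∑_{t ∈ q^ℤ/a_i} t f(t) = 0 with d_1 = 0 holds for all admissible shifts. It
implies the same relation with t² f(t)/(1 - a_k q^j t) in place of t f(t). As j → ∞ the point t =
q^{-j}/a_k contributes a nonzero limit E_k, and all other terms have a sum whose limit S does not
depend on k. Hence d_k E_k + S = 0 for every k; k = 1 gives S = 0, and then all d_k = 0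
(`eq_zero_of_sum_latticeSum`).

Meromorphic version. Up to the factor ∏_k (q b_k/a_i)_∞, which has no zero at generic parameters,
each one-sided integral is analytic in the parameters (`exists_analytic_jacksonZero`). In the
algebra `genericMero` of pairs (meromorphic function, its values at generic parameters) both
projections are injective, so the equations and the nonvanishing of the determinant pass from
functions on the generic set to meromorphic functions. -/

noncomputable section

open Polynomial

/-! ## The operator `Ê_M` in expanded form -/

section Expand

variable {M : ℕ} {R : Type*} [CommRing R] [Algebra ℂ R]

/-- The polynomial `∏_{i=0}^{n-1} (1 - c q^i X)`. -/
def linFac (q : ℂ) (c : R) (n : ℕ) : R[X] := ∏ i ∈ Finset.range n, (1 - C (q ^ i • c) * X)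

/-- The polynomial `P` such that `Ê_M = P(T) T⁻¹`, where `c = a_1 / b_1`. -/
def hatPoly (q : ℂ) (a b : Fin (M + 3) → R) (c : R) : R[X] :=
  C (b 0 ^ (M + 2)) * linFac q c (M + 1)
  + ∑ k ∈ Finset.Icc 1 (M + 1),
      (C ((-1) ^ k * b 0 ^ (M + 2 - k) *
          (Finset.univ.val.map fun i : Fin (M + 2) => a i.succ).esymm k)
        - C ((-1) ^ k * b 0 ^ (M + 2 - k) *
          (q • (Finset.univ.val.map fun i : Fin (M + 2) => b i.succ).esymm k)) * X) *
        linFac q c (M + 1 - k) * linFac q⁻¹ 1 (k - 1)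
  + C ((-1) ^ M * ∏ i : Fin (M + 2), a i.succ) * linFac q⁻¹ 1 (M + 1)

theorem linFac_succ (q : ℂ) (c : R) (n : ℕ) :
    linFac q c (n + 1) = linFac q c n * (1 - C (q ^ n • c) * X) :=
  Finset.prod_range_succ _ _

theorem natDegree_linFac_le (q : ℂ) (c : R) (n : ℕ) : (linFac q c n).natDegree ≤ n := by
  refine (natDegree_prod_le _ _).trans ((Finset.sum_le_card_nsmul _ _ 1 fun i _ => ?_).trans ?_)
  · refine (natDegree_sub_le _ _).trans ?_
    simp only [natDegree_one, zero_le, max_eq_right]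
    exact (natDegree_C_mul_le _ _).trans natDegree_X_le
  · simp

theorem natDegree_hatPoly_le (q : ℂ) (a b : Fin (M + 3) → R) (c : R) :
    (hatPoly q a b c).natDegree ≤ M + 1 := by
  refine natDegree_add_le_of_degree_le (natDegree_add_le_of_degree_le ?_ ?_) ?_
  · exact (natDegree_C_mul_le _ _).trans (natDegree_linFac_le _ _ _)
  · refine natDegree_sum_le_of_forall_le _ _ fun k hk => ?_
    rw [Finset.mem_Icc] at hk
    refine (natDegree_mul_le_of_le (natDegree_mul_le_of_le (m := 1) ?_
      (natDegree_linFac_le _ _ _)) (natDegree_linFac_le _ _ _)).trans (by omega)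
    refine (natDegree_sub_le _ _).trans ?_
    simp only [natDegree_C, zero_le, max_eq_right]
    exact (natDegree_C_mul_le _ _).trans natDegree_X_le
  · exact (natDegree_C_mul_le _ _).trans (natDegree_linFac_le _ _ _)

theorem map_linFac {R' : Type*} [CommRing R'] [Algebra ℂ R'] (f : R →ₐ[ℂ] R') (q : ℂ) (c : R)
    (n : ℕ) : (linFac q c n).map (f : R →+* R') = linFac q (f c) n := by
  simp [linFac, Polynomial.map_prod]

theorem map_esymm_apply {R' : Type*} [CommRing R'] [Algebra ℂ R'] (f : R →ₐ[ℂ] R') {n : ℕ}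
    (u : Fin n → R) (k : ℕ) : f ((Finset.univ.val.map u).esymm k) =
      (Finset.univ.val.map fun i => f (u i)).esymm k := by
  rw [Finset.esymm_map_val, Finset.esymm_map_val]
  simp

/-- This naturality transports the coefficients of Ê_M between function algebras, and to their
values at a single point. -/
theorem map_hatPoly {R' : Type*} [CommRing R'] [Algebra ℂ R'] (f : R →ₐ[ℂ] R') (q : ℂ)
    (a b : Fin (M + 3) → R) (c : R) : (hatPoly q a b c).map (f : R →+* R') =
      hatPoly q (fun i => f (a i)) (fun i => f (b i)) (f c) := by
  have hC : ∀ x : R, (C x).map (f : R →+* R') = C (f x) := fun x => map_C _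
  simp only [hatPoly, Polynomial.map_add, Polynomial.map_mul, Polynomial.map_sum,
    Polynomial.map_sub, map_linFac, hC, map_X, map_one]
  simp only [map_mul f, map_pow f, map_neg f, map_one f, map_smul f, map_prod f, map_esymm_apply]

variable {σ : AdmShift M → R →ₐ[ℂ] R}

/-- The shifts act as a group. -/
structure IsShiftAction (σ : AdmShift M → R →ₐ[ℂ] R) : Prop where
  zero : ∀ y, σ 0 y = y
  add : ∀ v w y, σ (v + w) y = σ v (σ w y)

theorem IsShiftAction.neg_apply (h : IsShiftAction σ) {v : AdmShift M} {c : R} (hc : σ v c = c) :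
    σ (-v) c = c := by
  conv_lhs => rw [← hc]
  rw [← h.add, neg_add_cancel, h.zero]

theorem IsShiftAction.pow_apply (h : IsShiftAction σ) (v : AdmShift M) (n : ℕ) (y : R) :
    ((σ v).toLinearMap ^ n) y = σ (n • v) y := by
  induction n with
  | zero => simp [h.zero]
  | succ n ih => rw [pow_succ', Module.End.mul_apply, ih, succ_nsmul', h.add]; rfl

theorem commute_lmul_of_fixed {v : AdmShift M} {c : R} (hc : σ v c = c) :
    Commute (Algebra.lmul ℂ R c : Module.End ℂ R) (σ v).toLinearMap := by
  ext y
  simp [hc]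

theorem coeff_linFac_fixed {v : AdmShift M} {c : R} (hc : σ v c = c) (q : ℂ) (n k : ℕ) :
    σ v ((linFac q c n).coeff k) = (linFac q c n).coeff k := by
  have := congrArg (fun p => p.coeff k) (map_linFac (σ v) q c n)
  simpa [coeff_map, hc] using this

/-- The `R`-linear map substituting the operator `T` into a polynomial, coefficients to the left. -/
def evalOp (T : Module.End ℂ R) (P : R[X]) : Module.End ℂ R :=
  P.eval₂ (Algebra.lmul ℂ R : R →+* Module.End ℂ R) T

/-- T does not commute with multiplication operators, so substitution of T is not multiplicative in
general. It is when the coefficients of the right factor are T-invariant. -/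
theorem evalOp_mul {v : AdmShift M} (P Q : R[X]) (hQ : ∀ k, σ v (Q.coeff k) = Q.coeff k) :
    evalOp (σ v).toLinearMap (P * Q) =
      evalOp (σ v).toLinearMap P * evalOp (σ v).toLinearMap Q :=
  eval₂_mul_noncomm _ _ fun k => commute_lmul_of_fixed (hQ k)

theorem evalOp_linFac {v : AdmShift M} {c : R} (hc : σ v c = c) (q : ℂ) (n : ℕ) :
    evalOp (σ v).toLinearMap (linFac q c n) = prodOp q c (σ v).toLinearMap n := by
  induction n with
  | zero => simp [evalOp, linFac, prodOp]
  | succ n ih =>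
    rw [linFac_succ, evalOp_mul, ih, prodOp, prodOp, List.range_succ, List.map_append,
      List.prod_append]
    · congr 1
      simp only [evalOp, eval₂_sub, eval₂_one, C_mul_X_eq_monomial, eval₂_monomial, pow_one,
        List.map_cons, List.map_nil, List.prod_cons, List.prod_nil, mul_one]
      rfl
    · intro k
      have := coeff_linFac_fixed (q := 1) (c := q ^ n • c) (n := 1) (k := k) (σ := σ) (v := v)
        (by simp [hc])
      simpa [linFac] using this

theorem evalOp_commute {v w : AdmShift M} (h : IsShiftAction σ) (P : R[X])
    (hP : ∀ k, σ w (P.coeff k) = P.coeff k) :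
    Commute (evalOp (σ v).toLinearMap P) (σ w).toLinearMap := by
  have hc : Commute (σ v).toLinearMap (σ w).toLinearMap := by
    ext y
    simp [← h.add, add_comm]
  unfold evalOp
  rw [eval₂_eq_sum]
  refine (Finset.sum_induction _ (fun f => Commute f (σ w).toLinearMap) (fun _ _ => Commute.add_left)
    (Commute.zero_left _) fun k _ => ?_)
  exact (commute_lmul_of_fixed (hP k)).mul_left (hc.pow_left k)

/-- In Ê_M the operator T⁻¹ stands to the left of the products. These have T-invariant coefficients,
so T⁻¹ can be moved to the far right. The terms q e_k(b̂), which carry no T⁻¹, are written with T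
T⁻¹ and become the X-terms of `hatPoly`. -/
theorem hatE_eq_evalOp [Div R] (h : IsShiftAction σ) (q : ℂ) (a b : Fin (M + 3) → R)
    (hc : σ (shAB 0 0) (a 0 / b 0) = a 0 / b 0) :
    hatE q σ a b = evalOp (σ (shAB 0 0)).toLinearMap (hatPoly q a b (a 0 / b 0)) *
      (σ (-shAB 0 0)).toLinearMap := by
  set T := (σ (shAB 0 0)).toLinearMap with hT
  set S := (σ (-shAB 0 0)).toLinearMap with hS
  have hTS : T * S = 1 := by
    ext y
    simp [hT, hS, ← h.add, h.zero]
  have h1 : ∀ v, σ v (1 : R) = 1 := fun v => map_one _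
  have hc' := h.neg_apply hc
  have e1 : ∀ n, evalOp T (linFac q (a 0 / b 0) n) = prodOp q (a 0 / b 0) T n :=
    fun n => evalOp_linFac hc q n
  have e2 : ∀ n, evalOp T (linFac q⁻¹ 1 n) = prodOp q⁻¹ 1 T n :=
    fun n => evalOp_linFac (h1 _) q⁻¹ n
  have c1 : ∀ n, Commute (prodOp q (a 0 / b 0) T n) S := fun n => by
    rw [← e1]; exact evalOp_commute h _ (coeff_linFac_fixed hc' q n)
  have c2 : ∀ n, Commute (prodOp q⁻¹ 1 T n) S := fun n => by
    rw [← e2]; exact evalOp_commute h _ (coeff_linFac_fixed (h1 _) q⁻¹ n)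
  have m1 : ∀ P n, evalOp T (P * linFac q (a 0 / b 0) n) =
      evalOp T P * prodOp q (a 0 / b 0) T n := fun P n => by
    rw [← e1]; exact evalOp_mul _ _ (coeff_linFac_fixed hc q n)
  have m2 : ∀ P n, evalOp T (P * linFac q⁻¹ 1 n) =
      evalOp T P * prodOp q⁻¹ 1 T n := fun P n => by
    rw [← e2]; exact evalOp_mul _ _ (coeff_linFac_fixed (h1 _) q⁻¹ n)
  have hadd : ∀ P Q, evalOp T (P + Q) = evalOp T P + evalOp T Q := fun P Q => eval₂_add _ _
  have hC : ∀ r : R, evalOp T (C r) = LinearMap.mulLeft ℂ r := fun r => eval₂_C _ _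
  have hCX : ∀ r s : R, evalOp T (C r - C s * X) =
      LinearMap.mulLeft ℂ r - LinearMap.mulLeft ℂ s * T := fun r s => by
    simp only [evalOp, eval₂_sub, eval₂_C]
    congr 1
    rw [C_mul_X_eq_monomial, eval₂_monomial, pow_one]
    rfl
  have hsum : ∀ (s : Finset ℕ) (f : ℕ → R[X]), evalOp T (∑ k ∈ s, f k) =
      ∑ k ∈ s, evalOp T (f k) := fun s f => eval₂_finsetSum _ _ _ _
  have hmul : ∀ r s : R, LinearMap.mulLeft ℂ (r * s) =
      LinearMap.mulLeft ℂ r * LinearMap.mulLeft ℂ s := fun r s =>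
    LinearMap.mulLeft_mul ℂ R r s
  unfold hatE hatPoly
  simp only [hadd, m1, m2, hC, hCX, hsum]
  simp only [add_mul, Finset.sum_mul, ← hT, ← hS]
  refine congrArg₂ _ (congrArg₂ _ ?_ (Finset.sum_congr rfl fun k _ => ?_)) ?_
  · rw [mul_assoc, mul_assoc, (c1 _).eq]
  · rw [mul_assoc (_ * _) (prodOp q⁻¹ 1 T _) S, (c2 _).eq, ← mul_assoc, mul_assoc _ _ S, (c1 _).eq,
      ← mul_assoc]
    congr 2
    rw [sub_mul, mul_assoc _ T S, hTS, mul_one, hmul _ (Multiset.esymm _ _), hmul _ (q • _),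
      mul_sub, mul_assoc]
  · rw [mul_assoc, mul_assoc, (c2 _).eq]

theorem hatE_apply [Div R] (h : IsShiftAction σ) (q : ℂ) (a b : Fin (M + 3) → R)
    (hc : σ (shAB 0 0) (a 0 / b 0) = a 0 / b 0) (y : R) :
    hatE q σ a b y = ∑ j ∈ Finset.range (M + 2), (hatPoly q a b (a 0 / b 0)).coeff j *
      σ (((j : ℤ) - 1) • shAB 0 0) y := by
  rw [hatE_eq_evalOp h q a b hc, Module.End.mul_apply, evalOp,
    eval₂_eq_sum_range' _ (Nat.lt_succ_of_le (natDegree_hatPoly_le q a b _))]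
  rw [LinearMap.sum_apply]
  refine Finset.sum_congr rfl fun j _ => ?_
  rw [Module.End.mul_apply, h.pow_apply, AlgHom.toLinearMap_apply, ← h.add]
  have : j • shAB 0 0 + -shAB (M := M) 0 0 = ((j : ℤ) - 1) • shAB 0 0 := by
    rw [sub_smul, one_smul, natCast_zsmul, sub_eq_add_neg]
  rw [this]
  rfl

end Expand

/-! ## The space of solutions over the pseudo-constants -/

section Abstract

variable {M : ℕ} {R : Type*} [CommRing R] [Algebra ℂ R] {σ : AdmShift M → R →ₐ[ℂ] R}

/-- The shifts by `T_{a_1} T_{b_1}`, `T_{a_1} T_{a_k}⁻¹` and `T_{b_k} T_{b_1}⁻¹` generate all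
admissible shifts. -/
theorem admShift_induction {p : AdmShift M → Prop} (h0 : p 0) (hadd : ∀ v w, p v → p w → p (v + w))
    (hneg : ∀ v, p v → p (-v)) (hT : p (shAB 0 0)) (hA : ∀ k, k ≠ 0 → p (shAA 0 k))
    (hB : ∀ k, k ≠ 0 → p (shBB k 0)) (v : AdmShift M) : p v := by
  let S : AddSubgroup (AdmShift M) :=
    { carrier := {v | p v}
      zero_mem' := h0
      add_mem' := fun {v w} hv hw => hadd v w hv hw
      neg_mem' := fun {v} hv => hneg v hv }
  have hA' : ∀ k, shAA 0 k ∈ S := fun k => by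
    by_cases hk : k = 0
    · have : shAA (M := M) 0 k = 0 := by subst hk; ext <;> simp [shAA]
      rw [this]; exact S.zero_mem
    · exact hA k hk
  have hB' : ∀ k, shBB k 0 ∈ S := fun k => by
    by_cases hk : k = 0
    · have : shBB (M := M) k 0 = 0 := by subst hk; ext <;> simp [shBB]
      rw [this]; exact S.zero_mem
    · exact hB k hk
  have hT' : shAB 0 0 ∈ S := hT
  -- The exponents of a_1 cancel identically; those of b_1 cancel because the two total exponents of
  -- an admissible shift agree.
  have hv : v = (∑ k, v.1.1 k) • shAB 0 0 - ∑ k, v.1.1 k • shAA 0 k + ∑ k, v.1.2 k • shBB k 0 := by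
    have h2 : ∑ k, v.1.1 k = ∑ k, v.1.2 k := v.2
    have e1 : ∀ i, ∑ x, v.1.1 x * (Pi.single x 1 : Fin (M + 3) → ℤ) i = v.1.1 i := fun i => by
      simp [Pi.single_apply]
    have e2 : ∀ i, ∑ x, v.1.2 x * (Pi.single x 1 : Fin (M + 3) → ℤ) i = v.1.2 i := fun i => by
      simp [Pi.single_apply]
    refine Subtype.ext (Prod.ext (funext fun i => ?_) (funext fun i => ?_))
    · simp [shAA, shBB, shAB, Prod.fst_sum, Finset.sum_apply, mul_sub, Finset.sum_sub_distrib, e1,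
        ← Finset.sum_mul]
    · simp [shAA, shBB, shAB, Prod.snd_sum, Finset.sum_apply, mul_sub, Finset.sum_sub_distrib, e2,
        ← Finset.sum_mul, h2]
  have : v ∈ S := by
    rw [hv]
    exact S.add_mem (S.sub_mem (S.zsmul_mem hT' _) (S.sum_mem fun k _ => S.zsmul_mem (hA' k) _))
      (S.sum_mem fun k _ => S.zsmul_mem (hB' k) _)
  exact this

theorem IsPseudoConstant.shift_eq (h : IsShiftAction σ) {C : R} (hC : IsPseudoConstant σ C)
    (v : AdmShift M) : σ v C = C := by
  refine admShift_induction (p := fun v => σ v C = C) (h.zero C) (fun v w hv hw => ?_)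
    (fun v hv => h.neg_apply hv) (hC 0 0).2.2 (fun k _ => (hC 0 k).1) (fun k _ => (hC k 0).2.1) v
  rw [h.add, hw, hv]

/-- The Casorati matrix `(T^j φ_i)_{j, i}` for `T = T_{a_1} T_{b_1}`. -/
def casorati (σ : AdmShift M → R →ₐ[ℂ] R) (φ : Fin (M + 1) → R) :
    Matrix (Fin (M + 1)) (Fin (M + 1)) R :=
  Matrix.of fun j i => σ ((j : ℕ) • shAB 0 0) (φ i)

theorem eq_zero_of_isUnit_det {R : Type*} [CommRing R] {n : ℕ} {W : Matrix (Fin n) (Fin n) R}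
    (hW : IsUnit W.det) {C : Fin n → R} (hC : ∀ j, ∑ i, C i * W j i = 0) (i : Fin n) : C i = 0 := by
  have h1 : W.mulVec C = 0 := funext fun j => by
    simpa [Matrix.mulVec, dotProduct, mul_comm] using hC j
  have h2 : (W⁻¹ * W).mulVec C = 0 := by rw [← Matrix.mulVec_mulVec, h1, Matrix.mulVec_zero]
  rw [Matrix.nonsing_inv_mul W hW, Matrix.one_mulVec] at h2
  exact congrFun h2 i

theorem isUnit_det_map_casorati {φ : Fin (M + 1) → R} (hW : IsUnit (casorati σ φ).det)
    (v : AdmShift M) : IsUnit ((casorati σ φ).map (σ v)).det := by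
  have := hW.map (σ v)
  rwa [AlgHom.map_det] at this

theorem linearIndependent_of_casorati (h : IsShiftAction σ) {φ : Fin (M + 1) → R}
    (hW : IsUnit (casorati σ φ).det) : LinearIndependent (pseudoConstants σ) φ := by
  rw [Fintype.linearIndependent_iff]
  intro g hg i
  refine Subtype.ext (eq_zero_of_isUnit_det hW (C := fun i => (g i : R)) (fun j => ?_) i)
  have := congrArg (σ ((j : ℕ) • shAB 0 0)) hg
  rw [map_sum, map_zero] at this
  rw [← this]
  refine Finset.sum_congr rfl fun i _ => ?_
  have h1 : g i • φ i = (g i : R) * φ i := rfl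
  rw [h1, map_mul, (show IsPseudoConstant σ (g i : R) from (g i).2).shift_eq h]
  rfl

variable [Div R] {q : ℂ} {a b : Fin (M + 3) → R}

/-- The system is polynomial in the coordinates, their one quotient a_1/b_1 and the shifts, so an
injective equivariant map both preserves and reflects solutions. Compatibility with division is
needed for that quotient only. -/
theorem isSolutionRP_iff_of_injective {R' : Type*} [CommRing R'] [Algebra ℂ R'] [Div R']
    {σ' : AdmShift M → R' →ₐ[ℂ] R'} {a' b' : Fin (M + 3) → R'} (h : IsShiftAction σ)
    (h' : IsShiftAction σ') (hc : σ (shAB 0 0) (a 0 / b 0) = a 0 / b 0)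
    (ι : R →ₐ[ℂ] R') (hι : Function.Injective ι) (hσ : ∀ v y, ι (σ v y) = σ' v (ι y))
    (ha : ∀ i, ι (a i) = a' i) (hb : ∀ i, ι (b i) = b' i) (hdiv : ι (a 0 / b 0) = a' 0 / b' 0)
    (y : R) : IsSolutionRP q σ a b y ↔ IsSolutionRP q σ' a' b' (ι y) := by
  have hc' : σ' (shAB 0 0) (a' 0 / b' 0) = a' 0 / b' 0 := by rw [← hdiv, ← hσ, hc]
  have hE : hatE q σ' a' b' (ι y) = ι (hatE q σ a b y) := by
    rw [hatE_apply h' q a' b' hc', hatE_apply h q a b hc, map_sum]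
    refine Finset.sum_congr rfl fun j _ => ?_
    have := congrArg (fun P => P.coeff j) (map_hatPoly ι q a b (a 0 / b 0))
    rw [map_mul, hσ]
    simp only [coeff_map, ha, hb, hdiv] at this
    rw [← this]
    rfl
  have key : ∀ x : R, x = 0 ↔ ι x = 0 := fun x => (map_eq_zero_iff ι hι).symm
  constructor
  · rintro ⟨h1, h2, h3, h4, h5, h6, h7, h8⟩
    refine ⟨by rw [hE, h1, map_zero], fun k l hk hl hkl => ?_, fun k hk => ?_,
      fun k l hk hl hkl => ?_, fun k hk => ?_, fun k l hk hl hkl => ?_, fun k l hk hl hkl => ?_, ?_⟩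
    · simpa [ha, hb, hσ] using congrArg ι (h2 k l hk hl hkl)
    · simpa [ha, hb, hσ] using congrArg ι (h3 k hk)
    · simpa [ha, hb, hσ] using congrArg ι (h4 k l hk hl hkl)
    · simpa [ha, hb, hσ] using congrArg ι (h5 k hk)
    · simpa [ha, hb, hσ] using congrArg ι (h6 k l hk hl hkl)
    · simpa [ha, hb, hσ] using congrArg ι (h7 k l hk hl hkl)
    · simpa [ha, hb, hσ] using congrArg ι h8
  · rintro ⟨h1, h2, h3, h4, h5, h6, h7, h8⟩
    refine ⟨by rw [key, ← hE, h1], fun k l hk hl hkl => ?_, fun k hk => ?_,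
      fun k l hk hl hkl => ?_, fun k hk => ?_, fun k l hk hl hkl => ?_, fun k l hk hl hkl => ?_, ?_⟩
    · rw [key]; simpa [ha, hb, hσ] using h2 k l hk hl hkl
    · rw [key]; simpa [ha, hb, hσ] using h3 k hk
    · rw [key]; simpa [ha, hb, hσ] using h4 k l hk hl hkl
    · rw [key]; simpa [ha, hb, hσ] using h5 k hk
    · rw [key]; simpa [ha, hb, hσ] using h6 k l hk hl hkl
    · rw [key]; simpa [ha, hb, hσ] using h7 k l hk hl hkl
    · rw [key]; simpa [ha, hb, hσ] using h8

theorem IsSolutionRP.zero : IsSolutionRP q σ a b 0 := by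
  refine ⟨map_zero _, ?_, ?_, ?_, ?_, ?_, ?_, ?_⟩ <;> intros <;> simp

theorem IsSolutionRP.add {y z : R} (hy : IsSolutionRP q σ a b y) (hz : IsSolutionRP q σ a b z) :
    IsSolutionRP q σ a b (y + z) := by
  obtain ⟨h1, h2, h3, h4, h5, h6, h7, h8⟩ := hy
  obtain ⟨k1, k2, k3, k4, k5, k6, k7, k8⟩ := hz
  refine ⟨by rw [map_add, h1, k1, add_zero], fun k l hk hl hkl => ?_, fun k hk => ?_,
    fun k l hk hl hkl => ?_, fun k hk => ?_, fun k l hk hl hkl => ?_, fun k l hk hl hkl => ?_, ?_⟩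
  · rw [map_add, map_add]; linear_combination h2 k l hk hl hkl + k2 k l hk hl hkl
  · rw [map_add, map_add]; linear_combination h3 k hk + k3 k hk
  · rw [map_add, map_add]; linear_combination h4 k l hk hl hkl + k4 k l hk hl hkl
  · rw [map_add, map_add]; linear_combination h5 k hk + k5 k hk
  · rw [map_add, map_add]; linear_combination h6 k l hk hl hkl + k6 k l hk hl hkl
  · rw [map_add, map_add]; linear_combination h7 k l hk hl hkl + k7 k l hk hl hkl
  · rw [map_add, smul_add]; linear_combination h8 + k8

theorem IsSolutionRP.mul {y C : R} (h : IsShiftAction σ)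
    (hc : σ (shAB 0 0) (a 0 / b 0) = a 0 / b 0) (hC : IsPseudoConstant σ C)
    (hy : IsSolutionRP q σ a b y) : IsSolutionRP q σ a b (C * y) := by
  have hv : ∀ v, σ v (C * y) = C * σ v y := fun v => by rw [map_mul, hC.shift_eq h]
  obtain ⟨h1, h2, h3, h4, h5, h6, h7, h8⟩ := hy
  refine ⟨?_, fun k l hk hl hkl => ?_, fun k hk => ?_,
    fun k l hk hl hkl => ?_, fun k hk => ?_, fun k l hk hl hkl => ?_, fun k l hk hl hkl => ?_, ?_⟩
  · rw [hatE_apply h q a b hc] at h1 ⊢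
    rw [← mul_zero C, ← h1, Finset.mul_sum]
    refine Finset.sum_congr rfl fun j _ => ?_
    rw [hv, mul_left_comm]
  · rw [hv, hv]; linear_combination C * h2 k l hk hl hkl
  · rw [hv, hv]; linear_combination C * h3 k hk
  · rw [hv, hv]; linear_combination C * h4 k l hk hl hkl
  · rw [hv, hv]; linear_combination C * h5 k hk
  · rw [hv, hv]; linear_combination C * h6 k l hk hl hkl
  · rw [hv, hv]; linear_combination C * h7 k l hk hl hkl
  · rw [hv, ← mul_smul_comm]; linear_combination C * h8

/-- Variation of constants: the C_i are defined by Cramer's rule from the first M + 1 powers of T.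
The recurrence makes them T-invariant, the contiguity relations make them invariant under the other
generating shifts. -/
theorem exists_isPseudoConstant_of_isSolutionRP (h : IsShiftAction σ)
    (hc : σ (shAB 0 0) (a 0 / b 0) = a 0 / b 0)
    (hu : IsUnit ((hatPoly q a b (a 0 / b 0)).coeff (M + 1))) (hab : IsUnit (b 0 - a 0))
    {φ : Fin (M + 1) → R} (hφ : ∀ i, IsSolutionRP q σ a b (φ i))
    (hW : IsUnit (casorati σ φ).det) {y : R} (hy : IsSolutionRP q σ a b y) :
    ∃ C : Fin (M + 1) → R, (∀ i, IsPseudoConstant σ (C i)) ∧ y = ∑ i, C i * φ i := by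
  set W := casorati σ φ with hWdef
  obtain ⟨C, hC⟩ : ∃ C : Fin (M + 1) → R, ∀ j : Fin (M + 1),
      ∑ i, C i * σ ((j : ℕ) • shAB 0 0) (φ i) = σ ((j : ℕ) • shAB 0 0) y := by
    refine ⟨W⁻¹.mulVec fun j => σ ((j : ℕ) • shAB 0 0) y, fun j => ?_⟩
    have h1 : W.mulVec (W⁻¹.mulVec fun j : Fin (M + 1) => σ ((j : ℕ) • shAB 0 0) y) =
        fun j : Fin (M + 1) => σ ((j : ℕ) • shAB 0 0) y := by
      rw [Matrix.mulVec_mulVec, Matrix.mul_nonsing_inv W hW, Matrix.one_mulVec]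
    have h2 := congrFun h1 j
    simp only [Matrix.mulVec, dotProduct] at h2 ⊢
    rw [← h2]
    refine Finset.sum_congr rfl fun i _ => ?_
    rw [mul_comm, hWdef]
    rfl
  set T : AdmShift M := shAB 0 0 with hT
  have hCn : ∀ j : ℕ, j < M + 1 → ∑ i, C i * σ (j • T) (φ i) = σ (j • T) y := fun j hj =>
    hC ⟨j, hj⟩
  have hCs : ∀ {v : AdmShift M} {j : ℕ}, j < M + 1 →
      ∑ i, σ v (C i) * σ (v + j • T) (φ i) = σ (v + j • T) y := fun {v j} hj => by
    rw [h.add, ← hCn j hj, map_sum]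
    exact Finset.sum_congr rfl fun i _ => by rw [map_mul, h.add]
  -- Applying σ v to the defining equations gives the same system with σ v (C i) as coefficients;
  -- its matrix, the shifted Casorati matrix, is still invertible.
  have hinv : ∀ v, (∀ j < M + 1, ∑ i, C i * σ (v + j • T) (φ i) = σ (v + j • T) y) →
      ∀ i, σ v (C i) = C i := fun v hv i => by
    refine sub_eq_zero.1 (eq_zero_of_isUnit_det (isUnit_det_map_casorati hW v)
      (C := fun i => σ v (C i) - C i) (fun j => ?_) i)
    have e : ∀ i, (W.map (σ v)) j i = σ (v + (j : ℕ) • T) (φ i) := fun i => by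
      rw [h.add]; rfl
    have h1 := hCs (v := v) j.2
    have h2 := hv j j.2
    simp only [← e] at h1 h2
    simp only [sub_mul, Finset.sum_sub_distrib]
    rw [h1, h2, sub_self]
  have hTC : ∀ i, σ T (C i) = C i := by
    refine hinv T fun j hj => ?_
    rw [← succ_nsmul']
    rcases Nat.lt_or_ge (j + 1) (M + 1) with hj' | hj'
    · exact hCn _ hj'
    obtain rfl : j = M := by omega
    set e := fun k => (hatPoly q a b (a 0 / b 0)).coeff k with he
    -- One application of T clears the T⁻¹, so the recurrence involves the powers 0, …, M + 1; its
    -- top coefficient is a unit and yields the one missing power.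
    have hrec : ∀ z, IsSolutionRP q σ a b z →
        ∑ k ∈ Finset.range (j + 2), σ T (e k) * σ (k • T) z = 0 := fun z hz => by
      have h1 := congrArg (σ T) hz.eqE
      rw [hatE_apply h q a b hc, map_sum, map_zero] at h1
      rw [← h1]
      refine Finset.sum_congr rfl fun k _ => ?_
      rw [map_mul, ← h.add]
      congr 3
      rw [sub_smul, one_smul, natCast_zsmul, add_sub_cancel]
    have hy' := hrec y hy
    have hφ' : ∑ i, C i * ∑ k ∈ Finset.range (j + 2), σ T (e k) * σ (k • T) (φ i) = 0 :=
      Finset.sum_eq_zero fun i _ => by rw [hrec _ (hφ i), mul_zero]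
    simp only [Finset.mul_sum] at hφ'
    rw [Finset.sum_comm, Finset.sum_range_succ] at hφ'
    rw [Finset.sum_range_succ] at hy'
    have h3 : ∑ k ∈ Finset.range (j + 1), ∑ i, C i * (σ T (e k) * σ (k • T) (φ i)) =
        ∑ k ∈ Finset.range (j + 1), σ T (e k) * σ (k • T) y := by
      refine Finset.sum_congr rfl fun k hk => ?_
      rw [← hCn k (Finset.mem_range.1 hk), Finset.mul_sum]
      exact Finset.sum_congr rfl fun i _ => mul_left_comm _ _ _
    have h4 : ∑ i, C i * (σ T (e (j + 1)) * σ ((j + 1) • T) (φ i)) =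
        σ T (e (j + 1)) * ∑ i, C i * σ ((j + 1) • T) (φ i) := by
      rw [Finset.mul_sum]
      exact Finset.sum_congr rfl fun i _ => mul_left_comm _ _ _
    rw [h3, h4] at hφ'
    exact (hu.map (σ T)).mul_left_cancel (by linear_combination hφ' - hy')
  have hy0 : ∑ i, C i * φ i = y := by
    have := hCn 0 (Nat.succ_pos _)
    simpa only [zero_smul, h.zero] using this
  have hTj : ∀ {v : AdmShift M} {j : ℕ}, ∑ i, C i * σ v (φ i) = σ v y →
      ∑ i, C i * σ (v + j • T) (φ i) = σ (v + j • T) y := fun {v j} hv => by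
    have hj : ∀ i, σ (j • T) (C i) = C i := fun i => by
      induction j with
      | zero => rw [zero_smul, h.zero]
      | succ j ih => rw [succ_nsmul, h.add, hTC, ih]
    rw [add_comm v, h.add, ← hv, map_sum]
    exact Finset.sum_congr rfl fun i _ => by rw [map_mul, h.add, hj]
  have hT1 : ∑ i, C i * σ T (φ i) = σ T y := by
    rw [← hy0, map_sum]
    exact Finset.sum_congr rfl fun i _ => by rw [map_mul, hTC]
  have hT2 : ∑ i, C i * σ (-T) (φ i) = σ (-T) y := by
    rw [← hy0, map_sum]
    exact Finset.sum_congr rfl fun i _ => by rw [map_mul, h.neg_apply (hTC i)]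
  have hA : ∀ k, k ≠ 0 → ∀ i, σ (shAA 0 k) (C i) = C i := fun k hk => by
    refine hinv _ fun j hj => hTj (hab.mul_left_cancel ?_)
    have h1 : ∑ i, C i * ((b 0 - a 0) * σ (shAA 0 k) (φ i) - (q⁻¹ • a k - a 0) * σ (shAB 0 0) (φ i)
        + (q⁻¹ • a k - b 0) * φ i) = 0 :=
      Finset.sum_eq_zero fun i _ => by rw [(hφ i).eqA k hk, mul_zero]
    have h2 := hy.eqA k hk
    simp only [mul_add, mul_sub, Finset.sum_add_distrib, Finset.sum_sub_distrib,
      mul_left_comm (C _), ← Finset.mul_sum] at h1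
    rw [← hT, hT1, hy0] at h1
    linear_combination h1 - h2
  have hB : ∀ k, k ≠ 0 → ∀ i, σ (shBB k 0) (C i) = C i := fun k hk => by
    refine hinv _ fun j hj => hTj (hab.mul_left_cancel ?_)
    have h1 : ∑ i, C i * ((a 0 - b 0) * σ (shBB k 0) (φ i) -
        (q • b k - b 0) * σ (-shAB 0 0) (φ i) + (q • b k - a 0) * φ i) = 0 :=
      Finset.sum_eq_zero fun i _ => by rw [(hφ i).eqB k hk, mul_zero]
    have h2 := hy.eqB k hk
    simp only [mul_add, mul_sub, Finset.sum_add_distrib, Finset.sum_sub_distrib,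
      mul_left_comm (C _), ← Finset.mul_sum] at h1
    rw [← hT, hT2, hy0] at h1
    linear_combination -h1 + h2
  have hall : ∀ v i, σ v (C i) = C i := fun v =>
    admShift_induction (p := fun v => ∀ i, σ v (C i) = C i) (fun i => h.zero _)
      (fun v w hv hw i => by rw [h.add, hw, hv]) (fun v hv i => h.neg_apply (hv i)) hTC hA hB v
  exact ⟨C, fun i k l => ⟨hall _ i, hall _ i, hall _ i⟩, hy0.symm⟩

/-- Solutions with an invertible Casorati determinant are a basis of the space of solutions. -/
theorem isSolutionRP_iff_mem_span (h : IsShiftAction σ)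
    (hc : σ (shAB 0 0) (a 0 / b 0) = a 0 / b 0)
    (hu : IsUnit ((hatPoly q a b (a 0 / b 0)).coeff (M + 1))) (hab : IsUnit (b 0 - a 0))
    {φ : Fin (M + 1) → R} (hφ : ∀ i, IsSolutionRP q σ a b (φ i))
    (hW : IsUnit (casorati σ φ).det) (y : R) :
    IsSolutionRP q σ a b y ↔ y ∈ Submodule.span (pseudoConstants σ) (Set.range φ) := by
  constructor
  · intro hy
    obtain ⟨C, hC, rfl⟩ := exists_isPseudoConstant_of_isSolutionRP h hc hu hab hφ hW hy
    refine Submodule.sum_mem _ fun i _ => ?_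
    exact Submodule.smul_mem _ (⟨C i, hC i⟩ : pseudoConstants σ) (Submodule.subset_span ⟨i, rfl⟩)
  · intro hy
    induction hy using Submodule.span_induction with
    | mem x hx => obtain ⟨i, rfl⟩ := hx; exact hφ i
    | zero => exact IsSolutionRP.zero
    | add x y _ _ hx hy => exact hx.add hy
    | smul C x _ hx => exact hx.mul h hc C.2

end Abstract

/-! ## The extreme coefficients of `Ê_M` and its action on `q`-hypergeometric terms -/

theorem prod_sub_mul_eq_sum_esymm {m : ℕ} (u : Fin m → ℂ) (z w : ℂ) :
    ∏ i, (z - w * u i) = ∑ k ∈ Finset.range (m + 1),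
      (-1) ^ k * w ^ k * (Finset.univ.val.map u).esymm k * z ^ (m - k) := by
  have h := congrArg (Polynomial.eval z)
    (Multiset.prod_X_sub_X_eq_sum_esymm (Finset.univ.val.map fun i => w * u i))
  rw [Polynomial.eval_multiset_prod, Multiset.map_map, Multiset.map_map] at h
  simp only [Polynomial.eval_finsetSum, eval_mul, eval_pow, eval_neg, eval_one, eval_C, eval_X,
    Function.comp_apply, eval_sub, Multiset.card_map, Finset.card_val, Finset.card_univ,
    Fintype.card_fin] at h
  have e : ∏ i, (z - w * u i) = (Multiset.map (fun x => z - w * u x) Finset.univ.val).prod := rfl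
  rw [e, h]
  refine Finset.sum_congr rfl fun k _ => ?_
  rw [Finset.esymm_map_val, Finset.esymm_map_val]
  have : ∀ t ∈ Finset.powersetCard k (Finset.univ : Finset (Fin m)),
      ∏ i ∈ t, (w * u i) = w ^ k * ∏ i ∈ t, u i := fun t ht => by
    rw [Finset.prod_mul_distrib, Finset.prod_const, (Finset.mem_powersetCard.1 ht).2]
  rw [Finset.sum_congr rfl this, ← Finset.mul_sum]
  ring

/-- The two extreme terms are split off because Ê_M has the same shape, with e_k only for 1 ≤ k ≤ M
+ 1 in the sum. -/
theorem prod_sub_mul_eq_sum_Icc {M : ℕ} (u : Fin (M + 2) → ℂ) (z w : ℂ) :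
    ∏ i, (z - w * u i) = z ^ (M + 2) + ∑ k ∈ Finset.Icc 1 (M + 1),
      (-1) ^ k * w ^ k * (Finset.univ.val.map u).esymm k * z ^ (M + 2 - k)
      + (-1) ^ M * w ^ (M + 2) * ∏ i, u i := by
  rw [prod_sub_mul_eq_sum_esymm, Finset.sum_range_succ, Finset.sum_range_succ',
    Finset.range_eq_Ico, Finset.sum_Ico_add' (fun k => (-1) ^ k * w ^ k *
      (Finset.univ.val.map u).esymm k * z ^ (M + 2 - k)) 0 (M + 1) 1]
  have h1 : Finset.Ico (0 + 1) (M + 1 + 1) = Finset.Icc 1 (M + 1) := by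
    ext; simp
  have h2 : (Finset.univ.val.map u).esymm (M + 2) = ∏ i, u i := by
    rw [Finset.esymm_map_val]
    have : Finset.powersetCard (M + 2) (Finset.univ : Finset (Fin (M + 2))) = {Finset.univ} := by
      have := Finset.powersetCard_self (Finset.univ : Finset (Fin (M + 2)))
      rwa [Finset.card_univ, Fintype.card_fin] at this
    rw [this, Finset.sum_singleton]
  have h3 : (Finset.univ.val.map u).esymm 0 = 1 := by
    rw [Finset.esymm_map_val]; simp
  rw [h1, h2, h3]
  have h4 : ((-1 : ℂ)) ^ (M + 2) = (-1) ^ M := by rw [pow_add]; norm_num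
  rw [h4]
  simp only [Nat.sub_self, Nat.sub_zero, pow_zero]
  ring

theorem coeff_zero_linFac (q c : ℂ) (n : ℕ) : (linFac q c n).coeff 0 = 1 := by
  rw [coeff_zero_eq_eval_zero, linFac, eval_prod]
  simp

theorem coeff_self_linFac (q c : ℂ) (n : ℕ) :
    (linFac q c n).coeff n = (-c) ^ n * ∏ i ∈ Finset.range n, q ^ i := by
  induction n with
  | zero => simp [linFac]
  | succ n ih =>
    have h1 : (1 - C (q ^ n • c) * X : ℂ[X]).natDegree ≤ 1 := by
      refine (natDegree_sub_le _ _).trans ?_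
      simp only [natDegree_one, zero_le, max_eq_right]
      exact (natDegree_C_mul_le _ _).trans natDegree_X_le
    rw [linFac_succ, coeff_mul_add_eq_of_natDegree_le (natDegree_linFac_le _ _ _) h1, ih,
      Finset.prod_range_succ]
    rw [coeff_sub, coeff_C_mul, coeff_X_one, coeff_one, if_neg one_ne_zero, smul_eq_mul]
    ring

theorem coeff_zero_hatPoly {M : ℕ} (q : ℂ) (a b : Fin (M + 3) → ℂ) (c : ℂ) :
    (hatPoly q a b c).coeff 0 = ∏ i : Fin (M + 2), (b 0 - a i.succ) := by
  have h := prod_sub_mul_eq_sum_Icc (fun i : Fin (M + 2) => a i.succ) (b 0) 1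
  simp only [one_mul] at h
  rw [h, hatPoly]
  simp only [coeff_add, finsetSum_coeff, mul_coeff_zero, coeff_C_zero, coeff_zero_linFac, coeff_sub,
    coeff_X_zero]
  simp only [mul_one, mul_zero, sub_zero, one_pow]
  congr 2
  exact Finset.sum_congr rfl fun k _ => by ring

/-- An identity between triangular powers q^{n(n-1)/2}. It shows that the leading coefficients of
the k-th summand of Ê_M depend on k like w^k with w = q^{1-M}, so that they assemble to a product.
-/
theorem prod_pow_range_shift {q : ℂ} (hq : q ≠ 0) {n k : ℕ} (hk : k ≤ n) :
    (∏ i ∈ Finset.range (n - k), q ^ i) * q =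
      (∏ i ∈ Finset.range (n + 1), q ^ i) * (q * q⁻¹ ^ n) ^ (k + 1) * ∏ i ∈ Finset.range k, q ^ i := by
  induction k with
  | zero =>
    rw [Finset.prod_range_succ]
    simp only [Nat.sub_zero, zero_add, pow_one, Finset.range_zero, Finset.prod_empty, inv_pow]
    field_simp
  | succ k ih =>
    have h1 := ih (by omega)
    obtain ⟨m, rfl⟩ : ∃ m, n = m + (k + 1) := ⟨n - (k + 1), by omega⟩
    have h2 : m + (k + 1) - k = m + 1 := by omega
    have h3 : m + (k + 1) - (k + 1) = m := by omega
    rw [h2, Finset.prod_range_succ] at h1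
    rw [h3, Finset.prod_range_succ (fun i => q ^ i) k, pow_succ]
    have h4 : q ^ m * (q * q⁻¹ ^ (m + (k + 1)) * q ^ k) = 1 := by
      rw [inv_pow]
      field_simp
      ring
    calc (∏ i ∈ Finset.range m, q ^ i) * q
        = ((∏ i ∈ Finset.range m, q ^ i) * q ^ m * q) * (q * q⁻¹ ^ (m + (k + 1)) * q ^ k) := by
          linear_combination -((∏ i ∈ Finset.range m, q ^ i) * q) * h4
      _ = _ := by rw [h1]; ring

/-- In top degree only the b̂-part of each middle summand survives, and the sum is the expansion of
one product in the b_i. The last summand carries a_2 ⋯ a_{M+3}; the relation defining the variety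
turns it into the missing term in the b_i. -/
theorem coeff_top_hatPoly {M : ℕ} {q : ℂ} (hq : q ≠ 0) (a b : Fin (M + 3) → ℂ) (ha : a 0 ≠ 0)
    (hb : b 0 ≠ 0) (hab : ∏ i, a i = q ^ 2 * ∏ i, b i) :
    (hatPoly q a b (a 0 / b 0)).coeff (M + 1) =
      (-1) ^ (M + 1) * (∏ i ∈ Finset.range (M + 1), q ^ i) * (b 0 / a 0) *
        ∏ i : Fin (M + 2), (a 0 - q * q⁻¹ ^ M * b i.succ) := by
  set c := a 0 / b 0 with hc
  set w := q * q⁻¹ ^ M with hw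
  set Q : ℕ → ℂ := fun n => ∏ i ∈ Finset.range n, q ^ i with hQ
  have hQ0 : ∀ n, Q n ≠ 0 := fun n => Finset.prod_ne_zero_iff.2 fun i _ => pow_ne_zero _ hq
  have hQi : ∀ n, ∏ i ∈ Finset.range n, q⁻¹ ^ i = (Q n)⁻¹ := fun n => by
    rw [hQ, ← Finset.prod_inv_distrib]
    exact Finset.prod_congr rfl fun i _ => inv_pow _ _
  have hQs : ∀ k ≤ M, Q (M - k) * q = Q (M + 1) * w ^ (k + 1) * Q k := fun k hk =>
    prod_pow_range_shift hq hk
  rw [prod_sub_mul_eq_sum_Icc (fun i : Fin (M + 2) => b i.succ)]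
  rw [hatPoly]
  simp only [coeff_add, finsetSum_coeff, coeff_C_mul, coeff_self_linFac, hQi]
  change _ = (-1) ^ (M + 1) * Q (M + 1) * (b 0 / a 0) * _
  rw [mul_add, mul_add]
  refine congrArg₂ _ (congrArg₂ _ ?_ ?_) ?_
  · change b 0 ^ (M + 2) * ((-c) ^ (M + 1) * Q (M + 1)) = _
    rw [neg_pow, hc, div_pow]
    field_simp
    ring
  · rw [Finset.mul_sum]
    refine Finset.sum_congr rfl fun k hk => ?_
    obtain ⟨hk1, hk2⟩ := Finset.mem_Icc.1 hk
    obtain ⟨k, rfl⟩ : ∃ j, k = j + 1 := ⟨k - 1, by omega⟩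
    obtain ⟨n, rfl⟩ : ∃ n, M = n + k := ⟨M - k, by omega⟩
    have e1 : n + k + 1 - (k + 1) = n := by omega
    have e2 : n + k + 2 - (k + 1) = n + 1 := by omega
    have e3 : k + 1 - 1 = k := by omega
    have hs := hQs k (by omega)
    rw [show n + k - k = n by omega] at hs
    rw [e1, e2, e3, show n + k + 1 = (1 + n) + k by ring]
    have h1 : ∀ r s : ℂ, (C r - C s * X).natDegree ≤ 1 := fun r s => by
      refine (natDegree_sub_le _ _).trans ?_
      simp only [natDegree_C, zero_le, max_eq_right]
      exact (natDegree_C_mul_le _ _).trans natDegree_X_le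
    rw [coeff_mul_add_eq_of_natDegree_le (natDegree_mul_le_of_le (h1 _ _)
      (natDegree_linFac_le _ _ _)) (natDegree_linFac_le _ _ _),
      coeff_mul_add_eq_of_natDegree_le (h1 _ _) (natDegree_linFac_le _ _ _), coeff_self_linFac,
      coeff_self_linFac, hQi]
    set e := (Multiset.map (fun i : Fin (n + k + 2) => b i.succ) Finset.univ.val).esymm (k + 1)
    have h2 : (∏ i ∈ Finset.range n, q ^ i) = Q n := rfl
    have h3 : Q n = Q (n + k + 1) * w ^ (k + 1) * Q k / q := by
      rw [← hs]; field_simp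
    rw [h2, h3, coeff_sub, coeff_C_mul, coeff_X_one, coeff_C, if_neg one_ne_zero, smul_eq_mul,
      neg_pow c, neg_pow (1 : ℂ) k, hc, div_pow, show 1 + n + k = n + k + 1 by ring]
    have h4 := hQ0 k
    have h5 : ((-1 : ℂ)) ^ (n + k + 1) = - ((-1) ^ n * (-1) ^ k) := by ring
    rw [h5, one_pow]
    field_simp
    ring
  · rw [Fin.prod_univ_succ a, Fin.prod_univ_succ b] at hab
    have h1 : ∏ i : Fin (M + 2), a i.succ = q ^ 2 * (b 0 / a 0) * ∏ i : Fin (M + 2), b i.succ := by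
      field_simp
      linear_combination hab
    have h2 : Q (M + 1) * Q (M + 1) * w ^ (M + 2) = q ^ 2 := by
      have h3 := hQs M le_rfl
      have h4 := hQs 0 (Nat.zero_le _)
      rw [Nat.sub_self] at h3
      have h5 : Q 0 = 1 := by simp [hQ]
      simp only [h5, Nat.sub_zero, zero_add, pow_one, mul_one, one_mul] at h3 h4
      apply mul_left_cancel₀ (hQ0 M)
      calc Q M * (Q (M + 1) * Q (M + 1) * w ^ (M + 2))
          = (Q (M + 1) * w ^ (M + 1) * Q M) * (Q (M + 1) * w) := by ring
        _ = _ := by rw [← h3, ← h4]; ring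
    rw [h1, ← h2, neg_pow (1 : ℂ) (M + 1), one_pow]
    have h6 := hQ0 (M + 1)
    field_simp

/-- The linear functional `X ^ j ↦ y (s + j)`. -/
def seqEval (y : ℕ → ℂ) (s : ℕ) : ℂ[X] →ₗ[ℂ] ℂ :=
  Polynomial.lsum fun j => LinearMap.mulRight ℂ (y (s + j))

theorem seqEval_monomial (y : ℕ → ℂ) (s j : ℕ) (r : ℂ) :
    seqEval y s (monomial j r) = r * y (s + j) := by
  simp [seqEval, Polynomial.lsum_apply, Polynomial.sum_monomial_index]

theorem seqEval_C_mul (y : ℕ → ℂ) (s : ℕ) (r : ℂ) (P : ℂ[X]) :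
    seqEval y s (C r * P) = r * seqEval y s P := by
  rw [← smul_eq_C_mul, map_smul, smul_eq_mul]

theorem seqEval_mul_X (y : ℕ → ℂ) (s : ℕ) (P : ℂ[X]) :
    seqEval y s (P * X) = seqEval y (s + 1) P := by
  induction P using Polynomial.induction_on' with
  | add p q hp hq => rw [add_mul, map_add, map_add, hp, hq]
  | monomial n r =>
    rw [monomial_mul_X, seqEval_monomial, seqEval_monomial]
    congr 2
    ring

theorem seqEval_mul_linear (y : ℕ → ℂ) (s : ℕ) (r u : ℂ) (P : ℂ[X]) :
    seqEval y s (P * (C u - C r * X)) = u * seqEval y s P - r * seqEval y (s + 1) P := by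
  rw [mul_sub, map_sub, mul_comm P, seqEval_C_mul, ← mul_assoc, mul_comm P, mul_assoc,
    seqEval_C_mul, seqEval_mul_X]

theorem sum_coeff_hatPoly_eq_seqEval {M : ℕ} (q : ℂ) (a b : Fin (M + 3) → ℂ) (c : ℂ) (y : ℕ → ℂ) :
    ∑ j ∈ Finset.range (M + 2), (hatPoly q a b c).coeff j * y j =
      seqEval y 0 (hatPoly q a b c) := by
  rw [seqEval, Polynomial.lsum_apply, Polynomial.sum_over_range' _ _ (M + 2)
    (Nat.lt_succ_of_le (natDegree_hatPoly_le q a b c))]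
  · simp
  · simp

/-- A sequence satisfying `(1 - x q^j) y_{j+1} = (1 - w q^j) y_j` for all `j`. -/
def IsQGeometric (q x w : ℂ) (y : ℕ → ℂ) : Prop :=
  ∀ j, (1 - x * q ^ j) * y (j + 1) = (1 - w * q ^ j) * y j

/-- Each linear factor combines the values for the starting points s and s + 1, and the first order
recurrence merges them into one product. The statement is kept for all s because the induction needs
both. -/
theorem IsQGeometric.seqEval_linFac {q x w c : ℂ} (hq : q ≠ 0) (hc : c * w = x) {y : ℕ → ℂ}
    (hy : IsQGeometric q x w y) (n m s : ℕ) :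
    seqEval y s (linFac q c n * linFac q⁻¹ 1 m) * ∏ i ∈ Finset.range (n + m), (1 - x * q ^ (s + i)) =
      y s * (∏ i ∈ Finset.range (n + m), (1 - c * q ^ i)) * (w * q ^ s) ^ m := by
  have hshift : ∀ N s, ∏ i ∈ Finset.range (N + 1), (1 - x * q ^ (s + i)) =
      (1 - x * q ^ s) * ∏ i ∈ Finset.range N, (1 - x * q ^ (s + 1 + i)) := fun N s => by
    rw [Finset.prod_range_succ', mul_comm]
    simp only [add_zero]
    congr 1
    exact Finset.prod_congr rfl fun i _ => by ring_nf
  induction n generalizing s with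
  | zero =>
    induction m generalizing s with
    | zero =>
      have := seqEval_monomial y s 0 1
      simp only [monomial_zero_left, C_1, one_mul, add_zero] at this
      simp [linFac, this]
    | succ m ih =>
      have h1 := ih s
      have h2 := ih (s + 1)
      have e : linFac q (c : ℂ) 0 * linFac q⁻¹ 1 (m + 1) =
          (linFac q c 0 * linFac q⁻¹ 1 m) * (C 1 - C (q⁻¹ ^ m) * X) := by
        rw [linFac_succ, ← mul_assoc]; simp
      rw [e, seqEval_mul_linear, ← add_assoc, sub_mul, mul_assoc, mul_assoc, hshift,
        mul_left_comm (seqEval y (s + 1) _), h2, ← hshift,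
        Finset.prod_range_succ _ (0 + m), ← mul_assoc (seqEval y s _), h1,
        Finset.prod_range_succ _ (0 + m)]
      have h3 := hy s
      have h4 : q⁻¹ ^ m * q ^ m = 1 := by rw [← mul_pow, inv_mul_cancel₀ hq, one_pow]
      set Z := ∏ i ∈ Finset.range (0 + m), (1 - c * q ^ i)
      have h5 : (w * q ^ (s + 1)) ^ m = (w * q ^ s) ^ m * q ^ m := by
        rw [pow_succ q s, ← mul_assoc, mul_pow]
      rw [h5, zero_add, ← hc] at *
      rw [pow_succ (w * q ^ s) m]
      linear_combination (-(Z * (w * q ^ s) ^ m) * (q⁻¹ ^ m * q ^ m)) * h3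
        - (Z * (w * q ^ s) ^ m * (1 - w * q ^ s) * y s) * h4
  | succ n ih =>
    have h1 := ih s
    have h2 := ih (s + 1)
    have e : linFac q c (n + 1) * linFac q⁻¹ 1 m =
        (linFac q c n * linFac q⁻¹ 1 m) * (C 1 - C (q ^ n * c) * X) := by
      rw [linFac_succ]; simp; ring
    rw [e, seqEval_mul_linear, show n + 1 + m = n + m + 1 by ring, sub_mul, mul_assoc, mul_assoc,
      hshift, mul_left_comm (seqEval y (s + 1) _), h2, ← hshift,
      Finset.prod_range_succ _ (n + m), ← mul_assoc (seqEval y s _), h1,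
      Finset.prod_range_succ _ (n + m)]
    have h3 := hy s
    set Z := ∏ i ∈ Finset.range (n + m), (1 - c * q ^ i)
    have h5 : (w * q ^ (s + 1)) ^ m = (w * q ^ s) ^ m * q ^ m := by
      rw [pow_succ q s, ← mul_assoc, mul_pow]
    rw [h5, ← hc] at *
    simp only [pow_add]
    linear_combination (-(q ^ n * c) * (Z * (w * q ^ s) ^ m) * (q ^ m)) * h3

/-- The action of `Ê_M` on a solution of a first order recurrence in `T`. -/
theorem IsQGeometric.sum_coeff_hatPoly {M : ℕ} {q : ℂ} (hq : q ≠ 0) {a b : Fin (M + 3) → ℂ}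
    (hb : b 0 ≠ 0) (hab : ∏ i, a i = q ^ 2 * ∏ i, b i) {s : ℂ} {y : ℕ → ℂ}
    (hy : IsQGeometric q (a 0 * s) (b 0 * s) y) :
    (∑ j ∈ Finset.range (M + 2), (hatPoly q a b (a 0 / b 0)).coeff j * y j) * s *
        ∏ i ∈ Finset.range (M + 1), (1 - a 0 * s * q ^ i) =
      b 0 ^ (M + 1) * (∏ i ∈ Finset.range M, (1 - a 0 / b 0 * q ^ i)) * y 0 *
        ((1 - a 0 * s * q ^ M) * ∏ i : Fin (M + 2), (1 - s * a i.succ)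
          - (1 - b 0 * s) * ∏ i : Fin (M + 2), (1 - (q * s) * b i.succ)) := by
  set c := a 0 / b 0 with hc
  set D := ∏ i ∈ Finset.range (M + 1), (1 - a 0 * s * q ^ i) with hD
  set Z := ∏ i ∈ Finset.range M, (1 - c * q ^ i) with hZ
  have hcw : c * (b 0 * s) = a 0 * s := by rw [hc]; field_simp
  have hL := hy.seqEval_linFac hq hcw
  have hZ1 : ∏ i ∈ Finset.range (M + 1), (1 - c * q ^ i) = Z * (1 - c * q ^ M) :=
    Finset.prod_range_succ _ _
  have t1 : seqEval y 0 (linFac q c (M + 1)) * D = y 0 * (Z * (1 - c * q ^ M)) := by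
    have := hL (M + 1) 0 0
    simpa [linFac, hZ1] using this
  have t3 : seqEval y 0 (linFac q⁻¹ 1 (M + 1)) * D =
      y 0 * (Z * (1 - c * q ^ M)) * (b 0 * s) ^ (M + 1) := by
    have := hL 0 (M + 1) 0
    simp only [zero_add, hZ1, pow_zero, mul_one] at this
    rw [← this]
    simp [linFac, hD]
  have t2 : ∀ k ≤ M, seqEval y 0 (linFac q c (M - k) * linFac q⁻¹ 1 k) * D =
      y 0 * Z * (b 0 * s) ^ k * (1 - a 0 * s * q ^ M) := fun k hk => by
    have := hL (M - k) k 0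
    rw [Nat.sub_add_cancel hk] at this
    simp only [zero_add, pow_zero, mul_one] at this
    rw [hD, Finset.prod_range_succ, ← mul_assoc, this]
  have t2' : ∀ k ≤ M, seqEval y 1 (linFac q c (M - k) * linFac q⁻¹ 1 k) * D =
      y 0 * Z * (b 0 * s * q) ^ k * (1 - b 0 * s) := fun k hk => by
    have := hL (M - k) k 1
    rw [Nat.sub_add_cancel hk] at this
    have h0 := hy 0
    rw [hD, Finset.prod_range_succ', ← mul_assoc]
    simp only [pow_zero, mul_one, pow_one, zero_add] at h0 this ⊢
    simp only [add_comm 1] at this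
    rw [this]
    linear_combination Z * (b 0 * s * q) ^ k * h0
  rw [sum_coeff_hatPoly_eq_seqEval, hatPoly, map_add, map_add, seqEval_C_mul, seqEval_C_mul,
    map_sum]
  have hA := prod_sub_mul_eq_sum_Icc (fun i : Fin (M + 2) => a i.succ) 1 s
  have hB := prod_sub_mul_eq_sum_Icc (fun i : Fin (M + 2) => b i.succ) 1 (q * s)
  simp only [one_pow, mul_one] at hA hB
  set ea := fun k => (Multiset.map (fun i : Fin (M + 2) => a i.succ) Finset.univ.val).esymm k
  set eb := fun k => (Multiset.map (fun i : Fin (M + 2) => b i.succ) Finset.univ.val).esymm k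
  have hmid : (∑ k ∈ Finset.Icc 1 (M + 1), seqEval y 0 ((C ((-1) ^ k * b 0 ^ (M + 2 - k) * ea k) -
      C ((-1) ^ k * b 0 ^ (M + 2 - k) * (q • eb k)) * X) * linFac q c (M + 1 - k) *
        linFac q⁻¹ 1 (k - 1))) * s * D = b 0 ^ (M + 1) * Z * y 0 *
      ((1 - a 0 * s * q ^ M) * ∑ k ∈ Finset.Icc 1 (M + 1), (-1) ^ k * s ^ k * ea k
        - (1 - b 0 * s) * ∑ k ∈ Finset.Icc 1 (M + 1), (-1) ^ k * (q * s) ^ k * eb k) := by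
    rw [Finset.sum_mul, Finset.sum_mul, Finset.mul_sum, Finset.mul_sum, ← Finset.sum_sub_distrib,
      Finset.mul_sum]
    refine Finset.sum_congr rfl fun k hk => ?_
    obtain ⟨hk1, hk2⟩ := Finset.mem_Icc.1 hk
    obtain ⟨k, rfl⟩ : ∃ j, k = j + 1 := ⟨k - 1, by omega⟩
    have e1 : M + 1 - (k + 1) = M - k := by omega
    have e2 : M + 2 - (k + 1) = M - k + 1 := by omega
    rw [e1, e2, Nat.add_sub_cancel, mul_assoc (C _ - _), mul_comm (C _ - _), seqEval_mul_linear]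
    have s1 := t2 k (by omega)
    have s2 := t2' k (by omega)
    have e3 : b 0 ^ (M + 1) = b 0 ^ (M - k + 1) * b 0 ^ k := by
      rw [← pow_add]; congr 1; omega
    simp only [smul_eq_mul, zero_add]
    rw [e3]
    linear_combination ((-1) ^ (k + 1) * b 0 ^ (M - k + 1) * ea (k + 1) * s) * s1
      - ((-1) ^ (k + 1) * b 0 ^ (M - k + 1) * (q * eb (k + 1)) * s) * s2
  have hab' : a 0 * ∏ i : Fin (M + 2), a i.succ =
      q ^ 2 * (b 0 * ∏ i : Fin (M + 2), b i.succ) := by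
    rw [← Fin.prod_univ_succ, ← Fin.prod_univ_succ, hab]
  have hcb : c * b 0 = a 0 := by rw [hc]; field_simp
  set PA := ∏ i : Fin (M + 2), a i.succ
  set PB := ∏ i : Fin (M + 2), b i.succ
  have hcPA : c * PA = q ^ 2 * PB := by
    apply mul_left_cancel₀ hb
    linear_combination hab' + PA * hcb
  rw [hA, hB, add_mul, add_mul, add_mul, add_mul, hmid]
  generalize (∑ k ∈ Finset.Icc 1 (M + 1), (-1) ^ k * s ^ k * ea k) = SA
  generalize (∑ k ∈ Finset.Icc 1 (M + 1), (-1) ^ k * (q * s) ^ k * eb k) = SB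
  rw [← hcb]
  -- The first and last summands of Ê_M must supply the terms k = 0 and k = M + 2 of both products.
  -- For k = M + 2 this is where the relation between ∏ a_i and ∏ b_i, in the form `hcPA`, is used.
  linear_combination (b 0 ^ (M + 2) * s) * t1 + ((-1) ^ M * PA * s) * t3
    + (b 0 ^ (M + 1) * Z * y 0 * ((-1) ^ M * s ^ (M + 2) * q ^ M * (b 0 * s - 1))) * hcPA

/-! ## The `q`-shifted factorial -/

section InfiniteProduct

variable {A : Type*} [NormedCommRing A] [NormOneClass A] [CompleteSpace A] [NormedAlgebra ℂ A]

/-- The product converges uniformly on every ball. Values in a Banach algebra are allowed because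
the product is later taken in the bounded sequences, which handles all points of a lattice at once.
-/
theorem differentiable_tprod_one_add_smul {w : ℕ → A} (hw : Summable fun i => ‖w i‖) :
    Differentiable ℂ fun x : ℂ => ∏' i, (1 + x • w i) := by
  intro x
  have hK : IsOpen (Metric.ball (0 : ℂ) (‖x‖ + 1)) := Metric.isOpen_ball
  have h := Summable.hasProdLocallyUniformlyOn_nat_one_add (R := A)
    (f := fun i (z : ℂ) => z • w i) hK (hw.mul_left (‖x‖ + 1))
    (Filter.Eventually.of_forall fun i z hz => ?_) (fun i => by fun_prop)
  · have := h.differentiableOn (Filter.Eventually.of_forall fun s => by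
      have : Differentiable ℂ fun z : ℂ => ∏ i ∈ s, (1 + z • w i) :=
        Differentiable.fun_finsetProd fun i _ => by fun_prop
      convert! this.differentiableOn) hK
    exact this.differentiableAt (hK.mem_nhds (by simp))
  · rw [norm_smul]
    gcongr
    simpa using (mem_ball_zero_iff.1 hz).le

theorem multipliable_one_add_smul {w : ℕ → A} (hw : Summable fun i => ‖w i‖) (x : ℂ) :
    Multipliable fun i => 1 + x • w i :=
  multipliable_one_add_of_summable (by simpa only [norm_smul] using hw.mul_left ‖x‖)

end InfiniteProduct

section QPoch

variable {q : ℂ}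

theorem summable_norm_pow (hq : ‖q‖ < 1) : Summable fun i : ℕ => ‖-q ^ i‖ := by
  simpa using summable_geometric_of_lt_one (norm_nonneg _) hq

theorem qPoch_eq_tprod (q a : ℂ) : qPoch q a = ∏' i : ℕ, (1 + a • (-q ^ i)) := by
  simp [qPoch, sub_eq_add_neg]

theorem multipliable_qPoch (hq : ‖q‖ < 1) (a : ℂ) : Multipliable fun i : ℕ => 1 - a * q ^ i := by
  simpa [sub_eq_add_neg] using multipliable_one_add_smul (summable_norm_pow hq) a

theorem differentiable_qPoch (hq : ‖q‖ < 1) : Differentiable ℂ (qPoch q) := by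
  have := differentiable_tprod_one_add_smul (summable_norm_pow hq)
  rwa [← funext (qPoch_eq_tprod q)] at this

theorem continuous_qPoch (hq : ‖q‖ < 1) : Continuous (qPoch q) := (differentiable_qPoch hq).continuous

theorem qPoch_zero (q : ℂ) : qPoch q 0 = 1 := by simp [qPoch]

theorem qPoch_eq_prod_mul (hq : ‖q‖ < 1) (a : ℂ) (n : ℕ) :
    qPoch q a = (∏ i ∈ Finset.range n, (1 - a * q ^ i)) * qPoch q (a * q ^ n) := by
  induction n with
  | zero => simp
  | succ n ih =>
    rw [ih, Finset.prod_range_succ, mul_assoc]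
    congr 1
    rw [qPoch, tprod_eq_zero_mul']
    · rw [pow_zero, mul_one, qPoch]
      congr 2
      funext i
      ring
    · have := multipliable_qPoch hq (a * q ^ (n + 1))
      convert! this using 2
      ring

theorem qPoch_succ (hq : ‖q‖ < 1) (a : ℂ) : qPoch q a = (1 - a) * qPoch q (a * q) := by
  simpa using qPoch_eq_prod_mul hq a 1

theorem qPoch_ne_zero (hq : ‖q‖ < 1) {a : ℂ} (h : ∀ n : ℕ, a * q ^ n ≠ 1) : qPoch q a ≠ 0 := by
  rw [qPoch_eq_tprod]
  refine tprod_one_add_ne_zero_of_summable (fun i => ?_) ?_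
  · have := sub_ne_zero.2 (h i).symm
    simpa [sub_eq_add_neg] using this
  · simpa only [norm_smul] using (summable_norm_pow hq).mul_left ‖a‖

theorem qPoch_eq_zero (hq : ‖q‖ < 1) {a : ℂ} {n : ℕ} (h : a * q ^ n = 1) : qPoch q a = 0 := by
  rw [qPoch_eq_prod_mul hq a (n + 1), Finset.prod_range_succ, h, sub_self, mul_zero, zero_mul]

theorem qPoch_zpow_eq_zero (hq : ‖q‖ < 1) (hq0 : q ≠ 0) {n : ℤ} (hn : n ≤ 0) :
    qPoch q (q ^ n) = 0 := by
  obtain ⟨m, rfl⟩ : ∃ m : ℕ, n = -m := ⟨n.natAbs, by omega⟩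
  refine qPoch_eq_zero hq (n := m) ?_
  rw [zpow_neg, zpow_natCast, inv_mul_cancel₀ (pow_ne_zero _ hq0)]

theorem tendsto_prod_qPoch (hq : ‖q‖ < 1) (a : ℂ) :
    Filter.Tendsto (fun n => ∏ i ∈ Finset.range n, (1 - a * q ^ i)) Filter.atTop (𝓝 (qPoch q a)) :=
  (multipliable_qPoch hq a).hasProd.tendsto_prod_nat

end QPoch

/-! ## The integrand and its shifts -/

section Integrand

variable {M : ℕ} {q : ℂ}

/-- The integrand `∏_k (a_k t)_∞ / (b_k t)_∞`. -/
def rpTerm (q : ℂ) (p : Param M) (t : ℂ) : ℂ :=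
  ∏ k, qPoch q (p.1 k * t) / qPoch q (p.2 k * t)

/-- The parameters multiplied by powers of `q` with arbitrary exponents. -/
def scaleParam (q : ℂ) (v : (Fin (M + 3) → ℤ) × (Fin (M + 3) → ℤ)) (p : Param M) : Param M :=
  (fun i => q ^ (v.1 i) * p.1 i, fun i => q ^ (v.2 i) * p.2 i)

/-- No factor `(q^n b_k t)_∞` vanishes. -/
def IsRegularAt (q : ℂ) (p : Param M) (t : ℂ) : Prop := ∀ k, ∀ n : ℤ, q ^ n * p.2 k * t ≠ 1

theorem rpTerm_eq_mul_A (hq : ‖q‖ < 1) (hq0 : q ≠ 0) (p : Param M)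
    (v : (Fin (M + 3) → ℤ) × (Fin (M + 3) → ℤ)) (k : Fin (M + 3)) (t : ℂ) :
    rpTerm q (scaleParam q v p) t = (1 - q ^ v.1 k * p.1 k * t) *
      rpTerm q (scaleParam q (v + (Pi.single k 1, 0)) p) t := by
  classical
  unfold rpTerm
  rw [← Finset.mul_prod_erase _ _ (Finset.mem_univ k),
    ← Finset.mul_prod_erase _ _ (Finset.mem_univ k), ← mul_assoc]
  congr 1
  · simp only [scaleParam, Prod.fst_add, Prod.snd_add, Pi.add_apply, Pi.single_eq_same, add_zero,
      Pi.zero_apply]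
    rw [qPoch_succ hq (q ^ v.1 k * p.1 k * t), zpow_add_one₀ hq0, mul_div_assoc]
    congr 3
    ring
  · refine Finset.prod_congr rfl fun i hi => ?_
    have : i ≠ k := Finset.ne_of_mem_erase hi
    simp [scaleParam, this]

theorem rpTerm_mul_B (hq : ‖q‖ < 1) (hq0 : q ≠ 0) {p : Param M}
    (v : (Fin (M + 3) → ℤ) × (Fin (M + 3) → ℤ)) (k : Fin (M + 3)) {t : ℂ}
    (ht : IsRegularAt q p t) :
    rpTerm q (scaleParam q (v + (0, Pi.single k 1)) p) t = (1 - q ^ v.2 k * p.2 k * t) *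
      rpTerm q (scaleParam q v p) t := by
  classical
  unfold rpTerm
  rw [← Finset.mul_prod_erase _ _ (Finset.mem_univ k),
    ← Finset.mul_prod_erase _ _ (Finset.mem_univ k), ← mul_assoc]
  congr 1
  · simp only [scaleParam, Prod.fst_add, Prod.snd_add, Pi.add_apply, Pi.single_eq_same, add_zero,
      Pi.zero_apply]
    have h1 := sub_ne_zero.2 (ht k (v.2 k)).symm
    rw [qPoch_succ hq (q ^ v.2 k * p.2 k * t), zpow_add_one₀ hq0,
      show q ^ v.2 k * q * p.2 k * t = q ^ v.2 k * p.2 k * t * q by ring]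
    rw [mul_div_assoc', mul_div_mul_left _ _ h1]
  · refine Finset.prod_congr rfl fun i hi => ?_
    have : i ≠ k := Finset.ne_of_mem_erase hi
    simp [scaleParam, this]

/-- The relation between the integrand at `t` and at `q t`. -/
theorem rpTerm_mul_prod (hq : ‖q‖ < 1) {p : Param M} {t : ℂ} (ht : ∀ k, 1 - p.2 k * t ≠ 0) :
    rpTerm q p t * ∏ k, (1 - p.2 k * t) = (∏ k, (1 - p.1 k * t)) * rpTerm q p (t * q) := by
  unfold rpTerm
  rw [← Finset.prod_mul_distrib, ← Finset.prod_mul_distrib]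
  refine Finset.prod_congr rfl fun k _ => ?_
  rw [qPoch_succ hq (p.1 k * t), qPoch_succ hq (p.2 k * t), mul_assoc (p.1 k), mul_assoc (p.2 k),
    mul_div_mul_comm, div_mul_eq_mul_div, div_mul_cancel₀ _ (ht k)]

theorem continuousAt_rpTerm_zero (hq : ‖q‖ < 1) (p : Param M) :
    ContinuousAt (rpTerm q p) 0 := by
  have h : ∀ c : ℂ, ContinuousAt (fun t => qPoch q (c * t)) 0 := fun c =>
    ((continuous_qPoch hq).comp (continuous_const.mul continuous_id)).continuousAt
  refine tendsto_finsetProd _ fun k _ => (h _).div (h _) ?_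
  simp [qPoch_zero]

theorem rpTerm_zero (q : ℂ) (p : Param M) : rpTerm q p 0 = 1 := by
  simp [rpTerm, qPoch_zero]

theorem scaleParam_zero (q : ℂ) (p : Param M) : scaleParam q 0 p = p := by
  simp [scaleParam]

theorem scaleParam_add (hq0 : q ≠ 0) (v w : (Fin (M + 3) → ℤ) × (Fin (M + 3) → ℤ)) (p : Param M) :
    scaleParam q (v + w) p = scaleParam q v (scaleParam q w p) := by
  simp [scaleParam, zpow_add₀ hq0, mul_assoc]

end Integrand

/-! ## Bilateral sums over the lattices `q^ℤ / a_i` -/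

section Lattice

variable {M : ℕ} {q : ℂ}

theorem tsum_int_eq_tsum_nat {g : ℤ → ℂ} {N : ℤ} (hg : ∀ n < N, g n = 0) :
    ∑' n, g n = ∑' n : ℕ, g (N + n) := by
  symm
  refine Function.Injective.tsum_eq (g := fun n : ℕ => N + (n : ℤ)) (fun m n h => ?_) fun n hn => ?_
  · simpa using h
  · have : N ≤ n := by
      by_contra h
      exact hn (hg n (by omega))
    exact ⟨(n - N).toNat, by simp; omega⟩

theorem tendsto_mul_zpow_zero (hq : ‖q‖ < 1) (hq0 : q ≠ 0) (τ : ℂ) (N : ℤ) :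
    Filter.Tendsto (fun n : ℕ => τ * q ^ (N + n : ℤ)) Filter.atTop (𝓝 0) := by
  have h := (tendsto_pow_atTop_nhds_zero_of_norm_lt_one hq).const_mul (τ * q ^ N)
  rw [mul_zero] at h
  refine h.congr fun n => ?_
  rw [zpow_add₀ hq0, zpow_natCast, mul_assoc]

theorem summable_mul_of_continuousAt (hq : ‖q‖ < 1) (hq0 : q ≠ 0) (τ : ℂ) {G : ℂ → ℂ}
    (hG : ContinuousAt G 0) {N : ℤ} (hN : ∀ n < N, G (τ * q ^ n) = 0) :
    Summable fun n : ℤ => τ * q ^ n * G (τ * q ^ n) := by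
  have h1 : Summable fun n : ℕ => τ * q ^ (N + n : ℤ) * G (τ * q ^ (N + n : ℤ)) := by
    have h2 : Summable fun n : ℕ => ‖q‖ ^ n := summable_geometric_of_lt_one (norm_nonneg _) hq
    refine summable_of_isBigO_nat h2 ?_
    have h3 : (fun n : ℕ => G (τ * q ^ (N + n : ℤ))) =O[Filter.atTop] fun _ => (1 : ℝ) :=
      (hG.tendsto.comp (tendsto_mul_zpow_zero hq hq0 τ N)).isBigO_one ℝ
    have h4 : (fun n : ℕ => τ * q ^ (N + n : ℤ)) =O[Filter.atTop] fun n => ‖q‖ ^ n := by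
      refine Asymptotics.IsBigO.of_bound ‖τ * q ^ N‖ (Filter.Eventually.of_forall fun n => ?_)
      rw [zpow_add₀ hq0, zpow_natCast, ← mul_assoc, norm_mul, norm_pow]
      simp
    simpa using h4.mul h3
  have hinj : Function.Injective fun n : ℕ => N + (n : ℤ) := fun m n h => by simpa using h
  rw [← hinj.summable_iff]
  · exact h1
  · intro n hn
    have : n < N := by
      by_contra h
      exact hn ⟨(n - N).toNat, by simp; omega⟩
    rw [hN n this, mul_zero]

theorem rpTerm_lattice_eq_zero (hq : ‖q‖ < 1) (hq0 : q ≠ 0) {p : Param M} {i : Fin (M + 3)}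
    (ha : p.1 i ≠ 0) (v : (Fin (M + 3) → ℤ) × (Fin (M + 3) → ℤ)) {n : ℤ} (hn : n < 1 - v.1 i) :
    rpTerm q (scaleParam q v p) ((p.1 i)⁻¹ * q ^ n) = 0 := by
  refine Finset.prod_eq_zero (Finset.mem_univ i) ?_
  have : (scaleParam q v p).1 i * ((p.1 i)⁻¹ * q ^ n) = q ^ (v.1 i + n) := by
    rw [zpow_add₀ hq0]
    simp only [scaleParam]
    field_simp
  rw [this, qPoch_zpow_eq_zero hq hq0 (by omega), zero_div]

theorem summable_rpTerm_mul (hq : ‖q‖ < 1) (hq0 : q ≠ 0) {p : Param M} {i : Fin (M + 3)}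
    (ha : p.1 i ≠ 0) (v : (Fin (M + 3) → ℤ) × (Fin (M + 3) → ℤ)) {G : ℂ → ℂ}
    (hG : ContinuousAt G 0) :
    Summable fun n : ℤ => (p.1 i)⁻¹ * q ^ n *
      (G ((p.1 i)⁻¹ * q ^ n) * rpTerm q (scaleParam q v p) ((p.1 i)⁻¹ * q ^ n)) :=
  summable_mul_of_continuousAt hq hq0 _ (G := fun t => G t * rpTerm q (scaleParam q v p) t)
    (hG.mul (continuousAt_rpTerm_zero hq _)) (N := 1 - v.1 i) fun n hn => by
      rw [rpTerm_lattice_eq_zero hq hq0 ha v hn, mul_zero]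

/-- `∑_{t ∈ q^ℤ / a_i} t f(t)`, where `f` is the integrand for the parameters scaled by `v`. -/
def latticeSum (q : ℂ) (p : Param M) (i : Fin (M + 3)) (v : (Fin (M + 3) → ℤ) × (Fin (M + 3) → ℤ)) :
    ℂ :=
  ∑' n : ℤ, (p.1 i)⁻¹ * q ^ n * rpTerm q (scaleParam q v p) ((p.1 i)⁻¹ * q ^ n)

theorem summable_latticeSum (hq : ‖q‖ < 1) (hq0 : q ≠ 0) {p : Param M} {i : Fin (M + 3)}
    (ha : p.1 i ≠ 0) (v : (Fin (M + 3) → ℤ) × (Fin (M + 3) → ℤ)) :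
    Summable fun n : ℤ => (p.1 i)⁻¹ * q ^ n *
      rpTerm q (scaleParam q v p) ((p.1 i)⁻¹ * q ^ n) := by
  simpa using summable_rpTerm_mul hq hq0 ha v (G := fun _ => 1) continuousAt_const

/-- A shift of a_i moves the endpoint q/a_i within the fixed lattice q^ℤ/a_i, and beyond the
endpoint (a_i t)_∞ vanishes. After this reformulation shifts act on the summands only. -/
theorem jacksonZero_scaleParam (hq : ‖q‖ < 1) (hq0 : q ≠ 0) {p : Param M} {i : Fin (M + 3)}
    (ha : p.1 i ≠ 0) (v : (Fin (M + 3) → ℤ) × (Fin (M + 3) → ℤ)) :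
    jacksonZero q (rpTerm q (scaleParam q v p)) (q / (scaleParam q v p).1 i) =
      (1 - q) * latticeSum q p i v := by
  have h := tsum_int_eq_tsum_nat (g := fun n : ℤ => (p.1 i)⁻¹ * q ^ n *
    rpTerm q (scaleParam q v p) ((p.1 i)⁻¹ * q ^ n)) (N := 1 - v.1 i) fun n hn => by
      rw [rpTerm_lattice_eq_zero hq hq0 ha v hn, mul_zero]
  rw [jacksonZero, latticeSum, h]
  congr 2
  funext n
  have : q / (scaleParam q v p).1 i * q ^ n = (p.1 i)⁻¹ * q ^ (1 - v.1 i + n) := by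
    rw [zpow_add₀ hq0, zpow_sub₀ hq0, zpow_one, zpow_natCast]
    simp only [scaleParam]
    have := zpow_ne_zero (v.1 i) hq0
    field_simp
  rw [this, mul_comm]

theorem rpIntegral_shiftPoint (hq : ‖q‖ < 1) (hq0 : q ≠ 0) {p : Param M} (ha : ∀ i, p.1 i ≠ 0)
    (i j : Fin (M + 3)) (v : AdmShift M) :
    rpIntegral q i j (shiftPoint q v p) =
      (1 - q) * (latticeSum q p j v.1 - latticeSum q p i v.1) := by
  rw [mul_sub, ← jacksonZero_scaleParam hq hq0 (ha i), ← jacksonZero_scaleParam hq hq0 (ha j)]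
  rfl

theorem isRegularAt_lattice (hq0 : q ≠ 0) {p : Param M} (hp : p ∈ genericParams q M)
    (i : Fin (M + 3)) (n : ℤ) : IsRegularAt q p ((p.1 i)⁻¹ * q ^ n) := by
  intro k m h
  refine hp.2.2 i k (m + n) ?_
  have := hp.1.1 i
  rw [zpow_add₀ hq0]
  field_simp at h
  linear_combination -h

end Lattice

/-! ## The Jackson integrals solve the system -/

section Solutions

variable {M : ℕ} {q : ℂ}

/-- The exponent of `T_{a_k}`. -/
def expA (k : Fin (M + 3)) : (Fin (M + 3) → ℤ) × (Fin (M + 3) → ℤ) := (Pi.single k 1, 0)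

/-- The exponent of `T_{b_k}`. -/
def expB (k : Fin (M + 3)) : (Fin (M + 3) → ℤ) × (Fin (M + 3) → ℤ) := (0, Pi.single k 1)

theorem coe_shAA (k l : Fin (M + 3)) : (shAA k l : AdmShift M).1 = expA k - expA l := by
  ext <;> simp [shAA, expA]

theorem coe_shBB (k l : Fin (M + 3)) : (shBB k l : AdmShift M).1 = expB k - expB l := by
  ext <;> simp [shBB, expB]

theorem coe_shAB (k l : Fin (M + 3)) : (shAB k l : AdmShift M).1 = expA k + expB l := by
  ext <;> simp [shAB, expA, expB]

@[simp] theorem expA_fst (k i : Fin (M + 3)) : (expA k).1 i = if i = k then 1 else 0 := by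
  simp [expA, Pi.single_apply]

@[simp] theorem expA_snd (k i : Fin (M + 3)) : (expA k).2 i = 0 := rfl

@[simp] theorem expB_fst (k i : Fin (M + 3)) : (expB k).1 i = 0 := rfl

@[simp] theorem expB_snd (k i : Fin (M + 3)) : (expB k).2 i = if i = k then 1 else 0 := by
  simp [expB, Pi.single_apply]

theorem rpTerm_sub_expA (hq : ‖q‖ < 1) (hq0 : q ≠ 0) (p : Param M)
    (v : (Fin (M + 3) → ℤ) × (Fin (M + 3) → ℤ)) (k : Fin (M + 3)) (t : ℂ) :
    rpTerm q (scaleParam q (v - expA k) p) t = (1 - q ^ (v.1 k - 1) * p.1 k * t) *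
      rpTerm q (scaleParam q v p) t := by
  have := rpTerm_eq_mul_A hq hq0 p (v - expA k) k t
  rw [this]
  simp [expA]

theorem rpTerm_add_expB (hq : ‖q‖ < 1) (hq0 : q ≠ 0) {p : Param M}
    (v : (Fin (M + 3) → ℤ) × (Fin (M + 3) → ℤ)) (k : Fin (M + 3)) {t : ℂ}
    (ht : IsRegularAt q p t) :
    rpTerm q (scaleParam q (v + expB k) p) t = (1 - q ^ v.2 k * p.2 k * t) *
      rpTerm q (scaleParam q v p) t :=
  rpTerm_mul_B hq hq0 v k ht

/-- The coefficients do not depend on t, so a pointwise relation between integrands can be summed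
over both lattices. -/
theorem rpIntegral_three_term (hq : ‖q‖ < 1) (hq0 : q ≠ 0) {p : Param M}
    (hp : p ∈ genericParams q M) (i j : Fin (M + 3)) {v w : AdmShift M} {c₁ c₂ c₃ : ℂ}
    (H : ∀ t, IsRegularAt q p t → c₁ * rpTerm q (scaleParam q v.1 p) t
      - c₂ * rpTerm q (scaleParam q w.1 p) t + c₃ * rpTerm q (scaleParam q 0 p) t = 0) :
    c₁ * rpIntegral q i j (shiftPoint q v p) - c₂ * rpIntegral q i j (shiftPoint q w p)
      + c₃ * rpIntegral q i j p = 0 := by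
  have h0 : shiftPoint q (0 : AdmShift M) p = p := scaleParam_zero q p
  have key : ∀ i, c₁ * latticeSum q p i v.1 - c₂ * latticeSum q p i w.1
      + c₃ * latticeSum q p i 0 = 0 := fun i => by
    have hs := fun v => summable_latticeSum hq hq0 (hp.1.1 i) v
    simp only [latticeSum]
    rw [← tsum_mul_left, ← tsum_mul_left, ← tsum_mul_left,
      ← ((hs _).mul_left _).tsum_sub ((hs _).mul_left _),
      ← (((hs _).mul_left _).sub ((hs _).mul_left _)).tsum_add ((hs _).mul_left _)]
    rw [← tsum_zero (α := ℂ) (β := ℤ)]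
    congr 1
    funext n
    linear_combination ((p.1 i)⁻¹ * q ^ n) * H _ (isRegularAt_lattice hq0 hp i n)
  have h3 := rpIntegral_shiftPoint hq hq0 hp.1.1 i j 0
  rw [h0] at h3
  rw [rpIntegral_shiftPoint hq hq0 hp.1.1, rpIntegral_shiftPoint hq hq0 hp.1.1, h3]
  have e : (0 : AdmShift M).1 = 0 := rfl
  rw [e]
  linear_combination (1 - q) * (key j - key i)

theorem rpTerm_eq_sub_expA (hq : ‖q‖ < 1) (hq0 : q ≠ 0) (p : Param M) (k : Fin (M + 3)) (t : ℂ) :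
    rpTerm q (scaleParam q 0 p) t = (1 - p.1 k * t) * rpTerm q (scaleParam q (expA k) p) t := by
  rw [← sub_self (expA k), rpTerm_sub_expA hq hq0]
  simp

theorem rpTerm_eq_add_expB (hq : ‖q‖ < 1) (hq0 : q ≠ 0) {p : Param M} (k : Fin (M + 3)) {t : ℂ}
    (ht : IsRegularAt q p t) : rpTerm q (scaleParam q 0 p) t =
      (1 - q⁻¹ * p.2 k * t) * rpTerm q (scaleParam q (-expB k) p) t := by
  rw [← neg_add_cancel (expB k), rpTerm_add_expB hq hq0 _ _ ht]
  simp

/-! ### Contiguity relations: identities between linear polynomials in t -/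

section Contiguity

variable (hq : ‖q‖ < 1) (hq0 : q ≠ 0) {p : Param M} (hp : p ∈ genericParams q M)
  (i j : Fin (M + 3))
include hq hq0 hp

theorem rpIntegral_eqAA {k l : Fin (M + 3)} (hk : k ≠ 0) (hkl : k ≠ l) :
    (p.1 0 - q * p.1 k) * rpIntegral q i j (shiftPoint q (shAA k l) p)
      - (p.1 l - q * p.1 k) * rpIntegral q i j (shiftPoint q (shAA k 0) p)
      + (p.1 l - p.1 0) * rpIntegral q i j p = 0 := by
  refine rpIntegral_three_term hq hq0 hp i j fun t _ => ?_
  rw [coe_shAA, coe_shAA, rpTerm_sub_expA hq hq0, rpTerm_sub_expA hq hq0,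
    rpTerm_eq_sub_expA hq hq0 p k]
  simp only [expA_fst, if_neg hkl.symm, if_neg hk.symm, zero_sub, zpow_neg_one]
  field_simp
  ring

theorem rpIntegral_eqA {k : Fin (M + 3)} (hk : k ≠ 0) :
    (p.2 0 - p.1 0) * rpIntegral q i j (shiftPoint q (shAA 0 k) p)
      - (q⁻¹ * p.1 k - p.1 0) * rpIntegral q i j (shiftPoint q (shAB 0 0) p)
      + (q⁻¹ * p.1 k - p.2 0) * rpIntegral q i j p = 0 := by
  refine rpIntegral_three_term hq hq0 hp i j fun t ht => ?_
  rw [coe_shAA, coe_shAB, rpTerm_sub_expA hq hq0, rpTerm_add_expB hq hq0 _ _ ht,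
    rpTerm_eq_sub_expA hq hq0 p 0]
  simp only [expA_fst, expA_snd, if_neg hk, zero_sub, zpow_neg_one, zpow_zero, one_mul]
  field_simp
  ring

theorem rpIntegral_eqBB {k l : Fin (M + 3)} (hl : l ≠ 0) (hkl : k ≠ l) :
    (p.2 0 - q⁻¹ * p.2 l) * rpIntegral q i j (shiftPoint q (shBB k l) p)
      - (p.2 k - q⁻¹ * p.2 l) * rpIntegral q i j (shiftPoint q (shBB 0 l) p)
      + (p.2 k - p.2 0) * rpIntegral q i j p = 0 := by
  refine rpIntegral_three_term hq hq0 hp i j fun t ht => ?_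
  rw [coe_shBB, coe_shBB, sub_eq_neg_add (expB k), sub_eq_neg_add (expB 0), rpTerm_add_expB hq hq0 _ _ ht,
    rpTerm_add_expB hq hq0 _ _ ht, rpTerm_eq_add_expB hq hq0 l ht]
  simp only [Prod.snd_neg, Pi.neg_apply, expB_snd, if_neg hkl, if_neg hl.symm, neg_zero, zpow_zero,
    one_mul]
  ring

theorem rpIntegral_eqB {k : Fin (M + 3)} (hk : k ≠ 0) :
    (p.1 0 - p.2 0) * rpIntegral q i j (shiftPoint q (shBB k 0) p)
      - (q * p.2 k - p.2 0) * rpIntegral q i j (shiftPoint q (-shAB 0 0) p)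
      + (q * p.2 k - p.1 0) * rpIntegral q i j p = 0 := by
  refine rpIntegral_three_term hq hq0 hp i j fun t ht => ?_
  rw [AddSubgroup.coe_neg, coe_shBB, coe_shAB, sub_eq_neg_add (expB k), rpTerm_add_expB hq hq0 _ _ ht,
    neg_add_rev, ← sub_eq_add_neg, rpTerm_sub_expA hq hq0, rpTerm_eq_add_expB hq hq0 0 ht]
  simp only [Prod.snd_neg, Prod.fst_neg, Pi.neg_apply, expB_snd, expB_fst, if_neg hk, neg_zero,
    zpow_zero, one_mul, zero_sub, zpow_neg_one]
  field_simp
  ring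

theorem rpIntegral_eqAB (k l : Fin (M + 3)) :
    (p.2 0 - p.1 k) * rpIntegral q i j (shiftPoint q (shAB k l) p)
      - (p.2 l - p.1 k) * rpIntegral q i j (shiftPoint q (shAB k 0) p)
      + (p.2 l - p.2 0) * rpIntegral q i j p = 0 := by
  refine rpIntegral_three_term hq hq0 hp i j fun t ht => ?_
  rw [coe_shAB, coe_shAB, rpTerm_add_expB hq hq0 _ _ ht, rpTerm_add_expB hq hq0 _ _ ht,
    rpTerm_eq_sub_expA hq hq0 p k]
  simp only [expA_snd, zpow_zero, one_mul]
  ring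

theorem rpIntegral_eqABinv (k l : Fin (M + 3)) :
    (p.2 l - p.1 0) * rpIntegral q i j (shiftPoint q (-shAB k l) p)
      - (p.2 l - p.1 k) * rpIntegral q i j (shiftPoint q (-shAB 0 l) p)
      + (p.1 0 - p.1 k) * rpIntegral q i j p = 0 := by
  refine rpIntegral_three_term hq hq0 hp i j fun t ht => ?_
  rw [AddSubgroup.coe_neg, AddSubgroup.coe_neg, coe_shAB, coe_shAB, neg_add_rev, neg_add_rev,
    ← sub_eq_add_neg, ← sub_eq_add_neg, rpTerm_sub_expA hq hq0, rpTerm_sub_expA hq hq0,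
    rpTerm_eq_add_expB hq hq0 l ht]
  simp only [Prod.fst_neg, Pi.neg_apply, expB_fst, neg_zero, zero_sub, zpow_neg_one]
  field_simp
  ring

/-- Scaling all parameters by q replaces f(t) by f(qt), which is undone by translating the lattice
by one step. -/
theorem rpIntegral_eqAll :
    q * rpIntegral q i j (shiftPoint q (∑ k, shAB k k) p) - rpIntegral q i j p = 0 := by
  have h0 : shiftPoint q (0 : AdmShift M) p = p := scaleParam_zero q p
  have hs : (∑ k, shAB k k : AdmShift M).1 = (1, 1) := by
    rw [AddSubgroup.val_finsetSum]
    refine Prod.ext (funext fun i => ?_) (funext fun i => ?_)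
    · simp [Prod.fst_sum, coe_shAB]
    · simp [Prod.snd_sum, coe_shAB]
  have key : ∀ i, q * latticeSum q p i (∑ k, shAB k k : AdmShift M).1 = latticeSum q p i 0 := by
    intro i
    rw [hs, latticeSum, latticeSum, ← tsum_mul_left, ← (Equiv.addRight (1 : ℤ)).tsum_eq]
    nth_rewrite 2 [← (Equiv.addRight (1 : ℤ)).tsum_eq]
    rw [← (Equiv.addRight (-1 : ℤ)).tsum_eq]
    congr 1
    funext n
    have e : ∀ t, rpTerm q (scaleParam q (1, 1) p) t = rpTerm q p (t * q) := fun t => by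
      simp only [rpTerm, scaleParam, Pi.one_apply, zpow_one]
      refine Finset.prod_congr rfl fun k _ => ?_
      congr 2 <;> ring
    simp only [e, scaleParam_zero, Equiv.coe_addRight, neg_add_cancel_right]
    rw [zpow_add_one₀ hq0]
    ring_nf
  have h3 := rpIntegral_shiftPoint hq hq0 hp.1.1 i j 0
  rw [h0] at h3
  rw [rpIntegral_shiftPoint hq hq0 hp.1.1, h3]
  have e : (0 : AdmShift M).1 = 0 := rfl
  rw [e]
  linear_combination (1 - q) * (key j - key i)

end Contiguity

/-! ### The equation Ê_M y = 0 by telescoping -/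

theorem tsum_int_sub_eq_neg {g : ℤ → ℂ} {N : ℤ} {L : ℂ} (hg : ∀ n ≤ N, g n = 0)
    (hL : Filter.Tendsto (fun n : ℕ => g (N + n)) Filter.atTop (𝓝 L))
    (hs : Summable fun n => g (n - 1) - g n) : ∑' n, (g (n - 1) - g n) = -L := by
  have hsn : Summable fun n : ℕ => g (N + 1 + n - 1) - g (N + 1 + n) :=
    hs.comp_injective (i := fun n : ℕ => N + 1 + (n : ℤ)) fun m n h => by simpa using h
  rw [tsum_int_eq_tsum_nat (N := N + 1) fun n hn => by
    rw [hg _ (by omega), hg _ (by omega), sub_zero]]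
  refine tendsto_nhds_unique hsn.hasSum.tendsto_sum_nat ?_
  have h1 : ∀ n, ∑ i ∈ Finset.range n, (g (N + 1 + i - 1) - g (N + 1 + i)) = - g (N + n) := by
    intro n
    induction n with
    | zero => simp [hg N le_rfl]
    | succ n ih =>
      rw [Finset.sum_range_succ, ih]
      push_cast
      rw [show N + 1 + (n : ℤ) - 1 = N + n by ring, show N + 1 + (n : ℤ) = N + (n + 1) by ring]
      ring
  simp only [h1]
  exact hL.neg

/-- The antidifference used to sum the action of `Ê_M` on the integrand. -/
def hatPrimitive (q : ℂ) (p : Param M) (t : ℂ) : ℂ :=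
  (∏ k : Fin (M + 2), (1 - t * p.2 k.succ)) * rpTerm q p t /
    ∏ i ∈ Finset.range M, (1 - p.1 0 * t * q ^ i)

/-- T trades a factor 1 - a_1 t for a factor 1 - b_1 t. The evaluation at q s instead of s
compensates for the sequence starting at T⁻¹. -/
theorem isQGeometric_rpTerm (hq : ‖q‖ < 1) (hq0 : q ≠ 0) {p : Param M} {s : ℂ}
    (ht : IsRegularAt q p (q * s)) :
    IsQGeometric q (p.1 0 * s) (p.2 0 * s) fun j =>
      rpTerm q (scaleParam q (((j : ℤ) - 1) • shAB 0 0 : AdmShift M).1 p) (q * s) := by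
  intro j
  have e : (((j + 1 : ℕ) : ℤ) - 1) • (shAB 0 0 : AdmShift M) = (((j : ℤ) - 1) • shAB 0 0) + shAB 0 0 := by
    rw [← add_one_zsmul]; congr 1; push_cast; ring
  have e2 : (((j + 1 : ℕ) : ℤ) - 1) • (shAB 0 0 : AdmShift M).1 - expA 0 =
      (((j : ℤ) - 1) • (shAB 0 0 : AdmShift M).1) + expB 0 := by
    have := congrArg Subtype.val e
    simp only [AddSubgroup.coe_zsmul, AddSubgroup.coe_add] at this
    rw [this, coe_shAB]
    abel
  have h1 := rpTerm_sub_expA hq hq0 p ((((j + 1 : ℕ) : ℤ) - 1) • (shAB 0 0 : AdmShift M).1) 0 (q * s)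
  have h2 := rpTerm_add_expB hq hq0 (((j : ℤ) - 1) • (shAB 0 0 : AdmShift M).1) 0 ht
  rw [e2, h2] at h1
  have e3 : ((((j + 1 : ℕ) : ℤ) - 1) • (shAB 0 0 : AdmShift M).1).1 0 - 1 = (j : ℤ) - 1 := by
    simp [coe_shAB]
  have e4 : (((j : ℤ) - 1) • (shAB 0 0 : AdmShift M).1).2 0 = (j : ℤ) - 1 := by
    simp [coe_shAB]
  rw [e3, e4, zpow_sub_one₀ hq0, zpow_natCast] at h1
  simp only [AddSubgroup.coe_zsmul]
  have e5 : ∀ x : ℂ, q ^ j * q⁻¹ * x * (q * s) = x * s * q ^ j := fun x => by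
    field_simp
  rw [e5, e5] at h1
  exact h1.symm

/-- The two products in the closed form for P are, up to the common denominator ∏_i (1 - a_1 s q^i),
the values of the primitive at s and at q s; this uses f(s) ∏(1 - b_k s) = ∏(1 - a_k s) f(qs). -/
theorem mul_sum_coeff_rpTerm (hq : ‖q‖ < 1) (hq0 : q ≠ 0) {p : Param M}
    (hp : p ∈ paramVariety q M) {s : ℂ} (ht : IsRegularAt q p (q * s))
    (ha : ∀ n : ℕ, 1 - p.1 0 * s * q ^ n ≠ 0) :
    q * s * ∑ j ∈ Finset.range (M + 2), (hatPoly q p.1 p.2 (p.1 0 / p.2 0)).coeff j *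
        rpTerm q (scaleParam q (((j : ℤ) - 1) • shAB 0 0 : AdmShift M).1 p) (q * s) =
      q * p.2 0 ^ (M + 1) * (∏ i ∈ Finset.range M, (1 - p.1 0 / p.2 0 * q ^ i)) *
        (hatPrimitive q p s - hatPrimitive q p (q * s)) := by
  have hgeo := isQGeometric_rpTerm hq hq0 ht
  have hsum := hgeo.sum_coeff_hatPoly hq0 (hp.2.1 0) hp.2.2
  have h0 := hgeo 0
  set y : ℕ → ℂ := fun j =>
    rpTerm q (scaleParam q (((j : ℤ) - 1) • shAB 0 0 : AdmShift M).1 p) (q * s) with hy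
  have hy1 : y 1 = rpTerm q p (q * s) := by
    have : (((1 : ℕ) : ℤ) - 1) • (shAB 0 0 : AdmShift M) = 0 := by simp
    simp only [hy, this]
    exact congrArg (fun p => rpTerm q p (q * s)) (scaleParam_zero q p)
  simp only [zero_add, pow_zero, mul_one] at h0
  rw [hy1] at h0
  have hbk : ∀ k, 1 - p.2 k * s ≠ 0 := fun k h => ht k (-1) (by
    rw [zpow_neg_one]; field_simp; linear_combination -h)
  have hstep := rpTerm_mul_prod hq hbk
  rw [Fin.prod_univ_succ (fun k => 1 - p.2 k * s), Fin.prod_univ_succ (fun k => 1 - p.1 k * s),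
    mul_comm s q] at hstep
  have hBs : (∏ k : Fin (M + 2), (1 - s * p.2 k.succ)) * rpTerm q p s =
      (∏ k : Fin (M + 2), (1 - s * p.1 k.succ)) * y 0 := by
    apply mul_left_cancel₀ (hbk 0)
    simp only [mul_comm s]
    linear_combination hstep + (∏ k : Fin (M + 2), (1 - p.1 k.succ * s)) * h0
  have hD1 : ∏ i ∈ Finset.range (M + 1), (1 - p.1 0 * s * q ^ i) =
      (∏ i ∈ Finset.range M, (1 - p.1 0 * s * q ^ i)) * (1 - p.1 0 * s * q ^ M) :=
    Finset.prod_range_succ _ _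
  have hD2 : ∏ i ∈ Finset.range (M + 1), (1 - p.1 0 * s * q ^ i) =
      (∏ i ∈ Finset.range M, (1 - p.1 0 * (q * s) * q ^ i)) * (1 - p.1 0 * s) := by
    rw [Finset.prod_range_succ', pow_zero, mul_one]
    congr 1
    exact Finset.prod_congr rfl fun i _ => by ring
  have hD0 : ∏ i ∈ Finset.range (M + 1), (1 - p.1 0 * s * q ^ i) ≠ 0 :=
    Finset.prod_ne_zero_iff.2 fun i _ => ha i
  have hn1 : ∏ i ∈ Finset.range M, (1 - p.1 0 * s * q ^ i) ≠ 0 := left_ne_zero_of_mul (hD1 ▸ hD0)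
  have hn2 : ∏ i ∈ Finset.range M, (1 - p.1 0 * (q * s) * q ^ i) ≠ 0 :=
    left_ne_zero_of_mul (hD2 ▸ hD0)
  have hp1 : hatPrimitive q p s * ∏ i ∈ Finset.range (M + 1), (1 - p.1 0 * s * q ^ i) =
      (1 - p.1 0 * s * q ^ M) * (∏ k : Fin (M + 2), (1 - s * p.1 k.succ)) * y 0 := by
    rw [hatPrimitive, hBs, hD1, ← mul_assoc, div_mul_cancel₀ _ hn1]
    ring
  have hp2 : hatPrimitive q p (q * s) * ∏ i ∈ Finset.range (M + 1), (1 - p.1 0 * s * q ^ i) =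
      (1 - p.2 0 * s) * (∏ k : Fin (M + 2), (1 - q * s * p.2 k.succ)) * y 0 := by
    rw [hatPrimitive, hD2, ← mul_assoc, div_mul_cancel₀ _ hn2]
    linear_combination (∏ k : Fin (M + 2), (1 - q * s * p.2 k.succ)) * h0
  apply mul_right_cancel₀ hD0
  set K := p.2 0 ^ (M + 1) * ∏ i ∈ Finset.range M, (1 - p.1 0 / p.2 0 * q ^ i)
  linear_combination q * hsum - q * K * hp1 + q * K * hp2

/-- The telescoping sum leaves only the limit at t = 0, where the primitive equals 1. The value does
not involve i. The case i = 0 is excluded because the denominators 1 - a_1 t q^n must not vanish on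
the lattice. -/
theorem sum_coeff_latticeSum (hq : ‖q‖ < 1) (hq0 : q ≠ 0) {p : Param M}
    (hp : p ∈ genericParams q M) {i : Fin (M + 3)} (hi : i ≠ 0) :
    ∑ j ∈ Finset.range (M + 2), (hatPoly q p.1 p.2 (p.1 0 / p.2 0)).coeff j *
        latticeSum q p i (((j : ℤ) - 1) • shAB 0 0 : AdmShift M).1 =
      -(q * p.2 0 ^ (M + 1) * (∏ i ∈ Finset.range M, (1 - p.1 0 / p.2 0 * q ^ i))) := by
  set K := q * p.2 0 ^ (M + 1) * (∏ i ∈ Finset.range M, (1 - p.1 0 / p.2 0 * q ^ i)) with hK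
  have hai := hp.1.1 i
  set τ := (p.1 i)⁻¹ with hτ
  have hsm := fun v => summable_latticeSum hq hq0 hai v
  have hrw : ∀ n : ℤ, q * (τ * q ^ (n - 1)) = τ * q ^ n := fun n => by
    rw [zpow_sub_one₀ hq0]; field_simp
  have hterm : ∀ n : ℤ, ∑ j ∈ Finset.range (M + 2),
      (hatPoly q p.1 p.2 (p.1 0 / p.2 0)).coeff j * (τ * q ^ n *
        rpTerm q (scaleParam q (((j : ℤ) - 1) • shAB 0 0 : AdmShift M).1 p) (τ * q ^ n)) =
      K * hatPrimitive q p (τ * q ^ (n - 1)) - K * hatPrimitive q p (τ * q ^ n) := fun n => by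
    have hreg := isRegularAt_lattice hq0 hp i n
    rw [← hτ, ← hrw] at hreg
    have := mul_sum_coeff_rpTerm hq hq0 hp.1 hreg
      fun m h => by
        refine hp.2.1 i 0 hi (n - 1 + m) ?_
        rw [zpow_add₀ hq0, zpow_natCast]
        rw [hτ] at h
        field_simp at h
        linear_combination h
    rw [hrw] at this
    rw [← mul_sub, ← this, Finset.mul_sum]
    exact Finset.sum_congr rfl fun j _ => by ring
  have hsumm : Summable fun n : ℤ => K * hatPrimitive q p (τ * q ^ (n - 1)) -
      K * hatPrimitive q p (τ * q ^ n) := by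
    simp only [← hterm]
    exact summable_sum fun j _ => (hsm _).mul_left _
  have hzero : ∀ n ≤ (0 : ℤ), K * hatPrimitive q p (τ * q ^ n) = 0 := fun n hn => by
    have := rpTerm_lattice_eq_zero hq hq0 hai 0 (n := n) (by simp; omega)
    rw [scaleParam_zero] at this
    rw [hatPrimitive, this, mul_zero, zero_div, mul_zero]
  have hlim : Filter.Tendsto (fun n : ℕ => K * hatPrimitive q p (τ * q ^ (0 + n : ℤ)))
      Filter.atTop (𝓝 K) := by
    have hc : ContinuousAt (hatPrimitive q p) 0 := by
      refine ContinuousAt.div (ContinuousAt.mul (by fun_prop) (continuousAt_rpTerm_zero hq p))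
        (by fun_prop) (by simp)
    have h1 : hatPrimitive q p 0 = 1 := by simp [hatPrimitive, rpTerm_zero]
    have := (hc.tendsto.comp (tendsto_mul_zpow_zero hq hq0 τ 0)).const_mul K
    rwa [h1, mul_one] at this
  rw [← tsum_int_sub_eq_neg hzero hlim hsumm]
  simp only [← hterm, latticeSum]
  rw [Summable.tsum_finsetSum fun j _ => (hsm _).mul_left _]
  exact Finset.sum_congr rfl fun j _ => tsum_mul_left.symm

theorem sum_coeff_rpIntegral (hq : ‖q‖ < 1) (hq0 : q ≠ 0) {p : Param M}
    (hp : p ∈ genericParams q M) {i j : Fin (M + 3)} (hi : i ≠ 0) (hj : j ≠ 0) :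
    ∑ m ∈ Finset.range (M + 2), (hatPoly q p.1 p.2 (p.1 0 / p.2 0)).coeff m *
        rpIntegral q i j (shiftPoint q (((m : ℤ) - 1) • shAB 0 0) p) = 0 := by
  simp only [rpIntegral_shiftPoint hq hq0 hp.1.1]
  have h1 := sum_coeff_latticeSum hq hq0 hp hi
  have h2 := sum_coeff_latticeSum hq hq0 hp hj
  rw [← h1] at h2
  simp only [mul_left_comm _ (1 - q), mul_sub, Finset.sum_sub_distrib, ← Finset.mul_sum] at h2 ⊢
  rw [h2, sub_self]

/-! ### The system read pointwise on a shift-stable set -/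

theorem isShiftAction_shiftFun (hq0 : q ≠ 0) {U : Set (Param M)} (hU : ShiftStable q U) :
    IsShiftAction (shiftFun hU) := by
  refine ⟨fun y => funext fun p => ?_, fun v w y => funext fun p => ?_⟩
  · exact congrArg y (Subtype.ext (scaleParam_zero q p.1))
  · refine congrArg y (Subtype.ext ?_)
    have := scaleParam_add hq0 w.1 v.1 p.1
    rwa [add_comm] at this

theorem shiftFun_coord_div (hq0 : q ≠ 0) {U : Set (Param M)} (hU : ShiftStable q U) :
    shiftFun hU (shAB 0 0) (coordA U 0 / coordB U 0) = coordA U 0 / coordB U 0 := by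
  funext p
  change q ^ (shAB 0 0 : AdmShift M).1.1 0 * p.1.1 0 / (q ^ (shAB 0 0 : AdmShift M).1.2 0 * p.1.2 0) =
    p.1.1 0 / p.1.2 0
  rw [coe_shAB]
  simp only [Prod.fst_add, Prod.snd_add, Pi.add_apply, expA_fst, expB_fst, expA_snd, expB_snd,
    if_true, add_zero, zero_add, zpow_one]
  rw [mul_div_mul_left _ _ hq0]

theorem hatPoly_coord_apply {U : Set (Param M)} (p : U) (j : ℕ) :
    (hatPoly q (coordA U) (coordB U) (coordA U 0 / coordB U 0)).coeff j p =
      (hatPoly q p.1.1 p.1.2 (p.1.1 0 / p.1.2 0)).coeff j := by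
  have := congrArg (fun P => P.coeff j) (map_hatPoly (Pi.evalAlgHom ℂ (fun _ : U => ℂ) p) q
    (coordA U) (coordB U) (coordA U 0 / coordB U 0))
  rw [coeff_map] at this
  exact this

theorem hatE_shiftFun_apply (hq0 : q ≠ 0) {U : Set (Param M)} (hU : ShiftStable q U) (y : U → ℂ)
    (p : U) : hatE q (shiftFun hU) (coordA U) (coordB U) y p =
      ∑ j ∈ Finset.range (M + 2), (hatPoly q p.1.1 p.1.2 (p.1.1 0 / p.1.2 0)).coeff j *
        shiftFun hU (((j : ℤ) - 1) • shAB 0 0) y p := by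
  rw [hatE_apply (isShiftAction_shiftFun hq0 hU) _ _ _ (shiftFun_coord_div hq0 hU),
    Finset.sum_apply]
  refine Finset.sum_congr rfl fun j _ => ?_
  rw [Pi.mul_apply, hatPoly_coord_apply]

theorem isSolutionRP_rpIntegral (hq : ‖q‖ < 1) (hq0 : q ≠ 0) {U : Set (Param M)}
    (hUg : U ⊆ genericParams q M) (hU : ShiftStable q U) {i j : Fin (M + 3)} (hi : i ≠ 0)
    (hj : j ≠ 0) : IsSolutionRP q (shiftFun hU) (coordA U) (coordB U)
      fun p : U => rpIntegral q i j p.1 := by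
  refine ⟨funext fun p => ?_, fun k l hk hl hkl => funext fun p => ?_, fun k hk => funext fun p => ?_,
    fun k l hk hl hkl => funext fun p => ?_, fun k hk => funext fun p => ?_,
    fun k l hk hl hkl => funext fun p => ?_, fun k l hk hl hkl => funext fun p => ?_,
    funext fun p => ?_⟩
  · rw [hatE_shiftFun_apply hq0]
    exact sum_coeff_rpIntegral hq hq0 (hUg p.2) hi hj
  · exact rpIntegral_eqAA hq hq0 (hUg p.2) i j hk hkl
  · exact rpIntegral_eqA hq hq0 (hUg p.2) i j hk
  · exact rpIntegral_eqBB hq hq0 (hUg p.2) i j hl hkl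
  · exact rpIntegral_eqB hq hq0 (hUg p.2) i j hk
  · exact rpIntegral_eqAB hq hq0 (hUg p.2) i j k l
  · exact rpIntegral_eqABinv hq hq0 (hUg p.2) i j k l
  · exact rpIntegral_eqAll hq hq0 (hUg p.2) i j

end Solutions

/-! ## Vanishing of a solution on an orbit -/

section Orbit

variable {M : ℕ} {q : ℂ}

theorem scaleParam_mem_genericParams (hq0 : q ≠ 0) {p : Param M} (hp : p ∈ genericParams q M)
    (v : AdmShift M) : scaleParam q v.1 p ∈ genericParams q M := by
  have : NeZero q := ⟨hq0⟩
  refine ⟨shiftStable_paramVariety q M v p hp.1, fun i j hij n h => ?_, fun i j n h => ?_⟩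
  · refine hp.2.1 i j hij (n + v.1.1 j - v.1.1 i) ?_
    rw [zpow_sub₀ hq0, zpow_add₀ hq0]
    have := zpow_ne_zero (v.1.1 i) hq0
    simp only [scaleParam] at h
    field_simp
    linear_combination h
  · refine hp.2.2 i j (n + v.1.2 j - v.1.1 i) ?_
    rw [zpow_sub₀ hq0, zpow_add₀ hq0]
    have := zpow_ne_zero (v.1.1 i) hq0
    simp only [scaleParam] at h
    field_simp
    linear_combination h

theorem shiftStable_genericParams (hq0 : q ≠ 0) : ShiftStable q (genericParams q M) :=
  fun v _ hp => scaleParam_mem_genericParams hq0 hp v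

theorem genericParams_ne (hq0 : q ≠ 0) {p : Param M} (hp : p ∈ genericParams q M)
    (i j : Fin (M + 3)) (n : ℤ) : q ^ n * p.1 i ≠ p.2 j := fun h => by
  refine hp.2.2 i j (-n) ?_
  rw [← h, ← mul_assoc, ← zpow_add₀ hq0, neg_add_cancel, zpow_zero, one_mul]

theorem coeff_zero_hatPoly_ne_zero (hq0 : q ≠ 0) {p : Param M} (hp : p ∈ genericParams q M) (c : ℂ) :
    (hatPoly q p.1 p.2 c).coeff 0 ≠ 0 := by
  rw [coeff_zero_hatPoly]
  refine Finset.prod_ne_zero_iff.2 fun i _ => sub_ne_zero.2 fun h => ?_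
  exact genericParams_ne hq0 hp i.succ 0 0 (by rw [zpow_zero, one_mul, h])

theorem coeff_top_hatPoly_ne_zero (hq0 : q ≠ 0) {p : Param M} (hp : p ∈ genericParams q M) :
    (hatPoly q p.1 p.2 (p.1 0 / p.2 0)).coeff (M + 1) ≠ 0 := by
  rw [coeff_top_hatPoly hq0 _ _ (hp.1.1 0) (hp.1.2.1 0) hp.1.2.2]
  refine mul_ne_zero (mul_ne_zero (mul_ne_zero (pow_ne_zero _ (by norm_num))
    (Finset.prod_ne_zero_iff.2 fun i _ => pow_ne_zero _ hq0))
    (div_ne_zero (hp.1.2.1 0) (hp.1.1 0))) (Finset.prod_ne_zero_iff.2 fun i _ => ?_)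
  refine sub_ne_zero.2 fun h => hp.2.2 0 i.succ (1 - M) ?_
  rw [h, zpow_sub₀ hq0, zpow_one, zpow_natCast, inv_pow]
  ring

/-- A function on the orbit of `p` which satisfies the equations of the system that determine it
from its values along the powers of `T_{a_1} T_{b_1}`. -/
structure IsOrbitSolution (q : ℂ) (p : Param M) (Y : AdmShift M → ℂ) : Prop where
  eqE : ∀ v : AdmShift M, ∑ m ∈ Finset.range (M + 2),
    (hatPoly q (scaleParam q v.1 p).1 (scaleParam q v.1 p).2
      ((scaleParam q v.1 p).1 0 / (scaleParam q v.1 p).2 0)).coeff m *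
        Y (v + ((m : ℤ) - 1) • shAB 0 0) = 0
  eqA : ∀ v : AdmShift M, ∀ k ≠ 0,
    ((scaleParam q v.1 p).2 0 - (scaleParam q v.1 p).1 0) * Y (v + shAA 0 k)
      - (q⁻¹ * (scaleParam q v.1 p).1 k - (scaleParam q v.1 p).1 0) * Y (v + shAB 0 0)
      + (q⁻¹ * (scaleParam q v.1 p).1 k - (scaleParam q v.1 p).2 0) * Y v = 0
  eqB : ∀ v : AdmShift M, ∀ k ≠ 0,
    ((scaleParam q v.1 p).1 0 - (scaleParam q v.1 p).2 0) * Y (v + shBB k 0)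
      - (q * (scaleParam q v.1 p).2 k - (scaleParam q v.1 p).2 0) * Y (v - shAB 0 0)
      + (q * (scaleParam q v.1 p).2 k - (scaleParam q v.1 p).1 0) * Y v = 0

theorem IsSolutionRP.isOrbitSolution (hq0 : q ≠ 0) {U : Set (Param M)} (hU : ShiftStable q U)
    {y : U → ℂ} (hy : IsSolutionRP q (shiftFun hU) (coordA U) (coordB U) y) (p : U) :
    IsOrbitSolution q p.1 fun v => shiftFun hU v y p := by
  have hadd : ∀ v w : AdmShift M, shiftFun hU (v + w) y p =
      shiftFun hU w y ⟨scaleParam q v.1 p.1, hU v p.1 p.2⟩ := fun v w => by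
    rw [(isShiftAction_shiftFun hq0 hU).add]; rfl
  refine ⟨fun v => ?_, fun v k hk => ?_, fun v k hk => ?_⟩
  · have := congrFun hy.eqE ⟨scaleParam q v.1 p.1, hU v p.1 p.2⟩
    rw [hatE_shiftFun_apply hq0] at this
    simp only [hadd]
    exact this
  · simp only [hadd]
    exact congrFun (hy.eqA k hk) ⟨scaleParam q v.1 p.1, hU v p.1 p.2⟩
  · simp only [hadd, sub_eq_add_neg v]
    exact congrFun (hy.eqB k hk) ⟨scaleParam q v.1 p.1, hU v p.1 p.2⟩

theorem scaleParam_add_zsmul (hq0 : q ≠ 0) (p : Param M) (v : AdmShift M) (n : ℤ) :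
    (scaleParam q (v + n • shAB 0 0 : AdmShift M).1 p).1 0 = q ^ n * (scaleParam q v.1 p).1 0 ∧
    (scaleParam q (v + n • shAB 0 0 : AdmShift M).1 p).2 0 = q ^ n * (scaleParam q v.1 p).2 0 ∧
    ∀ k ≠ 0,
      (scaleParam q (v + n • shAB 0 0 : AdmShift M).1 p).1 k = (scaleParam q v.1 p).1 k ∧
      (scaleParam q (v + n • shAB 0 0 : AdmShift M).1 p).2 k = (scaleParam q v.1 p).2 k := by
  rw [AddSubgroup.coe_add, AddSubgroup.coe_zsmul, coe_shAB, add_comm v.1, scaleParam_add hq0]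
  refine ⟨?_, ?_, fun k hk => ⟨?_, ?_⟩⟩
  · simp [scaleParam]
  · simp [scaleParam]
  · simp [scaleParam, hk]
  · simp [scaleParam, hk]

namespace IsOrbitSolution

variable {p : Param M} {Y : AdmShift M → ℂ}

/-- The recurrence propagates zeros upwards through its nonzero top coefficient and downwards
through its nonzero bottom coefficient. -/
theorem zero_of_initial (hY : IsOrbitSolution q p Y) (hq0 : q ≠ 0) (hp : p ∈ genericParams q M)
    (h0 : ∀ j : ℕ, j < M + 1 → Y ((j : ℤ) • shAB 0 0) = 0) (j : ℤ) : Y (j • shAB 0 0) = 0 := by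
  have hpos : ∀ j : ℕ, Y ((j : ℤ) • shAB 0 0) = 0 := by
    intro j
    induction j using Nat.strong_induction_on with
    | _ j ih =>
      rcases Nat.lt_or_ge j (M + 1) with hj | hj
      · exact h0 j hj
      have h1 := hY.eqE (((j : ℤ) - M) • shAB 0 0)
      rw [Finset.sum_range_succ, Finset.sum_eq_zero, zero_add] at h1
      · have h2 := (mul_eq_zero.1 h1).resolve_left
          (coeff_top_hatPoly_ne_zero hq0 (scaleParam_mem_genericParams hq0 hp _))
        rw [← add_smul] at h2
        rw [← h2]
        congr 2
        push_cast
        ring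
      · intro m hm
        rw [Finset.mem_range] at hm
        obtain ⟨i, hi⟩ : ∃ i : ℕ, (j : ℤ) - M + (m - 1) = i := ⟨j - M + m - 1, by omega⟩
        rw [← add_smul, hi, ih i (by omega), mul_zero]
  have hneg : ∀ j : ℕ, Y ((-(j : ℤ)) • shAB 0 0) = 0 := by
    intro j
    induction j using Nat.strong_induction_on with
    | _ j ih =>
      rcases Nat.eq_zero_or_pos j with rfl | hj
      · exact hpos 0
      have h1 := hY.eqE ((1 - (j : ℤ)) • shAB 0 0)
      rw [Finset.sum_range_succ', Finset.sum_eq_zero, zero_add] at h1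
      · have h2 := (mul_eq_zero.1 h1).resolve_left
          (coeff_zero_hatPoly_ne_zero hq0 (scaleParam_mem_genericParams hq0 hp _) _)
        rw [← add_smul] at h2
        rw [← h2]
        congr 2
        push_cast
        ring
      · intro m hm
        rw [← add_smul]
        rcases le_or_gt j (m + 1) with hmj | hmj
        · obtain ⟨i, hi⟩ : ∃ i : ℕ, 1 - (j : ℤ) + ((m + 1 : ℕ) - 1) = i :=
            ⟨m + 1 - j, by omega⟩
          rw [hi, hpos i, mul_zero]
        · obtain ⟨i, hi⟩ : ∃ i : ℕ, 1 - (j : ℤ) + ((m + 1 : ℕ) - 1) = -(i : ℤ) :=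
            ⟨j - (m + 1), by omega⟩
          rw [hi, ih i (by omega), mul_zero]
  rcases Int.eq_nat_or_neg j with ⟨n, rfl | rfl⟩
  · exact hpos n
  · exact hneg n

/-- Forwards this is the contiguity relation. Backwards, zeros on the shifted line reduce that
relation to a first order recurrence on the original line, so Ê_M acts by the closed form. One of
its two products vanishes and the other is nonzero, hence the equation Ê_M Y = 0 forces Y = 0. Both
directions are needed, as the admissible shifts form a group. -/
theorem zero_add_iff_shAA (hY : IsOrbitSolution q p Y) (hq0 : q ≠ 0) (hp : p ∈ genericParams q M)
    {k : Fin (M + 3)} (hk : k ≠ 0) (v : AdmShift M) :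
    (∀ j : ℤ, Y (v + j • shAB 0 0) = 0) ↔ ∀ j : ℤ, Y (v + shAA 0 k + j • shAB 0 0) = 0 := by
  constructor
  · intro h j
    have h1 := hY.eqA (v + j • shAB 0 0) k hk
    have h2 := h (j + 1)
    rw [add_one_zsmul, ← add_assoc] at h2
    rw [h j, h2, mul_zero, mul_zero, sub_zero, add_zero, add_right_comm] at h1
    refine (mul_eq_zero.1 h1).resolve_left (sub_ne_zero.2 fun h3 => ?_)
    exact (scaleParam_mem_genericParams hq0 hp (v + j • shAB 0 0)).2.2 0 0 0
      (by rw [zpow_zero, one_mul, h3])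
  · intro h j
    -- With this base point the recurrence starts, through T⁻¹, at the point v + jT to be treated.
    set r := v + (j + 1) • shAB 0 0 with hr
    have hg := scaleParam_mem_genericParams hq0 hp r
    set P := scaleParam q r.1 p with hP
    have hak := hg.1.1 k
    -- The first order recurrence has parameter s = 1/a_k, which is a zero of ∏ (1 - s a_i) over i ≥
    -- 2.
    have hgeo : IsQGeometric q (P.1 0 * (P.1 k)⁻¹) (P.2 0 * (P.1 k)⁻¹)
        fun m => Y (r + ((m : ℤ) - 1) • shAB 0 0) := by
      intro m
      have h1 := hY.eqA (r + ((m : ℤ) - 1) • shAB 0 0) k hk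
      have h2 : Y (r + ((m : ℤ) - 1) • shAB 0 0 + shAA 0 k) = 0 := by
        have := h (j + m)
        rw [← this]
        congr 1
        rw [hr]
        module
      obtain ⟨e1, e2, e3⟩ := scaleParam_add_zsmul hq0 p r ((m : ℤ) - 1)
      rw [h2, e1, e2, (e3 k hk).1, ← hP, add_assoc, ← add_one_zsmul, zpow_sub_one₀ hq0,
        zpow_natCast] at h1
      have e4 : ((m + 1 : ℕ) : ℤ) - 1 = (m : ℤ) - 1 + 1 := by push_cast; ring
      simp only [e4]
      field_simp
      field_simp at h1
      linear_combination -h1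
    have hsum := hgeo.sum_coeff_hatPoly hq0 (hg.1.2.1 0) hg.1.2.2
    have hE := hY.eqE r
    rw [← hP] at hE
    rw [hE, zero_mul, zero_mul, Finset.prod_eq_zero (f := fun i : Fin (M + 2) =>
      1 - (P.1 k)⁻¹ * P.1 i.succ) (Finset.mem_univ (k.pred hk)) (by
        rw [Fin.succ_pred, inv_mul_cancel₀ hak, sub_self]), mul_zero, zero_sub] at hsum
    have hr0 : r + (((0 : ℕ) : ℤ) - 1) • shAB 0 0 = v + j • shAB 0 0 := by
      rw [hr, add_assoc, ← add_smul]; congr 2; push_cast; ring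
    rw [hr0] at hsum
    have n1 : P.2 0 ^ (M + 1) ≠ 0 := pow_ne_zero _ (hg.1.2.1 0)
    have n2 : ∏ i ∈ Finset.range M, (1 - P.1 0 / P.2 0 * q ^ i) ≠ 0 :=
      Finset.prod_ne_zero_iff.2 fun i _ h3 => by
        refine genericParams_ne hq0 hg 0 0 i ?_
        have := hg.1.2.1 0
        field_simp at h3
        rw [zpow_natCast]
        linear_combination -h3
    have n3 : 1 - P.2 0 * (P.1 k)⁻¹ ≠ 0 := fun h3 => by
      refine hg.2.2 k 0 0 ?_
      field_simp at h3
      rw [zpow_zero]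
      linear_combination h3
    have n4 : ∏ i : Fin (M + 2), (1 - q * (P.1 k)⁻¹ * P.2 i.succ) ≠ 0 :=
      Finset.prod_ne_zero_iff.2 fun i _ h3 => by
        refine hg.2.2 k i.succ 1 ?_
        field_simp at h3
        rw [zpow_one]
        linear_combination h3
    by_contra h0
    exact mul_ne_zero (mul_ne_zero (mul_ne_zero n1 n2) h0) (neg_ne_zero.2 (mul_ne_zero n3 n4))
      hsum.symm

/-- The same mechanism with s = 1/(q b_k), which annihilates the other product ∏ (1 - q s b_i) of
the closed form. -/
theorem zero_add_iff_shBB (hY : IsOrbitSolution q p Y) (hq0 : q ≠ 0) (hp : p ∈ genericParams q M)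
    {k : Fin (M + 3)} (hk : k ≠ 0) (v : AdmShift M) :
    (∀ j : ℤ, Y (v + j • shAB 0 0) = 0) ↔ ∀ j : ℤ, Y (v + shBB k 0 + j • shAB 0 0) = 0 := by
  constructor
  · intro h j
    have h1 := hY.eqB (v + j • shAB 0 0) k hk
    have h2 := h (j - 1)
    rw [sub_smul, one_smul, ← add_sub_assoc] at h2
    rw [h j, h2, mul_zero, mul_zero, sub_zero, add_zero, add_right_comm] at h1
    refine (mul_eq_zero.1 h1).resolve_left (sub_ne_zero.2 fun h3 => ?_)
    exact (scaleParam_mem_genericParams hq0 hp (v + j • shAB 0 0)).2.2 0 0 0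
      (by rw [zpow_zero, one_mul, h3])
  · intro h j
    set r := v + (j + 1) • shAB 0 0 with hr
    have hg := scaleParam_mem_genericParams hq0 hp r
    set P := scaleParam q r.1 p with hP
    have hbk := hg.1.2.1 k
    have hgeo : IsQGeometric q (P.1 0 * (q * P.2 k)⁻¹) (P.2 0 * (q * P.2 k)⁻¹)
        fun m => Y (r + ((m : ℤ) - 1) • shAB 0 0) := by
      intro m
      have h1 := hY.eqB (r + (m : ℤ) • shAB 0 0) k hk
      have h2 : Y (r + (m : ℤ) • shAB 0 0 + shBB k 0) = 0 := by
        have := h (j + 1 + m)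
        rw [← this]
        congr 1
        rw [hr]
        module
      obtain ⟨e1, e2, e3⟩ := scaleParam_add_zsmul hq0 p r (m : ℤ)
      rw [h2, e1, e2, (e3 k hk).2, ← hP, add_sub_assoc, zpow_natCast] at h1
      have e4 : ((m + 1 : ℕ) : ℤ) - 1 = m := by push_cast; ring
      have e5 : ((m : ℤ) - 1) • (shAB 0 0 : AdmShift M) = (m : ℤ) • shAB 0 0 - shAB 0 0 := by
        rw [sub_smul, one_smul]
      simp only [e4, e5]
      field_simp
      linear_combination h1
    have hsum := hgeo.sum_coeff_hatPoly hq0 (hg.1.2.1 0) hg.1.2.2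
    have hE := hY.eqE r
    rw [← hP] at hE
    rw [hE, zero_mul, zero_mul, Finset.prod_eq_zero (f := fun i : Fin (M + 2) =>
      1 - q * (q * P.2 k)⁻¹ * P.2 i.succ) (Finset.mem_univ (k.pred hk)) (by
        rw [Fin.succ_pred, mul_inv, mul_inv_cancel_left₀ hq0, inv_mul_cancel₀ hbk, sub_self]),
      mul_zero, sub_zero] at hsum
    have hr0 : r + (((0 : ℕ) : ℤ) - 1) • shAB 0 0 = v + j • shAB 0 0 := by
      rw [hr, add_assoc, ← add_smul]; congr 2; push_cast; ring
    rw [hr0] at hsum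
    have n1 : P.2 0 ^ (M + 1) ≠ 0 := pow_ne_zero _ (hg.1.2.1 0)
    have n2 : ∏ i ∈ Finset.range M, (1 - P.1 0 / P.2 0 * q ^ i) ≠ 0 :=
      Finset.prod_ne_zero_iff.2 fun i _ h3 => by
        refine genericParams_ne hq0 hg 0 0 i ?_
        have := hg.1.2.1 0
        field_simp at h3
        rw [zpow_natCast]
        linear_combination -h3
    have n3 : 1 - P.1 0 * (q * P.2 k)⁻¹ * q ^ M ≠ 0 := fun h3 => by
      refine genericParams_ne hq0 hg 0 k (M - 1) ?_
      rw [zpow_sub_one₀ hq0, zpow_natCast]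
      field_simp at h3 ⊢
      linear_combination -h3
    have n4 : ∏ i : Fin (M + 2), (1 - (q * P.2 k)⁻¹ * P.1 i.succ) ≠ 0 :=
      Finset.prod_ne_zero_iff.2 fun i _ h3 => by
        refine hg.2.2 i.succ k 1 ?_
        field_simp at h3
        rw [zpow_one]
        linear_combination -h3
    by_contra h0
    exact mul_ne_zero (mul_ne_zero (mul_ne_zero n1 n2) h0) (mul_ne_zero n3 n4) hsum.symm

/-- A solution vanishes on the whole orbit as soon as it vanishes at `M + 1` consecutive points. -/
theorem eq_zero (hY : IsOrbitSolution q p Y) (hq0 : q ≠ 0) (hp : p ∈ genericParams q M)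
    (h0 : ∀ j : ℕ, j < M + 1 → Y ((j : ℤ) • shAB 0 0) = 0) (w : AdmShift M) : Y w = 0 := by
  have key : ∀ w v : AdmShift M, (∀ j : ℤ, Y (v + j • shAB 0 0) = 0) ↔
      ∀ j : ℤ, Y (v + w + j • shAB 0 0) = 0 := by
    refine admShift_induction (fun v => by rw [add_zero]) (fun w₁ w₂ h₁ h₂ v => ?_)
      (fun w h v => ?_) (fun v => ?_) (fun k hk => hY.zero_add_iff_shAA hq0 hp hk)
      (fun k hk => hY.zero_add_iff_shBB hq0 hp hk)
    · rw [h₁ v, h₂ (v + w₁), add_assoc v]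
    · rw [h (v + -w), neg_add_cancel_right]
    · constructor
      · intro h j
        have := h (1 + j)
        rwa [add_smul, one_smul, ← add_assoc] at this
      · intro h j
        have := h (j - 1)
        rwa [sub_smul, one_smul, add_assoc, add_sub_cancel] at this
  have h1 := (key w 0).1 (fun j => by rw [zero_add]; exact hY.zero_of_initial hq0 hp h0 j) 0
  rwa [zero_smul, zero_add, add_zero] at h1

end IsOrbitSolution

end Orbit

/-! ## Linear independence of the Jackson integrals on an orbit -/

section Independence

variable {M : ℕ} {q : ℂ}

/-- The functional `G ↦ ∑_i d_i ∑_{t ∈ q^ℤ / a_i} t G(t) f(t)`, where `f` is the integrand for the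
parameters scaled by `w`. -/
def latticeFunctional (q : ℂ) (p : Param M) (d : Fin (M + 3) → ℂ)
    (w : (Fin (M + 3) → ℤ) × (Fin (M + 3) → ℤ)) (G : ℂ → ℂ) : ℂ :=
  ∑ i, d i * ∑' n : ℤ, (p.1 i)⁻¹ * q ^ n *
    (G ((p.1 i)⁻¹ * q ^ n) * rpTerm q (scaleParam q w p) ((p.1 i)⁻¹ * q ^ n))

/-- A linear relation between integrands yields one between the functionals. -/
theorem latticeFunctional_eq_add (hq : ‖q‖ < 1) (hq0 : q ≠ 0) {p : Param M}
    (hp : p ∈ genericParams q M) (d : Fin (M + 3) → ℂ)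
    {w w₁ w₂ : (Fin (M + 3) → ℤ) × (Fin (M + 3) → ℤ)} {G G₁ G₂ : ℂ → ℂ} (c₁ c₂ : ℂ)
    (h₁ : ContinuousAt G₁ 0) (h₂ : ContinuousAt G₂ 0)
    (h : ∀ t, IsRegularAt q p t → G t * rpTerm q (scaleParam q w p) t =
      c₁ * (G₁ t * rpTerm q (scaleParam q w₁ p) t) + c₂ * (G₂ t * rpTerm q (scaleParam q w₂ p) t)) :
    latticeFunctional q p d w G =
      c₁ * latticeFunctional q p d w₁ G₁ + c₂ * latticeFunctional q p d w₂ G₂ := by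
  unfold latticeFunctional
  rw [Finset.mul_sum, Finset.mul_sum, ← Finset.sum_add_distrib]
  refine Finset.sum_congr rfl fun i _ => ?_
  have s₁ := (summable_rpTerm_mul hq hq0 (hp.1.1 i) w₁ h₁).mul_left c₁
  have s₂ := (summable_rpTerm_mul hq hq0 (hp.1.1 i) w₂ h₂).mul_left c₂
  have e := s₁.tsum_add s₂
  rw [tsum_mul_left, tsum_mul_left] at e
  rw [mul_left_comm, mul_left_comm c₂, ← mul_add, ← e]
  congr 2
  funext n
  rw [h _ (isRegularAt_lattice hq0 hp i n)]
  ring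

theorem exists_eq_eval_add_mul {α : ℂ} (hα : α ≠ 0) {D : ℕ} {P : ℂ[X]} (hP : P.natDegree ≤ D + 1) :
    ∃ (r : ℂ) (Q : ℂ[X]), Q.natDegree ≤ D ∧ ∀ t, P.eval t = r + (1 - α * t) * Q.eval t := by
  -- Division with remainder by t - 1/α, normalised through 1 - αt = -α(t - 1/α).
  refine ⟨P.eval α⁻¹, C (-α⁻¹) * (P /ₘ (X - C α⁻¹)), ?_, fun t => ?_⟩
  · refine (natDegree_C_mul_le _ _).trans ?_
    rw [natDegree_divByMonic _ (monic_X_sub_C _), natDegree_X_sub_C]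
    omega
  · have h := congrArg (Polynomial.eval t) (modByMonic_add_div P (X - C α⁻¹))
    rw [modByMonic_X_sub_C_eq_C_eval] at h
    simp only [eval_add, eval_C, eval_mul, eval_sub, eval_X] at h ⊢
    rw [← h]
    field_simp
    ring

/-- Undoing a shift of a_1, or adding one of b_1, multiplies the integrand by a linear factor and
lowers the excess D of a-shifts over b-shifts by one. An excess of D thus leaves room for every
polynomial of degree at most D, by induction from the admissible case D = 0. -/
theorem latticeFunctional_eval_eq_zero (hq : ‖q‖ < 1) (hq0 : q ≠ 0) {p : Param M}
    (hp : p ∈ genericParams q M) {d : Fin (M + 3) → ℂ}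
    (hd : ∀ v : AdmShift M, ∑ i, d i * latticeSum q p i v.1 = 0) (D : ℕ)
    (w : (Fin (M + 3) → ℤ) × (Fin (M + 3) → ℤ)) (hw : ∑ i, w.1 i = ∑ i, w.2 i + D) (P : ℂ[X])
    (hP : P.natDegree ≤ D) : latticeFunctional q p d w (fun t => P.eval t) = 0 := by
  have hcP : ∀ P : ℂ[X], ContinuousAt (fun t => P.eval t) 0 := fun P =>
    P.continuous.continuousAt
  induction D generalizing w P with
  | zero =>
    rw [Nat.cast_zero, add_zero] at hw
    obtain ⟨r, rfl⟩ := natDegree_eq_zero.1 (Nat.le_zero.1 hP)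
    have h1 := latticeFunctional_eq_add hq hq0 hp d (w := w) (w₁ := w) (w₂ := w)
      (G := fun t => (C r : ℂ[X]).eval t) (G₁ := fun _ => 1) (G₂ := fun _ => 1) r 0
      continuousAt_const continuousAt_const fun t _ => by simp
    rw [h1, zero_mul, add_zero]
    have h2 := hd ⟨w, hw⟩
    simp only [latticeSum] at h2
    simp only [latticeFunctional, one_mul]
    rw [h2, mul_zero]
  | succ D ih =>
    set α := q ^ (w.1 0 - 1) * p.1 0 with hα
    set β := q ^ w.2 0 * p.2 0 with hβ
    have hα0 : α ≠ 0 := mul_ne_zero (zpow_ne_zero _ hq0) (hp.1.1 0)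
    have hαβ : β - α ≠ 0 := sub_ne_zero.2 fun h => by
      refine hp.2.2 0 0 (w.2 0 - (w.1 0 - 1)) ?_
      rw [zpow_sub₀ hq0]
      have := zpow_ne_zero (w.1 0 - 1) hq0
      field_simp
      linear_combination -h
    have wA : ∑ i, (w - expA 0).1 i = ∑ i, (w - expA 0).2 i + (D : ℤ) := by
      simp only [Prod.fst_sub, Prod.snd_sub, Pi.sub_apply, Finset.sum_sub_distrib, hw, expA_fst,
        expA_snd, Finset.sum_ite_eq', Finset.mem_univ, if_true, Finset.sum_const_zero]
      push_cast
      ring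
    have wB : ∑ i, (w + expB 0).1 i = ∑ i, (w + expB 0).2 i + (D : ℤ) := by
      simp only [Prod.fst_add, Prod.snd_add, Pi.add_apply, Finset.sum_add_distrib, hw, expB_fst,
        expB_snd, Finset.sum_ite_eq', Finset.mem_univ, if_true, Finset.sum_const_zero]
      push_cast
      ring
    -- The constant 1 is a combination of 1 - αt and 1 - βt, since α ≠ β at generic parameters; each
    -- of the two factors reduces the excess to D.
    have h1 : latticeFunctional q p d w (fun t => (1 : ℂ[X]).eval t) = 0 := by
      rw [latticeFunctional_eq_add hq hq0 hp d (w₁ := w - expA 0) (w₂ := w + expB 0)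
        (β / (β - α)) (-α / (β - α)) (hcP 1) (hcP 1) fun t ht => ?_,
        ih _ wA 1 (by simp), ih _ wB 1 (by simp), mul_zero, mul_zero, add_zero]
      rw [rpTerm_sub_expA hq hq0, rpTerm_add_expB hq hq0 _ _ ht, ← hα, ← hβ]
      simp only [eval_one]
      field_simp
      ring
    obtain ⟨r, Q, hQ, hPQ⟩ := exists_eq_eval_add_mul hα0 hP
    rw [latticeFunctional_eq_add hq hq0 hp d (w₁ := w) (w₂ := w - expA 0) r 1 (hcP 1) (hcP Q)
      fun t ht => ?_, h1, ih _ wA Q hQ, mul_zero, mul_zero, add_zero]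
    rw [rpTerm_sub_expA hq hq0, ← hα, hPQ]
    simp only [eval_one]
    ring

/-- The polynomial `∏_{i<n} (1 - α q^i X)`. -/
def qPoly (q α : ℂ) (n : ℕ) : ℂ[X] := ∏ i ∈ Finset.range n, (1 - C (α * q ^ i) * X)

theorem natDegree_qPoly_le (q α : ℂ) (n : ℕ) : (qPoly q α n).natDegree ≤ n := by
  refine (natDegree_prod_le _ _).trans ((Finset.sum_le_card_nsmul _ _ 1 fun i _ => ?_).trans ?_)
  · refine (natDegree_sub_le _ _).trans ?_
    simp only [natDegree_one, zero_le, max_eq_right]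
    exact (natDegree_C_mul_le _ _).trans natDegree_X_le
  · simp

theorem eval_qPoly (q α : ℂ) (n : ℕ) (t : ℂ) :
    (qPoly q α n).eval t = ∏ i ∈ Finset.range n, (1 - α * q ^ i * t) := by
  simp [qPoly, eval_prod]

theorem rpTerm_eq_eval_qPoly_mul (hq : ‖q‖ < 1) (hq0 : q ≠ 0) (p : Param M) (k : Fin (M + 3))
    (n : ℕ) (t : ℂ) : rpTerm q p t = (qPoly q (p.1 k) n).eval t *
      rpTerm q (scaleParam q ((n : ℤ) • expA k) p) t := by
  induction n with
  | zero => simp [eval_qPoly, scaleParam_zero]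
  | succ n ih =>
    have e : ((n + 1 : ℕ) : ℤ) • expA k - expA k = (n : ℤ) • expA k := by
      push_cast; module
    have h := rpTerm_sub_expA hq hq0 p (((n + 1 : ℕ) : ℤ) • expA k) k t
    rw [e] at h
    rw [ih, h, eval_qPoly, eval_qPoly, Finset.prod_range_succ, ← mul_assoc]
    simp [mul_comm (p.1 k)]

/-- The `n`-th term of the expansion of `f(t) / (1 - a_k q^j t)`, extended through the zeros of
`1 - a_k q^j t`. -/
def quotTerm (q : ℂ) (p : Param M) (k : Fin (M + 3)) (j : ℕ) (t : ℂ) : ℂ :=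
  (qPoly q (p.1 k) j).eval t * rpTerm q (scaleParam q (((j + 1 : ℕ) : ℤ) • expA k) p) t

theorem mul_quotTerm (hq : ‖q‖ < 1) (hq0 : q ≠ 0) (p : Param M) (k : Fin (M + 3)) (j : ℕ) (t : ℂ) :
    (1 - p.1 k * q ^ j * t) * quotTerm q p k j t = rpTerm q p t := by
  rw [rpTerm_eq_eval_qPoly_mul hq hq0 p k (j + 1), quotTerm, eval_qPoly, eval_qPoly,
    Finset.prod_range_succ]
  ring

/-- f(t)/(1 - a_k q^j t) is a polynomial of degree at most j times an integrand of excess j + 1, so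
the functional kills it. The extra factor t comes from t/(1 - γt) = γ⁻¹ (1/(1 - γt) - 1) with γ =
a_k q^j, as f itself is killed too. -/
theorem sum_tsum_quotTerm (hq : ‖q‖ < 1) (hq0 : q ≠ 0) {p : Param M}
    (hp : p ∈ genericParams q M) {d : Fin (M + 3) → ℂ}
    (hd : ∀ v : AdmShift M, ∑ i, d i * latticeSum q p i v.1 = 0) (k : Fin (M + 3)) (j : ℕ) :
    ∑ i, d i * ∑' n : ℤ, ((p.1 i)⁻¹ * q ^ n) ^ 2 * quotTerm q p k j ((p.1 i)⁻¹ * q ^ n) = 0 := by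
  set w := ((j + 1 : ℕ) : ℤ) • expA k with hw
  have hcP : ∀ P : ℂ[X], ContinuousAt (fun t => P.eval t) 0 := fun P =>
    P.continuous.continuousAt
  have hws : ∑ i, w.1 i = ∑ i, w.2 i + ((j + 1 : ℕ) : ℤ) := by
    simp [hw]
  have h1 := latticeFunctional_eval_eq_zero hq hq0 hp hd (j + 1) w hws (qPoly q (p.1 k) j)
    ((natDegree_qPoly_le _ _ _).trans (Nat.le_succ j))
  have h2 := latticeFunctional_eval_eq_zero hq hq0 hp hd 0 0 (by simp) 1 (by simp)
  have h3 : latticeFunctional q p d w (fun t => (X * qPoly q (p.1 k) j).eval t) = 0 := by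
    have hne : p.1 k * q ^ j ≠ 0 := mul_ne_zero (hp.1.1 k) (pow_ne_zero _ hq0)
    rw [latticeFunctional_eq_add hq hq0 hp d (w₁ := w) (w₂ := 0) (p.1 k * q ^ j)⁻¹
      (-(p.1 k * q ^ j)⁻¹) (hcP (qPoly q (p.1 k) j)) (hcP 1) fun t ht => ?_, h1, h2, mul_zero,
      mul_zero, add_zero]
    have hpk := hp.1.1 k
    have hqj := pow_ne_zero j hq0
    have h4 := mul_quotTerm hq hq0 p k j t
    rw [quotTerm, ← hw] at h4
    rw [scaleParam_zero, ← h4, eval_one, eval_mul, eval_X]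
    field_simp
    ring
  rw [← h3, latticeFunctional]
  refine Finset.sum_congr rfl fun i _ => ?_
  congr 2
  funext n
  rw [quotTerm, eval_mul, eval_X]
  ring

/-- The value of `t ^ 2 f(t) / (1 - a_k q^j t)` at `t = q^{-j} / a_k`. -/
def poleTerm (q : ℂ) (p : Param M) (k : Fin (M + 3)) (j : ℕ) : ℂ :=
  ((p.1 k)⁻¹ * q ^ (-(j : ℤ))) ^ 2 * quotTerm q p k j ((p.1 k)⁻¹ * q ^ (-(j : ℤ)))

/-- On the half-lattice t = q^{1+n}/a_i, n ≥ 0, the denominator is nonzero: for i = k because |q| <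
1, otherwise by genericity. -/
theorem quotTerm_eq_div (hq : ‖q‖ < 1) (hq0 : q ≠ 0) {p : Param M} (hp : p ∈ genericParams q M)
    (i k : Fin (M + 3)) (j n : ℕ) : quotTerm q p k j ((p.1 i)⁻¹ * q ^ (1 + n : ℤ)) =
      rpTerm q p ((p.1 i)⁻¹ * q ^ (1 + n : ℤ)) * (1 - p.1 k / p.1 i * q ^ (j + 1 + n))⁻¹ := by
  have hai := hp.1.1 i
  have e : p.1 k * q ^ j * ((p.1 i)⁻¹ * q ^ (1 + n : ℤ)) = p.1 k / p.1 i * q ^ (j + 1 + n) := by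
    rw [zpow_add₀ hq0, zpow_one, zpow_natCast, pow_add, pow_add]
    field_simp
  have hne : 1 - p.1 k / p.1 i * q ^ (j + 1 + n) ≠ 0 := by
    refine sub_ne_zero.2 fun h => ?_
    by_cases hik : i = k
    · subst hik
      rw [div_self hai, one_mul] at h
      have h1 : ‖q ^ (j + 1 + n)‖ < 1 := by
        rw [norm_pow]
        exact pow_lt_one₀ (norm_nonneg _) hq (by omega)
      rw [← h, norm_one] at h1
      exact lt_irrefl _ h1
    · refine hp.2.1 i k hik (j + 1 + n : ℕ) ?_
      rw [zpow_natCast]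
      field_simp at h
      linear_combination h
  have := mul_quotTerm hq hq0 p k j ((p.1 i)⁻¹ * q ^ (1 + n : ℤ))
  rw [e] at this
  rw [← this, mul_comm (1 - _) _, mul_assoc, mul_inv_cancel₀ hne, mul_one]

/-- Outside the half-lattice f vanishes, and so does the quotient except at the single point t =
q^{-j}/a_k, where the zero of f is cancelled by the denominator. -/
theorem tsum_quotTerm (hq : ‖q‖ < 1) (hq0 : q ≠ 0) {p : Param M} (hp : p ∈ genericParams q M)
    (i k : Fin (M + 3)) (j : ℕ) :
    ∑' n : ℤ, ((p.1 i)⁻¹ * q ^ n) ^ 2 * quotTerm q p k j ((p.1 i)⁻¹ * q ^ n) =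
      (if i = k then poleTerm q p k j else 0) +
      ∑' n : ℕ, ((p.1 i)⁻¹ * q ^ (1 + n : ℤ)) ^ 2 * (rpTerm q p ((p.1 i)⁻¹ * q ^ (1 + n : ℤ)) *
        (1 - p.1 k / p.1 i * q ^ (j + 1 + n))⁻¹) := by
  have hai := hp.1.1 i
  simp only [← quotTerm_eq_div hq hq0 hp]
  by_cases hik : i = k
  · subst hik
    rw [if_pos rfl]
    have hs : Summable fun n : ℤ =>
        ((p.1 i)⁻¹ * q ^ n) ^ 2 * quotTerm q p i j ((p.1 i)⁻¹ * q ^ n) := by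
      have := summable_rpTerm_mul hq hq0 hai (((j + 1 : ℕ) : ℤ) • expA i)
        (G := fun t => (X * qPoly q (p.1 i) j).eval t) (Polynomial.continuous _).continuousAt
      refine this.congr fun n => ?_
      rw [quotTerm, eval_mul, eval_X]
      ring
    rw [hs.tsum_eq_add_tsum_ite (-(j : ℤ)), tsum_int_eq_tsum_nat (N := 1)]
    · congr 2
      funext n
      rw [if_neg (by omega)]
    · intro n hn
      split_ifs with hnj
      · rfl
      -- For n < -j the shifted integrand vanishes; for -j < n ≤ 0 the polynomial factor does.
      have : quotTerm q p i j ((p.1 i)⁻¹ * q ^ n) = 0 := by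
        rw [quotTerm]
        rcases lt_or_gt_of_ne hnj with h | h
        · rw [rpTerm_lattice_eq_zero hq hq0 hai _ (by simp; omega), mul_zero]
        · rw [eval_qPoly, Finset.prod_eq_zero (i := (-n).toNat) (by simp; omega), zero_mul]
          have h1 : q ^ (-n).toNat = q ^ (-n) := by
            rw [← zpow_natCast]; congr 1; omega
          rw [h1, zpow_neg]
          have := zpow_ne_zero n hq0
          field_simp
          ring
      rw [this, mul_zero]
  · rw [if_neg hik, zero_add, tsum_int_eq_tsum_nat (N := 1)]
    intro n hn
    rw [quotTerm, rpTerm_lattice_eq_zero hq hq0 hai _ (by simp [hik]; omega), mul_zero, mul_zero]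

/-- Dominated convergence: the numbers (1 - x q^m)⁻¹ tend to 1 as m → ∞, hence are bounded uniformly
in m. The limit no longer depends on k. -/
theorem tendsto_tsum_quotTerm (hq : ‖q‖ < 1) (hq0 : q ≠ 0) {p : Param M}
    (hp : p ∈ genericParams q M) (i k : Fin (M + 3)) :
    Filter.Tendsto (fun j : ℕ => ∑' n : ℕ, ((p.1 i)⁻¹ * q ^ (1 + n : ℤ)) ^ 2 *
      (rpTerm q p ((p.1 i)⁻¹ * q ^ (1 + n : ℤ)) * (1 - p.1 k / p.1 i * q ^ (j + 1 + n))⁻¹))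
      Filter.atTop (𝓝 (∑' n : ℕ, ((p.1 i)⁻¹ * q ^ (1 + n : ℤ)) ^ 2 *
        rpTerm q p ((p.1 i)⁻¹ * q ^ (1 + n : ℤ)))) := by
  set x := p.1 k / p.1 i
  have hlim : Filter.Tendsto (fun m : ℕ => (1 - x * q ^ m)⁻¹) Filter.atTop (𝓝 1) := by
    have h1 : Filter.Tendsto (fun m : ℕ => 1 - x * q ^ m) Filter.atTop (𝓝 (1 - x * 0)) :=
      ((tendsto_pow_atTop_nhds_zero_of_norm_lt_one hq).const_mul x).const_sub 1
    rw [mul_zero, sub_zero] at h1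
    simpa using h1.inv₀ one_ne_zero
  obtain ⟨B, hB⟩ : ∃ B, ∀ m : ℕ, ‖(1 - x * q ^ m)⁻¹‖ ≤ B := by
    obtain ⟨B, hB⟩ := (Metric.isBounded_range_of_tendsto _ hlim).exists_norm_le
    exact ⟨B, fun m => hB _ ⟨m, rfl⟩⟩
  have hs : Summable fun n : ℕ => ((p.1 i)⁻¹ * q ^ (1 + n : ℤ)) ^ 2 *
      rpTerm q p ((p.1 i)⁻¹ * q ^ (1 + n : ℤ)) := by
    have h1 := summable_rpTerm_mul hq hq0 (hp.1.1 i) 0 (G := fun t => t) continuousAt_id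
    have h2 := h1.comp_injective (i := fun n : ℕ => 1 + (n : ℤ)) fun m n h => by simpa using h
    refine h2.congr fun n => ?_
    simp only [Function.comp_apply, scaleParam_zero]
    ring
  refine tendsto_tsum_of_dominated_convergence (hs.norm.mul_right B) (fun n => ?_)
    (Filter.Eventually.of_forall fun j n => ?_)
  · have h1 : Filter.Tendsto (fun j : ℕ => (1 - x * q ^ (j + 1 + n))⁻¹) Filter.atTop (𝓝 1) := by
      refine (hlim.comp (Filter.tendsto_add_atTop_nat (1 + n))).congr fun j => ?_
      simp only [Function.comp_apply, add_assoc]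
    have h2 := (h1.const_mul (rpTerm q p ((p.1 i)⁻¹ * q ^ (1 + n : ℤ)))).const_mul
      (((p.1 i)⁻¹ * q ^ (1 + n : ℤ)) ^ 2)
    rwa [mul_one] at h2
  · rw [← mul_assoc, norm_mul]
    exact mul_le_mul_of_nonneg_left (hB _) (norm_nonneg _)

theorem prod_one_sub_mul_zpow (hq0 : q ≠ 0) {x : ℂ} (hx : x ≠ 0) (j : ℕ) :
    ∏ i ∈ Finset.range j, (1 - x * q ^ ((i : ℤ) - j)) =
      (-x) ^ j * (∏ i ∈ Finset.range j, q ^ (-((i : ℤ) + 1))) *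
        ∏ i ∈ Finset.range j, (1 - q / x * q ^ i) := by
  rw [← Finset.prod_range_reflect]
  have h1 : ((-x) ^ j : ℂ) = ∏ _i ∈ Finset.range j, (-x) := by simp
  rw [h1, ← Finset.prod_mul_distrib, ← Finset.prod_mul_distrib]
  refine Finset.prod_congr rfl fun i hi => ?_
  rw [Finset.mem_range] at hi
  have h2 : (((j - 1 - i : ℕ) : ℤ) - j) = -((i : ℤ) + 1) := by omega
  rw [h2, zpow_neg, zpow_add_one₀ hq0, zpow_natCast]
  field_simp
  ring

theorem qPoch_mul_zpow_neg (hq : ‖q‖ < 1) (hq0 : q ≠ 0) (x : ℂ) (j : ℕ) :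
    qPoch q (x * q ^ (-(j : ℤ))) =
      (∏ i ∈ Finset.range j, (1 - x * q ^ ((i : ℤ) - j))) * qPoch q x := by
  rw [qPoch_eq_prod_mul hq _ j]
  congr 1
  · refine Finset.prod_congr rfl fun i _ => ?_
    rw [zpow_sub₀ hq0, zpow_neg, zpow_natCast, zpow_natCast]
    ring
  · rw [zpow_neg, zpow_natCast, mul_assoc, inv_mul_cancel₀ (pow_ne_zero _ hq0), mul_one]

/-- Inverting the first j factors of each (x q^{-j})_∞ produces the growth (∏ a_l/b_l)^j = q^{2j},
which exactly cancels the q^{-2j} of t². This is why the weight is t² and where the defining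
relation of the variety enters. -/
theorem poleTerm_eq (hq : ‖q‖ < 1) (hq0 : q ≠ 0) {p : Param M} (hp : p ∈ genericParams q M)
    (k : Fin (M + 3)) (j : ℕ) : poleTerm q p k j = ((p.1 k)⁻¹) ^ 2 *
      (∏ l, (if l = k then qPoch q q else qPoch q (p.1 l / p.1 k)) / qPoch q (p.2 l / p.1 k)) *
      ∏ l, (∏ i ∈ Finset.range j, (1 - q / (p.1 l / p.1 k) * q ^ i)) /
        ∏ i ∈ Finset.range j, (1 - q / (p.2 l / p.1 k) * q ^ i) := by
  classical
  have hak := hp.1.1 k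
  set t := (p.1 k)⁻¹ * q ^ (-(j : ℤ)) with ht
  set θ : ℂ → ℂ := fun x => ∏ i ∈ Finset.range j, (1 - x * q ^ ((i : ℤ) - j)) with hθ
  set Qj := ∏ i ∈ Finset.range j, q ^ (-((i : ℤ) + 1)) with hQj
  set e : ℂ → ℂ := fun x => ∏ i ∈ Finset.range j, (1 - q / x * q ^ i) with he
  have hQ0 : Qj ≠ 0 := Finset.prod_ne_zero_iff.2 fun i _ => zpow_ne_zero _ hq0
  have hθe : ∀ {x}, x ≠ 0 → θ x = (-x) ^ j * Qj * e x := fun hx => prod_one_sub_mul_zpow hq0 hx j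
  have hP : (qPoly q (p.1 k) j).eval t = θ (p.1 k / p.1 k) := by
    rw [eval_qPoly]
    refine Finset.prod_congr rfl fun i _ => ?_
    rw [ht, div_self hak, zpow_sub₀ hq0, zpow_neg, zpow_natCast, zpow_natCast]
    field_simp
  have hfac : quotTerm q p k j t = ∏ l, (θ (p.1 l / p.1 k) *
      (if l = k then qPoch q q else qPoch q (p.1 l / p.1 k))) /
        (θ (p.2 l / p.1 k) * qPoch q (p.2 l / p.1 k)) := by
    rw [quotTerm, hP, rpTerm, ← Finset.mul_prod_erase _ _ (Finset.mem_univ k),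
      ← Finset.mul_prod_erase _ _ (Finset.mem_univ k), ← mul_assoc]
    have hb : ∀ l, qPoch q ((scaleParam q (((j + 1 : ℕ) : ℤ) • expA k) p).2 l * t) =
        θ (p.2 l / p.1 k) * qPoch q (p.2 l / p.1 k) := fun l => by
      rw [← qPoch_mul_zpow_neg hq hq0]
      congr 1
      simp [scaleParam, ht]
      ring
    congr 1
    · rw [hb, if_pos rfl, mul_div_assoc]
      congr 3
      have h1 : ((((j + 1 : ℕ) : ℤ) • expA k).1 k) = j + 1 := by simp
      simp only [scaleParam, h1]
      rw [ht, zpow_neg, zpow_add_one₀ hq0, zpow_natCast]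
      field_simp
    · refine Finset.prod_congr rfl fun l hl => ?_
      have hlk : l ≠ k := Finset.ne_of_mem_erase hl
      rw [hb, if_neg hlk]
      congr 1
      rw [← qPoch_mul_zpow_neg hq hq0]
      congr 1
      simp [scaleParam, ht, hlk]
      ring
  have hprod : (∏ l, p.1 l / p.2 l) = q ^ 2 := by
    rw [Finset.prod_div_distrib, hp.1.2.2]
    have : ∏ i, p.2 i ≠ 0 := Finset.prod_ne_zero_iff.2 fun i _ => hp.1.2.1 i
    field_simp
  have hfac2 : quotTerm q p k j t = (∏ l, p.1 l / p.2 l) ^ j * (∏ l,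
      (if l = k then qPoch q q else qPoch q (p.1 l / p.1 k)) / qPoch q (p.2 l / p.1 k)) *
      ∏ l, e (p.1 l / p.1 k) / e (p.2 l / p.1 k) := by
    rw [hfac, ← Finset.prod_pow, ← Finset.prod_mul_distrib, ← Finset.prod_mul_distrib]
    refine Finset.prod_congr rfl fun l _ => ?_
    have h1 := hp.1.1 l
    have h2 := hp.1.2.1 l
    rw [hθe (div_ne_zero h1 hak), hθe (div_ne_zero h2 hak)]
    have h3 : (-(p.1 l / p.1 k)) ^ j = (p.1 l / p.2 l) ^ j * (-(p.2 l / p.1 k)) ^ j := by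
      rw [← mul_pow]; congr 1; field_simp
    have h4 : (-(p.2 l / p.1 k)) ^ j ≠ 0 := pow_ne_zero _ (neg_ne_zero.2 (div_ne_zero h2 hak))
    rw [h3, mul_assoc, mul_assoc, mul_assoc, mul_assoc, mul_assoc, mul_div_assoc,
      mul_div_mul_left _ _ h4, mul_div_mul_left _ _ hQ0, mul_div_mul_comm]
    ring
  rw [poleTerm, ← ht, hfac2, hprod, ht, mul_pow, zpow_neg, zpow_natCast, ← pow_mul]
  have h6 : ((q ^ j)⁻¹) ^ 2 * q ^ (2 * j) = 1 := by
    rw [inv_pow, ← pow_mul, mul_comm 2 j, inv_mul_cancel₀ (pow_ne_zero _ hq0)]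
  linear_combination (((p.1 k)⁻¹) ^ 2 * (∏ l, (if l = k then qPoch q q else
    qPoch q (p.1 l / p.1 k)) / qPoch q (p.2 l / p.1 k)) *
      ∏ l, e (p.1 l / p.1 k) / e (p.2 l / p.1 k)) * h6

/-- The finite products in `poleTerm_eq` converge to q-shifted factorials; genericity keeps all of
them, and the constant prefactor, nonzero. -/
theorem tendsto_poleTerm (hq : ‖q‖ < 1) (hq0 : q ≠ 0) {p : Param M} (hp : p ∈ genericParams q M)
    (k : Fin (M + 3)) : ∃ E : ℂ, E ≠ 0 ∧ Filter.Tendsto (poleTerm q p k) Filter.atTop (𝓝 E) := by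
  have hak := hp.1.1 k
  have hA : ∀ l, qPoch q (q / (p.1 l / p.1 k)) ≠ 0 := fun l => by
    have hal := hp.1.1 l
    refine qPoch_ne_zero hq fun n h => ?_
    by_cases hlk : l = k
    · subst hlk
      rw [div_self hak, div_one, ← pow_succ'] at h
      have h1 : ‖q ^ (n + 1)‖ < 1 := by
        rw [norm_pow]
        exact pow_lt_one₀ (norm_nonneg _) hq (by omega)
      rw [h, norm_one] at h1
      exact lt_irrefl _ h1
    · refine hp.2.1 l k hlk (n + 1 : ℕ) ?_
      rw [zpow_natCast, pow_succ]
      field_simp at h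
      linear_combination -h
  have hB : ∀ l, qPoch q (q / (p.2 l / p.1 k)) ≠ 0 := fun l => by
    have hbl := hp.1.2.1 l
    refine qPoch_ne_zero hq fun n h => ?_
    refine genericParams_ne hq0 hp k l (n + 1 : ℕ) ?_
    rw [zpow_natCast, pow_succ]
    field_simp at h
    linear_combination h
  have hA' : ∀ l, (if l = k then qPoch q q else qPoch q (p.1 l / p.1 k)) ≠ 0 := fun l => by
    split_ifs with hlk
    · have := hA k
      rwa [div_self hak, div_one] at this
    · refine qPoch_ne_zero hq fun n h => ?_
      refine hp.2.1 k l (Ne.symm hlk) n ?_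
      rw [zpow_natCast]
      field_simp at h
      linear_combination -h
  have hB' : ∀ l, qPoch q (p.2 l / p.1 k) ≠ 0 := fun l => by
    refine qPoch_ne_zero hq fun n h => ?_
    refine hp.2.2 k l n ?_
    rw [zpow_natCast]
    field_simp at h
    linear_combination -h
  refine ⟨((p.1 k)⁻¹) ^ 2 * (∏ l, (if l = k then qPoch q q else qPoch q (p.1 l / p.1 k)) /
    qPoch q (p.2 l / p.1 k)) *
      ∏ l, qPoch q (q / (p.1 l / p.1 k)) / qPoch q (q / (p.2 l / p.1 k)), ?_, ?_⟩
  rotate_left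
  · rw [funext (poleTerm_eq hq hq0 hp k)]
    refine Filter.Tendsto.const_mul _ (tendsto_finsetProd _ fun l _ => ?_)
    exact (tendsto_prod_qPoch hq _).div (tendsto_prod_qPoch hq _) (hB l)
  · refine mul_ne_zero (mul_ne_zero (pow_ne_zero _ (inv_ne_zero hak)) ?_) ?_
    · exact Finset.prod_ne_zero_iff.2 fun l _ => div_ne_zero (hA' l) (hB' l)
    · exact Finset.prod_ne_zero_iff.2 fun l _ => div_ne_zero (hA l) (hB l)

/-- The sums over the lattices `q^ℤ / a_i`, `i ≠ 1`, are linearly independent on an orbit. -/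
theorem eq_zero_of_sum_latticeSum (hq : ‖q‖ < 1) (hq0 : q ≠ 0) {p : Param M}
    (hp : p ∈ genericParams q M) {d : Fin (M + 3) → ℂ} (hd0 : d 0 = 0)
    (hd : ∀ v : AdmShift M, ∑ i, d i * latticeSum q p i v.1 = 0) (k : Fin (M + 3)) : d k = 0 := by
  set S : Fin (M + 3) → ℂ := fun i => ∑' n : ℕ, ((p.1 i)⁻¹ * q ^ (1 + n : ℤ)) ^ 2 *
    rpTerm q p ((p.1 i)⁻¹ * q ^ (1 + n : ℤ)) with hS
  have key : ∀ k, ∀ E, Filter.Tendsto (poleTerm q p k) Filter.atTop (𝓝 E) →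
      d k * E + ∑ i, d i * S i = 0 := fun k E hE => by
    have h1 := (hE.const_mul (d k)).add (tendsto_finsetSum Finset.univ fun i _ =>
      (tendsto_tsum_quotTerm hq hq0 hp i k).const_mul (d i))
    refine tendsto_nhds_unique h1 ?_
    refine tendsto_const_nhds.congr fun j => ?_
    rw [← sum_tsum_quotTerm hq hq0 hp hd k j]
    simp only [tsum_quotTerm hq hq0 hp, mul_add, Finset.sum_add_distrib,
      mul_ite, mul_zero, Finset.sum_ite_eq', Finset.mem_univ, if_true]
  obtain ⟨E, hE, hlim⟩ := tendsto_poleTerm hq hq0 hp k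
  -- The lattice with coefficient d 0 = 0 serves as a probe: its pole term drops out and shows that
  -- the common sum ∑ d_i S_i is zero.
  obtain ⟨E₀, -, hlim₀⟩ := tendsto_poleTerm hq hq0 hp 0
  have h0 := key 0 E₀ hlim₀
  rw [hd0, zero_mul, zero_add] at h0
  have h1 := key k E hlim
  rw [h0, add_zero] at h1
  exact (mul_eq_zero.1 h1).resolve_right hE

theorem castSucc_succ_ne (i : Fin (M + 1)) :
    (i.succ.castSucc : Fin (M + 3)) ≠ 0 ∧ (i.succ.castSucc : Fin (M + 3)) ≠ Fin.last (M + 2) :=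
  ⟨fun h => absurd (congrArg Fin.val h) (Nat.succ_ne_zero _), (Fin.castSucc_lt_last _).ne⟩

/-- A kernel vector of the matrix at p gives a complex combination of the integrals that vanishes at
M + 1 consecutive points of the orbit of p, hence on the orbit, contradicting independence of the
lattice sums. -/
theorem det_casorati_rpIntegral_ne_zero (hq : ‖q‖ < 1) (hq0 : q ≠ 0) {U : Set (Param M)}
    (hUg : U ⊆ genericParams q M) (hU : ShiftStable q U) (p : U) :
    (casorati (shiftFun hU) fun (i : Fin (M + 1)) (p : U) =>
      rpIntegral q i.succ.castSucc (Fin.last (M + 2)) p.1).det p ≠ 0 := by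
  have hp := hUg p.2
  set φ : Fin (M + 1) → U → ℂ := fun i p => rpIntegral q i.succ.castSucc (Fin.last (M + 2)) p.1
  have h1 : (casorati (shiftFun hU) φ).det p =
      ((casorati (shiftFun hU) φ).map (Pi.evalRingHom (fun _ : U => ℂ) p)).det :=
    RingHom.map_det (Pi.evalRingHom (fun _ : U => ℂ) p) _
  rw [h1]
  intro hdet
  obtain ⟨c, hc, hc0⟩ := Matrix.exists_mulVec_eq_zero_iff.2 hdet
  have hφ : ∀ i, IsSolutionRP q (shiftFun hU) (coordA U) (coordB U) (φ i) := fun i =>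
    isSolutionRP_rpIntegral hq hq0 hUg hU (castSucc_succ_ne i).1
      (Fin.last_pos.ne')
  have hact := isShiftAction_shiftFun hq0 hU
  have hy : IsSolutionRP q (shiftFun hU) (coordA U) (coordB U)
      (∑ i, algebraMap ℂ (U → ℂ) (c i) * φ i) := by
    refine Finset.sum_induction _ _ (fun _ _ => IsSolutionRP.add) IsSolutionRP.zero fun i _ => ?_
    exact (hφ i).mul hact (shiftFun_coord_div hq0 hU)
      fun k l => ⟨AlgHom.commutes _ _, AlgHom.commutes _ _, AlgHom.commutes _ _⟩
  have hval : ∀ v : AdmShift M, shiftFun hU v (∑ i, algebraMap ℂ (U → ℂ) (c i) * φ i) p =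
      ∑ i, c i * rpIntegral q i.succ.castSucc (Fin.last (M + 2)) (shiftPoint q v p.1) := fun v => by
    rw [map_sum, Finset.sum_apply]
    exact Finset.sum_congr rfl fun i _ => rfl
  have hzero := (hy.isOrbitSolution hq0 hU p).eq_zero hq0 hp fun j hj => by
    rw [hval]
    have := congrFun hc0 ⟨j, hj⟩
    rw [Matrix.mulVec, dotProduct, Pi.zero_apply] at this
    rw [← this]
    refine Finset.sum_congr rfl fun i _ => ?_
    rw [mul_comm, natCast_zsmul]
    rfl
  simp only [hval, rpIntegral_shiftPoint hq hq0 hp.1.1] at hzero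
  -- The combination rewritten in one-sided lattice sums: -c_i on the lattice of the lower endpoint
  -- of each integral, ∑ c_i on that of the common upper endpoint, 0 on the lattice of a_1.
  set d : Fin (M + 3) → ℂ := fun m => ∑ i, c i *
    ((if m = Fin.last (M + 2) then 1 else 0) - if m = i.succ.castSucc then 1 else 0) with hd
  have hdz : ∀ m, d m = 0 := by
    refine eq_zero_of_sum_latticeSum hq hq0 hp ?_ fun v => ?_
    · refine Finset.sum_eq_zero fun i _ => ?_
      rw [if_neg Fin.last_pos.ne, if_neg (castSucc_succ_ne i).1.symm, sub_zero, mul_zero]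
    · have h1q : (1 - q : ℂ) ≠ 0 := sub_ne_zero.2 fun h => by
        rw [← h, norm_one] at hq
        exact lt_irrefl _ hq
      apply mul_left_cancel₀ h1q
      rw [mul_zero, ← hzero v]
      simp only [hd, Finset.sum_mul]
      rw [Finset.sum_comm, Finset.mul_sum]
      refine Finset.sum_congr rfl fun i _ => ?_
      simp only [mul_assoc, sub_mul, ite_mul, one_mul, zero_mul, mul_sub, Finset.sum_sub_distrib]
      simp
      ring
  refine hc (funext fun i => ?_)
  have := hdz i.succ.castSucc
  rw [hd] at this
  simp only [if_neg (castSucc_succ_ne i).2, zero_sub, mul_neg, Finset.sum_neg_distrib] at this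
  simpa only [Fin.castSucc_inj, Fin.succ_inj, mul_ite, mul_one, mul_zero, Finset.sum_ite_eq,
    Finset.mem_univ, if_true, neg_eq_zero, Pi.zero_apply] using this

end Independence

/-! ## Functions on a shift-stable set of generic parameters -/

section FunctionSpace

variable {M : ℕ} {q : ℂ}

theorem isUnit_of_forall_ne_zero {U : Type*} {f : U → ℂ} (hf : ∀ p, f p ≠ 0) : IsUnit f :=
  Pi.isUnit_iff.2 fun p => (hf p).isUnit

theorem rpIntegral_basis (hq : ‖q‖ < 1) (hq0 : q ≠ 0) {U : Set (Param M)}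
    (hUg : U ⊆ genericParams q M) (hU : ShiftStable q U) :
    LinearIndependent (pseudoConstants (shiftFun hU))
        (fun (i : Fin (M + 1)) (p : U) => rpIntegral q i.succ.castSucc (Fin.last (M + 2)) p.1) ∧
      ∀ y : U → ℂ, IsSolutionRP q (shiftFun hU) (coordA U) (coordB U) y ↔
        y ∈ Submodule.span (pseudoConstants (shiftFun hU))
          (Set.range fun (i : Fin (M + 1)) (p : U) =>
            rpIntegral q i.succ.castSucc (Fin.last (M + 2)) p.1) := by
  have hW := isUnit_of_forall_ne_zero (det_casorati_rpIntegral_ne_zero hq hq0 hUg hU)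
  refine ⟨linearIndependent_of_casorati (isShiftAction_shiftFun hq0 hU) hW,
    isSolutionRP_iff_mem_span (isShiftAction_shiftFun hq0 hU) (shiftFun_coord_div hq0 hU)
      (isUnit_of_forall_ne_zero fun p => ?_) (isUnit_of_forall_ne_zero fun p => ?_)
      (fun i => isSolutionRP_rpIntegral hq hq0 hUg hU (castSucc_succ_ne i).1 Fin.last_pos.ne')
      hW⟩
  · rw [hatPoly_coord_apply]
    exact coeff_top_hatPoly_ne_zero hq0 (hUg p.2)
  · refine sub_ne_zero.2 fun h => (hUg p.2).2.2 0 0 0 ?_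
    rw [zpow_zero, one_mul]
    exact h.symm

end FunctionSpace

/-! ## Analytic dependence of the Jackson integrals on the parameters -/

section Analytic

open BoundedContinuousFunction

variable {M : ℕ} {q : ℂ}

/-- A bounded sequence as an element of a Banach algebra. -/
def boundedSeq (u : ℕ → ℂ) (C : ℝ) (hu : ∀ n, ‖u n‖ ≤ C) : ℕ →ᵇ ℂ :=
  BoundedContinuousFunction.ofNormedAddCommGroupDiscrete u C hu

theorem norm_boundedSeq_le {u : ℕ → ℂ} {C : ℝ} (hu : ∀ n, ‖u n‖ ≤ C) :
    ‖boundedSeq u C hu‖ ≤ C :=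
  norm_ofNormedAddCommGroup_le _ ((norm_nonneg _).trans (hu 0)) hu

/-- The evaluation of a bounded sequence. -/
def evalSeq (n : ℕ) : (ℕ →ᵇ ℂ) →* ℂ where
  toFun f := f n
  map_one' := rfl
  map_mul' _ _ := rfl

/-- Evaluation at n is continuous and multiplicative, so it commutes with the infinite product. -/
theorem tprod_boundedSeq_apply {w : ℕ → (ℕ →ᵇ ℂ)} (hw : Summable fun i => ‖w i‖) (x : ℂ) (n : ℕ) :
    (∏' i, (1 + x • w i)) n = ∏' i, (1 + x * w i n) :=
  (multipliable_one_add_smul hw x).map_tprod (evalSeq n) (continuous_eval_const n)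

/-- The entire functions `x ↦ ((x q^n)_∞)_n` and `y ↦ (∏_{i<n} (1 - y q^i))_n` with values in the
bounded sequences. -/
theorem exists_differentiable_qPoch_seq (hq : ‖q‖ < 1) :
    ∃ Q : ℂ → (ℕ →ᵇ ℂ), Differentiable ℂ Q ∧ ∀ x n, Q x n = qPoch q (x * q ^ n) := by
  have hb : ∀ i n : ℕ, ‖-(q ^ i * q ^ n)‖ ≤ ‖q‖ ^ i := fun i n => by
    rw [norm_neg, norm_mul, norm_pow, norm_pow]
    exact mul_le_of_le_one_right (by positivity) (pow_le_one₀ (norm_nonneg _) hq.le)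
  set w : ℕ → (ℕ →ᵇ ℂ) := fun i => boundedSeq _ _ (hb i)
  have hw : Summable fun i => ‖w i‖ :=
    (summable_geometric_of_lt_one (norm_nonneg _) hq).of_nonneg_of_le (fun _ => norm_nonneg _)
      fun i => norm_boundedSeq_le _
  refine ⟨_, differentiable_tprod_one_add_smul hw, fun x n => ?_⟩
  rw [tprod_boundedSeq_apply hw, qPoch]
  refine tprod_congr fun i => ?_
  change 1 + x * -(q ^ i * q ^ n) = _
  ring

theorem exists_differentiable_prod_seq (hq : ‖q‖ < 1) :
    ∃ S : ℂ → (ℕ →ᵇ ℂ), Differentiable ℂ S ∧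
      ∀ y n, S y n = ∏ i ∈ Finset.range n, (1 - y * q ^ i) := by
  have hb : ∀ i n : ℕ, ‖if i < n then -q ^ i else 0‖ ≤ ‖q‖ ^ i := fun i n => by
    split_ifs
    · rw [norm_neg, norm_pow]
    · rw [norm_zero]; positivity
  set w : ℕ → (ℕ →ᵇ ℂ) := fun i => boundedSeq _ _ (hb i)
  have hw : Summable fun i => ‖w i‖ :=
    (summable_geometric_of_lt_one (norm_nonneg _) hq).of_nonneg_of_le (fun _ => norm_nonneg _)
      fun i => norm_boundedSeq_le _
  refine ⟨_, differentiable_tprod_one_add_smul hw, fun y n => ?_⟩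
  rw [tprod_boundedSeq_apply hw]
  have hwn : ∀ i, w i n = if i < n then -q ^ i else 0 := fun i => rfl
  rw [tprod_eq_prod (s := Finset.range n)]
  · refine Finset.prod_congr rfl fun i hi => ?_
    rw [hwn, if_pos (Finset.mem_range.1 hi)]
    ring
  · intro i hi
    rw [hwn, if_neg (by simpa using hi), mul_zero, add_zero]

/-- The functional `f ↦ ∑_n q^n f(n)`. -/
theorem exists_clm_tsum (hq : ‖q‖ < 1) :
    ∃ Λ : (ℕ →ᵇ ℂ) →L[ℂ] ℂ, ∀ f, Λ f = ∑' n, q ^ n * f n := by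
  have hg := summable_geometric_of_lt_one (norm_nonneg _) hq
  have hb : ∀ (f : ℕ →ᵇ ℂ) n, ‖q ^ n * f n‖ ≤ ‖q‖ ^ n * ‖f‖ := fun f n => by
    rw [norm_mul, norm_pow]
    gcongr
    exact f.norm_coe_le_norm n
  have hs : ∀ f : ℕ →ᵇ ℂ, Summable fun n => q ^ n * f n := fun f =>
    Summable.of_norm_bounded (hg.mul_right _) (hb f)
  refine ⟨LinearMap.mkContinuous
    { toFun := fun f => ∑' n, q ^ n * f n
      map_add' := fun f g => by
        rw [← (hs f).tsum_add (hs g)]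
        exact tsum_congr fun n => mul_add _ _ _
      map_smul' := fun c f => by
        rw [RingHom.id_apply, smul_eq_mul, ← tsum_mul_left]
        exact tsum_congr fun n => mul_left_comm _ _ _ }
    (∑' n, ‖q‖ ^ n) fun f => ?_, fun f => rfl⟩
  rw [← tsum_mul_right]
  exact tsum_of_norm_bounded (hg.mul_right _).hasSum (hb f)

theorem mul_inv_qPoch_eq (hq : ‖q‖ < 1) {y : ℂ} (hy : qPoch q y ≠ 0) (n : ℕ) :
    (qPoch q (y * q ^ n))⁻¹ = (∏ i ∈ Finset.range n, (1 - y * q ^ i)) * (qPoch q y)⁻¹ := by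
  rw [qPoch_eq_prod_mul hq y n] at hy ⊢
  have h1 := left_ne_zero_of_mul hy
  rw [mul_inv, ← mul_assoc, mul_inv_cancel₀ h1, one_mul]

/-- At the n-th lattice point 1/(y q^n)_∞ equals ∏_{m<n} (1 - y q^m) divided by (y)_∞. With the
denominators (b_k q/a_i)_∞ taken out, the remaining sum is a continuous functional applied to a
product of entire functions with values in the bounded sequences, so it is analytic. -/
theorem exists_analytic_jacksonZero (hq : ‖q‖ < 1) (i : Fin (M + 3)) : ∃ G : Param M → ℂ,
    (∀ p : Param M, p.1 i ≠ 0 → AnalyticAt ℂ G p) ∧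
      ∀ p : Param M, (∏ k, qPoch q (p.2 k * (q / p.1 i))) ≠ 0 →
        jacksonZero q (fun t => ∏ k, qPoch q (p.1 k * t) / qPoch q (p.2 k * t)) (q / p.1 i) =
          G p / ∏ k, qPoch q (p.2 k * (q / p.1 i)) := by
  obtain ⟨Q, hQ, hQv⟩ := exists_differentiable_qPoch_seq hq
  obtain ⟨S, hS, hSv⟩ := exists_differentiable_prod_seq hq
  obtain ⟨Λ, hΛ⟩ := exists_clm_tsum hq
  refine ⟨fun p => (1 - q) * ((q / p.1 i) * Λ (∏ k, Q (p.1 k * (q / p.1 i)) *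
    S (p.2 k * (q / p.1 i)))), fun p hp => ?_, fun p hp => ?_⟩
  · have hτ : AnalyticAt ℂ (fun p : Param M => q / p.1 i) p :=
      analyticAt_const.div (analyticAt_coordA i p) hp
    refine analyticAt_const.mul (hτ.mul ((Λ.analyticAt _).fun_comp ?_))
    refine Finset.analyticAt_fun_prod _ fun k _ => ?_
    exact ((hQ.analyticAt _).fun_comp ((analyticAt_coordA k p).mul hτ)).mul
      ((hS.analyticAt _).fun_comp ((analyticAt_coordB k p).mul hτ))
  · have hp' := Finset.prod_ne_zero_iff.1 hp
    dsimp only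
    rw [jacksonZero, hΛ, mul_div_assoc, mul_div_assoc, ← tsum_div_const,
      ← tsum_mul_left (a := q / p.1 i)]
    refine congrArg ((1 - q) * ·) (tsum_congr fun n => ?_)
    have e : evalSeq n (∏ k, Q (p.1 k * (q / p.1 i)) * S (p.2 k * (q / p.1 i))) =
        ∏ k, (qPoch q (p.1 k * (q / p.1 i) * q ^ n) *
          ∏ m ∈ Finset.range n, (1 - p.2 k * (q / p.1 i) * q ^ m)) := by
      simp only [← hQv, ← hSv]
      exact map_prod (evalSeq n) _ _
    change _ = _ * (q ^ n * evalSeq n (∏ k, _) / _)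
    rw [e, div_eq_mul_inv _ (∏ k, _), ← Finset.prod_inv_distrib, mul_assoc (q ^ n),
      ← Finset.prod_mul_distrib]
    have e2 : ∀ k, qPoch q (p.1 k * (q / p.1 i * q ^ n)) / qPoch q (p.2 k * (q / p.1 i * q ^ n)) =
        qPoch q (p.1 k * (q / p.1 i) * q ^ n) * (∏ m ∈ Finset.range n,
          (1 - p.2 k * (q / p.1 i) * q ^ m)) * (qPoch q (p.2 k * (q / p.1 i)))⁻¹ := fun k => by
      rw [div_eq_mul_inv, ← mul_assoc, ← mul_assoc, mul_inv_qPoch_eq hq (hp' k (Finset.mem_univ k)),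
        ← mul_assoc]
    simp only [e2]
    ring

end Analytic

/-! ## Holomorphic functions and generic parameters -/

section Generic

variable {M : ℕ} {q : ℂ}

/-- With |q| = u^N, multiplication by a power of q changes the u-exponent of the absolute value by a
multiple of N; genericity can thus be tested on exponents modulo N. -/
theorem pow_sub_dvd_of_norm_eq {u : ℝ} (hu0 : 0 < u) (hu1 : u < 1) {N : ℕ} (hq : ‖q‖ = u ^ N)
    {x y : ℂ} {m n k : ℤ} (hx : ‖x‖ = u ^ m) (hy : ‖y‖ = u ^ n) (h : x = q ^ k * y) :
    (N : ℤ) ∣ m - n := by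
  have h1 := congrArg norm h
  rw [norm_mul, norm_zpow, hq, hx, hy, ← zpow_natCast, ← zpow_mul, ← zpow_add₀ hu0.ne'] at h1
  have h2 := zpow_right_injective₀ hu0 hu1.ne h1
  exact ⟨k, by omega⟩

theorem genericParams_nonempty (hq : ‖q‖ < 1) (hq0 : q ≠ 0) : (genericParams q M).Nonempty := by
  set s : ℤ := ∑ i : Fin (M + 2), ((i : ℤ) + 1) with hs
  have hs0 : 0 ≤ s := Finset.sum_nonneg fun i _ => by positivity
  set N : ℕ := s.toNat + M + 3 with hN
  have hNs : (N : ℤ) = s + M + 3 := by omega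
  set u : ℝ := ‖q‖ ^ ((N : ℝ)⁻¹) with hu
  have hq' : 0 < ‖q‖ := norm_pos_iff.2 hq0
  have hu0 : 0 < u := Real.rpow_pos_of_pos hq' _
  have hu1 : u < 1 := Real.rpow_lt_one hq'.le hq (by positivity)
  have huN : ‖q‖ = u ^ N := (Real.rpow_inv_natCast_pow hq'.le (by omega)).symm
  have huc : (u : ℂ) ≠ 0 := Complex.ofReal_ne_zero.2 hu0.ne'
  -- The exponents -s, 1, …, M + 2 have sum zero, and N = s + M + 3 is large enough for them to be
  -- distinct and nonzero modulo N. A factor q² in a_1 gives the defining relation, and all b_j = 1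
  -- is allowed since genericity does not restrict b_i/b_j.
  set e : Fin (M + 3) → ℤ := Fin.cases (-s) fun i => (i : ℤ) + 1 with he
  set f : Fin (M + 3) → ℤ := fun i => e i + if i = 0 then 2 * (N : ℤ) else 0 with hf
  set a : Fin (M + 3) → ℂ := fun i => (u : ℂ) ^ e i * if i = 0 then q ^ 2 else 1 with ha
  have ha_norm : ∀ i, ‖a i‖ = u ^ f i := fun i => by
    simp only [ha, hf]
    rw [norm_mul, norm_zpow, Complex.norm_of_nonneg hu0.le, zpow_add₀ hu0.ne']
    split_ifs
    · rw [norm_pow, huN, mul_comm 2, zpow_mul, zpow_natCast]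
      rfl
    · simp
  have hdvd : ∀ i m, (N : ℤ) ∣ f i - m → (N : ℤ) ∣ e i - m := fun i m h => by
    simp only [hf] at h
    split_ifs at h
    · exact (Int.dvd_add_left (Dvd.intro_left 2 rfl)).1
        (by rwa [show e i - m + 2 * (N : ℤ) = e i + 2 * N - m by ring])
    · rwa [add_zero] at h
  have hrange : ∀ i, i ≠ 0 → 0 < e i ∧ e i < M + 3 := fun i hi => by
    obtain ⟨j, rfl⟩ := Fin.exists_succ_eq.2 hi
    simp only [he, Fin.cases_succ]
    omega
  have he0 : e 0 = -s := rfl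
  have hs1 : 0 < s := by
    rw [hs, Fin.sum_univ_succ]
    have : 0 ≤ ∑ i : Fin (M + 1), (((i.succ : Fin (M + 2)) : ℤ) + 1) :=
      Finset.sum_nonneg fun i _ => by positivity
    simp only [Fin.val_zero]
    push_cast
    omega
  have hsmall : ∀ z : ℤ, (N : ℤ) ∣ z → |z| < N → z = 0 := fun z h1 h2 =>
    Int.eq_zero_of_abs_lt_dvd h1 h2
  have ha0 : ∀ i, a i ≠ 0 := fun i => by
    refine mul_ne_zero (zpow_ne_zero _ huc) ?_
    split_ifs
    · exact pow_ne_zero _ hq0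
    · exact one_ne_zero
  have hne : ∀ i j, i ≠ j → ¬(N : ℤ) ∣ e i - e j := fun i j hij h => by
    have h0 := hsmall _ h (by
      rw [abs_lt]
      by_cases hi : i = 0
      · have := hrange j fun hj => hij (hi.trans hj.symm)
        rw [hi, he0]; omega
      · have := hrange i hi
        by_cases hj : j = 0
        · rw [hj, he0]; omega
        · have := hrange j hj
          omega)
    by_cases hi : i = 0
    · have := hrange j fun hj => hij (hi.trans hj.symm)
      rw [hi, he0] at h0; omega
    · have := hrange i hi
      by_cases hj : j = 0
      · rw [hj, he0] at h0; omega
      · obtain ⟨i, rfl⟩ := Fin.exists_succ_eq.2 hi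
        obtain ⟨j, rfl⟩ := Fin.exists_succ_eq.2 hj
        simp only [he, Fin.cases_succ] at h0
        exact hij (by rw [Fin.ext_iff, Fin.val_succ, Fin.val_succ]; omega)
  refine ⟨(a, fun _ => 1), ⟨ha0, fun _ => one_ne_zero, ?_⟩, fun i j hij n h => ?_,
    fun i j n h => ?_⟩
  · have hsum : ∑ i, e i = 0 := by
      rw [Fin.sum_univ_succ]
      simp only [he, Fin.cases_zero, Fin.cases_succ]
      rw [← hs, neg_add_cancel]
    have hprod : ∏ i, (u : ℂ) ^ e i = (u : ℂ) ^ ∑ i, e i := by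
      induction (Finset.univ : Finset (Fin (M + 3))) using Finset.induction_on with
      | empty => simp
      | insert i s hi ih => rw [Finset.prod_insert hi, Finset.sum_insert hi, ih, zpow_add₀ huc]
    simp only [ha]
    rw [Finset.prod_mul_distrib, hprod, hsum]
    simp
  · have h1 := hdvd i _ (pow_sub_dvd_of_norm_eq hu0 hu1 huN (ha_norm i) (ha_norm j) h)
    have h2 := hdvd j (e i) (by rw [← neg_sub]; exact h1.neg_right)
    exact hne j i hij.symm h2
  · have h1 := hdvd i 0 (pow_sub_dvd_of_norm_eq hu0 hu1 huN (ha_norm i) (n := 0) (by simp) h)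
    rw [sub_zero] at h1
    have h0 := hsmall _ h1 (by
      rw [abs_lt]
      by_cases hi : i = 0
      · rw [hi, he0]; omega
      · have := hrange i hi
        omega)
    by_cases hi : i = 0
    · rw [hi, he0] at h0; omega
    · have := hrange i hi
      omega

/-- A function analytic near the parameter variety as a holomorphic function. -/
def holoOfAnalytic (F : Param M → ℂ) (hF : ∀ p ∈ paramVariety q M, AnalyticAt ℂ F p) : Holo q M :=
  ⟨fun p => F p, fun p => ⟨F, hF p p.2, Filter.Eventually.of_forall fun _ => rfl⟩⟩

/-- A theta function, which vanishes exactly on `q^ℤ`. -/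
def qTheta (q x : ℂ) : ℂ := qPoch q x * qPoch q (q / x)

theorem qTheta_zpow (hq : ‖q‖ < 1) (hq0 : q ≠ 0) (n : ℤ) : qTheta q (q ^ n) = 0 := by
  rcases le_or_gt n 0 with h | h
  · rw [qTheta, qPoch_zpow_eq_zero hq hq0 h, zero_mul]
  · have : q / q ^ n = q ^ (1 - n) := by rw [zpow_sub₀ hq0, zpow_one]
    rw [qTheta, this, qPoch_zpow_eq_zero hq hq0 (show 1 - n ≤ 0 by omega), mul_zero]

theorem qTheta_ne_zero (hq : ‖q‖ < 1) (hq0 : q ≠ 0) {x : ℂ} (hx : ∀ n : ℤ, x ≠ q ^ n) :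
    qTheta q x ≠ 0 := by
  refine mul_ne_zero (qPoch_ne_zero hq fun n h => ?_) (qPoch_ne_zero hq fun n h => ?_)
  · refine hx (-n) ?_
    rw [zpow_neg, zpow_natCast]
    exact eq_inv_of_mul_eq_one_left h
  · refine hx (n + 1) ?_
    have hx0 : x ≠ 0 := by
      rintro rfl
      simp at h
    rw [zpow_add_one₀ hq0, zpow_natCast]
    field_simp at h
    linear_combination -h

theorem analyticAt_qTheta_comp (hq : ‖q‖ < 1) {F : Param M → ℂ} {p : Param M}
    (hF : AnalyticAt ℂ F p) (h0 : F p ≠ 0) : AnalyticAt ℂ (fun x => qTheta q (F x)) p :=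
  (((differentiable_qPoch hq).analyticAt _).fun_comp hF).mul
    (((differentiable_qPoch hq).analyticAt _).fun_comp (analyticAt_const.div hF h0))

/-- The product of the theta functions of all ratios a_i/a_j (i ≠ j) and a_i/b_j; it is not
identically zero because a generic point exists. -/
theorem exists_holo_vanishing (hq : ‖q‖ < 1) (hq0 : q ≠ 0) : ∃ Θ : Holo q M, Θ ≠ 0 ∧
    ∀ p : paramVariety q M, p.1 ∉ genericParams q M → Θ.1 p = 0 := by
  refine ⟨holoOfAnalytic (fun p => (∏ i, ∏ j, if i = j then 1 else qTheta q (p.1 i / p.1 j)) *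
    ∏ i, ∏ j, qTheta q (p.1 i / p.2 j)) fun p hp => ?_, fun h => ?_, fun p hp => ?_⟩
  · refine (Finset.analyticAt_fun_prod _ fun i _ => Finset.analyticAt_fun_prod _ fun j _ => ?_).mul
      (Finset.analyticAt_fun_prod _ fun i _ => Finset.analyticAt_fun_prod _ fun j _ => ?_)
    · split_ifs
      · exact analyticAt_const
      · exact analyticAt_qTheta_comp hq ((analyticAt_coordA i p).div (analyticAt_coordA j p)
          (hp.1 j)) (div_ne_zero (hp.1 i) (hp.1 j))
    · exact analyticAt_qTheta_comp hq ((analyticAt_coordA i p).div (analyticAt_coordB j p)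
        (hp.2.1 j)) (div_ne_zero (hp.1 i) (hp.2.1 j))
  · obtain ⟨p, hp⟩ := genericParams_nonempty (M := M) hq hq0
    have h1 : (∏ i, ∏ j, if i = j then 1 else qTheta q (p.1 i / p.1 j)) *
        ∏ i, ∏ j, qTheta q (p.1 i / p.2 j) = 0 :=
      congrFun (congrArg Subtype.val h) ⟨p, hp.1⟩
    refine mul_ne_zero ?_ ?_ h1
    · refine Finset.prod_ne_zero_iff.2 fun i _ => Finset.prod_ne_zero_iff.2 fun j _ => ?_
      split_ifs with hij
      · exact one_ne_zero
      · refine qTheta_ne_zero hq hq0 fun n h => hp.2.1 i j hij n ?_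
        rwa [div_eq_iff (hp.1.1 j)] at h
    · refine Finset.prod_ne_zero_iff.2 fun i _ => Finset.prod_ne_zero_iff.2 fun j _ => ?_
      refine qTheta_ne_zero hq hq0 fun n h => hp.2.2 i j n ?_
      rwa [div_eq_iff (hp.1.2.1 j)] at h
  · change (∏ i, ∏ j, if i = j then 1 else qTheta q (p.1.1 i / p.1.1 j)) *
      ∏ i, ∏ j, qTheta q (p.1.1 i / p.1.2 j) = 0
    by_contra h
    refine hp ⟨p.2, fun i j hij n hn => h ?_, fun i j n hn => h ?_⟩
    · refine mul_eq_zero_of_left (Finset.prod_eq_zero (Finset.mem_univ i)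
        (Finset.prod_eq_zero (Finset.mem_univ j) ?_)) _
      rw [if_neg hij, hn, mul_div_cancel_right₀ _ (p.2.1 j), qTheta_zpow hq hq0]
    · refine mul_eq_zero_of_right _ (Finset.prod_eq_zero (Finset.mem_univ i)
        (Finset.prod_eq_zero (Finset.mem_univ j) ?_))
      rw [hn, mul_div_cancel_right₀ _ (p.2.2.1 j), qTheta_zpow hq hq0]

/-- The generic parameters are dense for holomorphic functions. -/
theorem holo_eq_zero_of_generic [NeZero q] (hq : ‖q‖ < 1) {g : Holo q M}
    (hg : ∀ p : paramVariety q M, p.1 ∈ genericParams q M → g.1 p = 0) : g = 0 := by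
  obtain ⟨Θ, hΘ, hΘ0⟩ := exists_holo_vanishing (M := M) hq (NeZero.ne q)
  -- At each point one factor vanishes, and the holomorphic functions form an integral domain, so no
  -- topology is needed.
  have h : g * Θ = 0 := Subtype.ext (funext fun p => by
    change g.1 p * Θ.1 p = 0
    by_cases hp : p.1 ∈ genericParams q M
    · rw [hg p hp, zero_mul]
    · rw [hΘ0 p hp, mul_zero])
  exact (mul_eq_zero.1 h).resolve_right hΘ

theorem holo_ne_zero_of_generic (hq : ‖q‖ < 1) (hq0 : q ≠ 0) {h : Holo q M}
    (hh : ∀ p : paramVariety q M, p.1 ∈ genericParams q M → h.1 p ≠ 0) : h ≠ 0 := by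
  rintro rfl
  obtain ⟨p, hp⟩ := genericParams_nonempty (M := M) hq hq0
  exact hh ⟨p, hp.1⟩ hp rfl

end Generic

/-! ## Meromorphic functions without poles at generic parameters -/

section Meromorphic

theorem map_det_casorati {M : ℕ} {R R' : Type*} [CommRing R] [Algebra ℂ R] [CommRing R']
    [Algebra ℂ R'] {σ : AdmShift M → R →ₐ[ℂ] R} {σ' : AdmShift M → R' →ₐ[ℂ] R'} (f : R →ₐ[ℂ] R')
    (hσ : ∀ v y, f (σ v y) = σ' v (f y)) (φ : Fin (M + 1) → R) :
    f (casorati σ φ).det = (casorati σ' fun i => f (φ i)).det := by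
  rw [AlgHom.map_det]
  congr 1
  ext j i
  exact hσ _ _

variable {M : ℕ} {q : ℂ} [NeZero q]

theorem shiftMero_algebraMap (v : AdmShift M) (g : Holo q M) :
    shiftMero q v (algebraMap _ (Mero q M) g) = algebraMap _ (Mero q M) (shiftHolo q v g) :=
  IsFractionRing.lift_algebraMap (K := Mero q M)
    (g := ((IsScalarTower.toAlgHom ℂ (Holo q M) (Mero q M)).comp (shiftHolo q v) :
      Holo q M →+* Mero q M)) ((IsFractionRing.injective (Holo q M) (Mero q M)).comp (shiftHolo_injective q v)) g

theorem isShiftAction_shiftHolo :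
    IsShiftAction (fun v : AdmShift M => shiftHolo q v) := by
  have h := isShiftAction_shiftFun (NeZero.ne q) (shiftStable_paramVariety q M)
  exact ⟨fun y => Subtype.ext (h.zero y.1), fun v w y => Subtype.ext (h.add v w y.1)⟩

theorem isShiftAction_shiftMero :
    IsShiftAction (fun v : AdmShift M => shiftMero q v) := by
  refine ⟨fun y => ?_, fun v w y => ?_⟩
  · obtain ⟨g, h, -, rfl⟩ := IsFractionRing.div_surjective (A := Holo q M) y
    simp only [map_div₀, shiftMero_algebraMap, isShiftAction_shiftHolo.zero]
  · obtain ⟨g, h, -, rfl⟩ := IsFractionRing.div_surjective (A := Holo q M) y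
    simp only [map_div₀, shiftMero_algebraMap, isShiftAction_shiftHolo.add]

/-- The pairs of a meromorphic function without poles at generic parameters and its values there. -/
def genericMero (q : ℂ) [NeZero q] (M : ℕ) : Subalgebra ℂ (Mero q M × (genericParams q M → ℂ)) where
  carrier := {x | ∃ g h : Holo q M, x.1 * algebraMap _ (Mero q M) h = algebraMap _ _ g ∧
    ∀ (p : Param M) (hp : p ∈ genericParams q M), h.1 ⟨p, hp.1⟩ ≠ 0 ∧
      x.2 ⟨p, hp⟩ * h.1 ⟨p, hp.1⟩ = g.1 ⟨p, hp.1⟩}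
  mul_mem' := by
    rintro x y ⟨g, h, e, H⟩ ⟨g', h', e', H'⟩
    refine ⟨g * g', h * h', ?_, fun p hp => ⟨mul_ne_zero (H p hp).1 (H' p hp).1, ?_⟩⟩
    · rw [map_mul, map_mul, ← e, ← e', Prod.fst_mul]
      ring
    · change x.2 _ * y.2 _ * (h.1 _ * h'.1 _) = g.1 _ * g'.1 _
      rw [← (H p hp).2, ← (H' p hp).2]
      ring
  add_mem' := by
    rintro x y ⟨g, h, e, H⟩ ⟨g', h', e', H'⟩
    refine ⟨g * h' + g' * h, h * h', ?_, fun p hp => ⟨mul_ne_zero (H p hp).1 (H' p hp).1, ?_⟩⟩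
    · rw [map_add, map_mul, map_mul, map_mul, ← e, ← e', Prod.fst_add]
      ring
    · change (x.2 _ + y.2 _) * (h.1 _ * h'.1 _) = g.1 _ * h'.1 _ + g'.1 _ * h.1 _
      rw [← (H p hp).2, ← (H' p hp).2]
      ring
  algebraMap_mem' := fun c => ⟨algebraMap ℂ _ c, 1, by
      rw [map_one, mul_one, ← IsScalarTower.algebraMap_apply]
      rfl, fun p hp => ⟨one_ne_zero, mul_one _⟩⟩

theorem holo_mem_genericMero (g : Holo q M) :
    ((algebraMap _ (Mero q M) g, fun p : genericParams q M => g.1 ⟨p.1, p.2.1⟩) :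
      Mero q M × (genericParams q M → ℂ)) ∈ genericMero q M :=
  ⟨g, 1, by rw [map_one, mul_one], fun _ _ => ⟨one_ne_zero, mul_one _⟩⟩

theorem algebraMap_holo_ne_zero (hq : ‖q‖ < 1) {h : Holo q M}
    (hh : ∀ (p : Param M) (hp : p ∈ genericParams q M), h.1 ⟨p, hp.1⟩ ≠ 0) :
    algebraMap _ (Mero q M) h ≠ 0 :=
  (map_ne_zero_iff _ (IsFractionRing.injective _ _)).2
    (holo_ne_zero_of_generic hq (NeZero.ne q) fun p hp => hh p.1 hp)

theorem genericMero_fst_injective :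
    Function.Injective fun x : genericMero q M => x.1.1 := by
  refine (injective_iff_map_eq_zero
    ((AlgHom.fst ℂ _ _).comp (genericMero q M).val : genericMero q M →ₐ[ℂ] Mero q M)).2 ?_
  rintro ⟨⟨Φ, f⟩, g, h, e, H⟩ (rfl : Φ = 0)
  rw [zero_mul] at e
  have hg : g = 0 := (map_eq_zero_iff _ (IsFractionRing.injective _ (Mero q M))).1 e.symm
  refine Subtype.ext (Prod.ext rfl (funext fun p => ?_))
  have := (H p.1 p.2).2
  rw [hg] at this
  exact (mul_eq_zero.1 this).resolve_right (H p.1 p.2).1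

/-- If all values vanish, the numerator vanishes at generic parameters, hence identically. This is
what carries identities between values over to meromorphic functions. -/
theorem genericMero_snd_injective (hq : ‖q‖ < 1) :
    Function.Injective fun x : genericMero q M => x.1.2 := by
  refine (injective_iff_map_eq_zero
    ((AlgHom.snd ℂ _ _).comp (genericMero q M).val :
      genericMero q M →ₐ[ℂ] genericParams q M → ℂ)).2 ?_
  rintro ⟨⟨Φ, f⟩, g, h, e, H⟩ (rfl : f = 0)
  have hg : g = 0 := holo_eq_zero_of_generic hq fun p hp => by
    rw [← (H p.1 hp).2]
    exact zero_mul _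
  rw [hg, map_zero] at e
  refine Subtype.ext (Prod.ext ?_ rfl)
  exact (mul_eq_zero.1 e).resolve_right (algebraMap_holo_ne_zero hq fun p hp => (H p hp).1)

theorem genericMero_fst_ne_zero (hq : ‖q‖ < 1) {x : genericMero q M} (hx : ∀ p, x.1.2 p ≠ 0) :
    x.1.1 ≠ 0 := fun h => by
  obtain ⟨p, hp⟩ := genericParams_nonempty (M := M) hq (NeZero.ne q)
  have h0 : x = 0 := genericMero_fst_injective h
  exact hx ⟨p, hp⟩ (by rw [h0]; rfl)

theorem genericMero_div_mem (hq : ‖q‖ < 1) {x y : Mero q M × (genericParams q M → ℂ)}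
    (hx : x ∈ genericMero q M) (hy : y ∈ genericMero q M) (hy0 : ∀ p, y.2 p ≠ 0) :
    x / y ∈ genericMero q M := by
  have hy1 := genericMero_fst_ne_zero hq (x := ⟨y, hy⟩) hy0
  obtain ⟨g, h, e, H⟩ := hy
  rw [div_eq_mul_inv]
  refine (genericMero q M).mul_mem hx ⟨h, g, ?_, fun p hp => ⟨?_, ?_⟩⟩
  · rw [← e, Prod.fst_inv, inv_mul_cancel_left₀ hy1]
  · rw [← (H p hp).2]
    exact mul_ne_zero (hy0 _) (H p hp).1
  · rw [← (H p hp).2]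
    exact inv_mul_cancel_left₀ (hy0 _) _

theorem represents_of_mem_genericMero (hq : ‖q‖ < 1) {Φ : Mero q M} {f : Param M → ℂ}
    (hx : ((Φ, fun p : genericParams q M => f p.1) : Mero q M × (genericParams q M → ℂ)) ∈
      genericMero q M) : Represents Φ f := by
  obtain ⟨g, h, e, H⟩ := hx
  refine ⟨g, h, ?_, fun p hp => ⟨(H p.1 hp).1, ?_⟩⟩
  · exact eq_div_of_mul_eq (algebraMap_holo_ne_zero hq fun p hp => (H p hp).1) e
  · exact eq_div_of_mul_eq (H p.1 hp).1 (H p.1 hp).2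

theorem shift_mem_genericMero (v : AdmShift M) {x : Mero q M × (genericParams q M → ℂ)}
    (hx : x ∈ genericMero q M) :
    (shiftMero q v x.1, shiftFun (shiftStable_genericParams (NeZero.ne q)) v x.2) ∈
      genericMero q M := by
  obtain ⟨g, h, e, H⟩ := hx
  refine ⟨shiftHolo q v g, shiftHolo q v h, ?_, fun p hp => ?_⟩
  · rw [← shiftMero_algebraMap, ← shiftMero_algebraMap, ← e, map_mul]
  · exact H _ (shiftStable_genericParams (NeZero.ne q) v p hp)

/-- The shift operators on the meromorphic functions without poles at generic parameters. -/
def shiftGenericMero (q : ℂ) [NeZero q] (v : AdmShift M) : genericMero q M →ₐ[ℂ] genericMero q M :=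
  (((shiftMero q v).prodMap (shiftFun (shiftStable_genericParams (NeZero.ne q)) v)).comp
    (genericMero q M).val).codRestrict (genericMero q M) fun x => shift_mem_genericMero v x.2

theorem isShiftAction_shiftGenericMero :
    IsShiftAction (fun v : AdmShift M => shiftGenericMero q v) := by
  have h := isShiftAction_shiftFun (NeZero.ne q) (shiftStable_genericParams (M := M) (NeZero.ne q))
  exact ⟨fun y => Subtype.ext (Prod.ext (isShiftAction_shiftMero.zero _) (h.zero _)),
    fun v w y => Subtype.ext (Prod.ext (isShiftAction_shiftMero.add _ _ _) (h.add _ _ _))⟩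

/-- The partially defined division. -/
instance instDivGenericMero : Div (genericMero q M) := by
  classical
  -- The default 0 is harmless: the system only forms a_1/b_1, and b_1 has no zeros.
  exact ⟨fun x y => if h : x.1 / y.1 ∈ genericMero q M then ⟨_, h⟩ else 0⟩

theorem genericMero_coe_div (hq : ‖q‖ < 1) {x y : genericMero q M} (hy : ∀ p, y.1.2 p ≠ 0) :
    (x / y).1 = x.1 / y.1 :=
  congrArg Subtype.val (dif_pos (genericMero_div_mem hq x.2 y.2 hy))

/-- The coordinate `a_i` with its values. -/
def genericMeroA (q : ℂ) [NeZero q] (i : Fin (M + 3)) : genericMero q M :=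
  ⟨(meroA q i, coordA _ i), holo_mem_genericMero (holoA q i)⟩

/-- The coordinate `b_i` with its values. -/
def genericMeroB (q : ℂ) [NeZero q] (i : Fin (M + 3)) : genericMero q M :=
  ⟨(meroB q i, coordB _ i), holo_mem_genericMero (holoB q i)⟩

theorem exists_jacksonZero_mem_genericMero (hq : ‖q‖ < 1) (i : Fin (M + 3)) :
    ∃ Φ : Mero q M, ((Φ, fun p : genericParams q M =>
      jacksonZero q (fun t => ∏ k, qPoch q (p.1.1 k * t) / qPoch q (p.1.2 k * t)) (q / p.1.1 i)) :
        Mero q M × (genericParams q M → ℂ)) ∈ genericMero q M := by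
  obtain ⟨G, hG, hGv⟩ := exists_analytic_jacksonZero (M := M) hq i
  obtain ⟨g, hg⟩ : ∃ g : Holo q M, ∀ p, g.1 p = G p.1 :=
    ⟨holoOfAnalytic G fun p hp => hG p (hp.1 i), fun _ => rfl⟩
  obtain ⟨h, hh⟩ : ∃ h : Holo q M, ∀ p, h.1 p = ∏ k, qPoch q (p.1.2 k * (q / p.1.1 i)) :=
    ⟨holoOfAnalytic (fun p => ∏ k, qPoch q (p.2 k * (q / p.1 i))) fun p hp =>
      Finset.analyticAt_fun_prod _ fun k _ => ((differentiable_qPoch hq).analyticAt _).fun_comp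
        ((analyticAt_coordB k p).mul (analyticAt_const.div (analyticAt_coordA i p) (hp.1 i))),
      fun _ => rfl⟩
  have hne : ∀ p ∈ genericParams q M, (∏ k, qPoch q (p.2 k * (q / p.1 i))) ≠ 0 := fun p hp => by
    refine Finset.prod_ne_zero_iff.2 fun k _ => qPoch_ne_zero hq fun n e => ?_
    refine hp.2.2 i k (n + 1) ?_
    have := hp.1.1 i
    rw [zpow_add_one₀ (NeZero.ne q), zpow_natCast]
    field_simp at e
    linear_combination -e
  have hh' : algebraMap _ (Mero q M) h ≠ 0 := algebraMap_holo_ne_zero hq fun p hp => by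
    rw [hh]
    exact hne p hp
  refine ⟨algebraMap _ _ g / algebraMap _ _ h, g, h, div_mul_cancel₀ _ hh', fun p hp => ?_⟩
  rw [hh, hg]
  refine ⟨hne p hp, ?_⟩
  dsimp only
  rw [hGv p (hne p hp), div_mul_cancel₀ _ (hne p hp)]

theorem exists_rpIntegral_mem_genericMero (hq : ‖q‖ < 1) (i j : Fin (M + 3)) :
    ∃ x : genericMero q M, x.1.2 = fun p => rpIntegral q i j p.1 := by
  obtain ⟨Φ, hΦ⟩ := exists_jacksonZero_mem_genericMero (q := q) (M := M) hq i
  obtain ⟨Ψ, hΨ⟩ := exists_jacksonZero_mem_genericMero (q := q) (M := M) hq j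
  exact ⟨⟨_, (genericMero q M).sub_mem hΨ hΦ⟩, rfl⟩

/-- The meromorphic function of a pair. -/
def genericMeroFst (q : ℂ) [NeZero q] (M : ℕ) : genericMero q M →ₐ[ℂ] Mero q M :=
  (AlgHom.fst ℂ _ _).comp (genericMero q M).val

/-- The values of a pair. -/
def genericMeroSnd (q : ℂ) [NeZero q] (M : ℕ) : genericMero q M →ₐ[ℂ] (genericParams q M → ℂ) :=
  (AlgHom.snd ℂ _ _).comp (genericMero q M).val

theorem genericMeroFst_injective : Function.Injective (genericMeroFst q M) :=
  genericMero_fst_injective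

theorem genericMeroSnd_injective (hq : ‖q‖ < 1) : Function.Injective (genericMeroSnd q M) :=
  genericMero_snd_injective hq

theorem genericMeroFst_coordA (i : Fin (M + 3)) :
    genericMeroFst q M (genericMeroA q i) = meroA q i := rfl

theorem genericMeroFst_coordB (i : Fin (M + 3)) :
    genericMeroFst q M (genericMeroB q i) = meroB q i := rfl

theorem genericMeroSnd_coordA (i : Fin (M + 3)) :
    genericMeroSnd q M (genericMeroA q i) = coordA _ i := rfl

theorem genericMeroSnd_coordB (i : Fin (M + 3)) :
    genericMeroSnd q M (genericMeroB q i) = coordB _ i := rfl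

theorem genericMeroFst_shift (v : AdmShift M) (x : genericMero q M) :
    genericMeroFst q M (shiftGenericMero q v x) = shiftMero q v (genericMeroFst q M x) := rfl

theorem genericMeroSnd_shift (hU : ShiftStable q (genericParams q M)) (v : AdmShift M)
    (x : genericMero q M) :
    genericMeroSnd q M (shiftGenericMero q v x) = shiftFun hU v (genericMeroSnd q M x) := rfl

theorem genericMeroFst_ne_zero (hq : ‖q‖ < 1) {x : genericMero q M}
    (hx : ∀ p, genericMeroSnd q M x p ≠ 0) : genericMeroFst q M x ≠ 0 :=
  genericMero_fst_ne_zero hq hx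

theorem genericMeroFst_div (hq : ‖q‖ < 1) :
    genericMeroFst q M (genericMeroA q 0 / genericMeroB q 0) = meroA q 0 / meroB q 0 :=
  congrArg Prod.fst (genericMero_coe_div hq fun p => p.2.1.2.1 0)

theorem genericMeroSnd_div (hq : ‖q‖ < 1) :
    genericMeroSnd q M (genericMeroA q 0 / genericMeroB q 0) = coordA _ 0 / coordB _ 0 :=
  congrArg Prod.snd (genericMero_coe_div hq fun p => p.2.1.2.1 0)

theorem shiftGenericMero_div (hq : ‖q‖ < 1) :
    shiftGenericMero q (shAB 0 0) (genericMeroA q 0 / genericMeroB q 0) =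
      (genericMeroA q 0 / genericMeroB q 0 : genericMero q M) := by
  refine genericMeroSnd_injective hq ?_
  have hU := shiftStable_genericParams (M := M) (NeZero.ne q)
  rw [genericMeroSnd_shift hU, genericMeroSnd_div hq, shiftFun_coord_div (NeZero.ne q) hU]

theorem shiftMero_div (hq : ‖q‖ < 1) :
    shiftMero q (shAB 0 0) (meroA q 0 / meroB q 0 : Mero q M) = meroA q 0 / meroB q 0 := by
  rw [← genericMeroFst_div hq, ← genericMeroFst_shift, shiftGenericMero_div hq]

theorem isSolutionRP_genericMeroFst_iff (hq : ‖q‖ < 1) (x : genericMero q M) :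
    IsSolutionRP q (shiftGenericMero q) (genericMeroA q) (genericMeroB q) x ↔
      IsSolutionRP q (shiftMero q) (meroA q) (meroB q) (genericMeroFst q M x) := by
  have h := isSolutionRP_iff_of_injective (q := q) (σ := shiftGenericMero (M := M) q)
    (σ' := shiftMero q) (a := genericMeroA q) (b := genericMeroB q) (a' := meroA q)
    (b' := meroB q) isShiftAction_shiftGenericMero isShiftAction_shiftMero
    (shiftGenericMero_div hq) (genericMeroFst q M) genericMeroFst_injective genericMeroFst_shift
  exact h genericMeroFst_coordA genericMeroFst_coordB (genericMeroFst_div hq) x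

theorem isSolutionRP_genericMeroSnd_iff (hq : ‖q‖ < 1) (hU : ShiftStable q (genericParams q M))
    (x : genericMero q M) :
    IsSolutionRP q (shiftGenericMero q) (genericMeroA q) (genericMeroB q) x ↔
      IsSolutionRP q (shiftFun hU) (coordA _) (coordB _) (genericMeroSnd q M x) :=
  isSolutionRP_iff_of_injective (σ := shiftGenericMero q) (σ' := shiftFun hU)
    isShiftAction_shiftGenericMero (isShiftAction_shiftFun (NeZero.ne q) hU)
    (shiftGenericMero_div hq) (genericMeroSnd q M) (genericMeroSnd_injective hq)
    (genericMeroSnd_shift hU) genericMeroSnd_coordA genericMeroSnd_coordB (genericMeroSnd_div hq) x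

theorem det_casorati_mero_ne_zero (hq : ‖q‖ < 1) (hU : ShiftStable q (genericParams q M))
    {x : Fin (M + 1) → genericMero q M}
    (hx : ∀ p, (casorati (shiftFun hU) fun i => genericMeroSnd q M (x i)).det p ≠ 0) :
    (casorati (shiftMero q) fun i => genericMeroFst q M (x i)).det ≠ 0 := by
  rw [← map_det_casorati (genericMeroFst q M) genericMeroFst_shift]
  refine genericMeroFst_ne_zero hq fun p => ?_
  rw [map_det_casorati (genericMeroSnd q M) (genericMeroSnd_shift hU)]
  exact hx p

theorem coeff_top_hatPoly_mero_ne_zero (hq : ‖q‖ < 1) :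
    (hatPoly q (meroA q) (meroB q) (meroA q 0 / meroB q 0 : Mero q M)).coeff (M + 1) ≠ 0 := by
  have e₁ := congrArg (fun P => P.coeff (M + 1)) (map_hatPoly (genericMeroFst q M) q
    (genericMeroA q) (genericMeroB q) (genericMeroA q 0 / genericMeroB q 0))
  have e₂ := congrArg (fun P => P.coeff (M + 1)) (map_hatPoly (genericMeroSnd q M) q
    (genericMeroA q) (genericMeroB q) (genericMeroA q 0 / genericMeroB q 0))
  rw [genericMeroFst_div hq] at e₁
  rw [genericMeroSnd_div hq] at e₂
  simp only [coeff_map] at e₁ e₂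
  refine ne_of_eq_of_ne e₁.symm (genericMeroFst_ne_zero hq fun p => ?_)
  refine ne_of_eq_of_ne (congrFun e₂ p) ?_
  change (hatPoly q (coordA _) (coordB _) (coordA _ 0 / coordB _ 0)).coeff (M + 1) p ≠ 0
  rw [hatPoly_coord_apply]
  exact coeff_top_hatPoly_ne_zero (NeZero.ne q) p.2

theorem meroB_sub_meroA_ne_zero (hq : ‖q‖ < 1) : (meroB q 0 - meroA q 0 : Mero q M) ≠ 0 := by
  refine genericMeroFst_ne_zero hq (x := genericMeroB q 0 - genericMeroA q 0) fun p => ?_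
  refine sub_ne_zero.2 fun h => p.2.2.2 0 0 0 ?_
  rw [zpow_zero, one_mul]
  exact h.symm

/-- The solution property and the nonvanishing determinant are transported through `genericMero`
from the set of all generic parameters. In a field nonzero means invertible, so the abstract basis
criterion applies. -/
theorem exists_mero_basis (hq : ‖q‖ < 1) : ∃ Φ : Fin (M + 1) → Mero q M,
    (∀ i, Represents (Φ i) (rpIntegral q i.succ.castSucc (Fin.last (M + 2)))) ∧
    LinearIndependent (pseudoConstants (shiftMero q (M := M))) Φ ∧
    ∀ y : Mero q M, IsSolutionRP q (shiftMero q) (meroA q) (meroB q) y ↔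
      y ∈ Submodule.span (pseudoConstants (shiftMero q (M := M))) (Set.range Φ) := by
  have hq0 : q ≠ 0 := NeZero.ne q
  choose x hx using fun i : Fin (M + 1) =>
    exists_rpIntegral_mem_genericMero (q := q) hq i.succ.castSucc (Fin.last (M + 2))
  replace hx : ∀ i, genericMeroSnd q M (x i) =
      fun p => rpIntegral q i.succ.castSucc (Fin.last (M + 2)) p.1 := hx
  have hU := shiftStable_genericParams (M := M) hq0
  have hsol : ∀ i, IsSolutionRP q (shiftMero q) (meroA q) (meroB q) (genericMeroFst q M (x i)) :=
    fun i => (isSolutionRP_genericMeroFst_iff hq _).1 <|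
      (isSolutionRP_genericMeroSnd_iff hq hU _).2 <| by
      rw [hx i]
      exact isSolutionRP_rpIntegral hq hq0 subset_rfl hU (castSucc_succ_ne i).1 Fin.last_pos.ne'
  have hW := (det_casorati_mero_ne_zero hq hU (x := x) fun p => by
    simp only [hx]
    exact det_casorati_rpIntegral_ne_zero hq hq0 subset_rfl hU p).isUnit
  refine ⟨fun i => genericMeroFst q M (x i), fun i => represents_of_mem_genericMero hq ?_,
    linearIndependent_of_casorati isShiftAction_shiftMero hW,
    isSolutionRP_iff_mem_span isShiftAction_shiftMero (shiftMero_div hq)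
      (coeff_top_hatPoly_mero_ne_zero hq).isUnit (meroB_sub_meroA_ne_zero hq).isUnit hsol hW⟩
  rw [← hx i]
  exact (x i).2

end Meromorphic

end

theorem mainTheorem5 (M : ℕ) (q : ℂ) [NeZero q] (hq : ‖q‖ < 1) :
    (∀ (U : Set (Param M)), U ⊆ genericParams q M → ∀ hU : ShiftStable q U,
      LinearIndependent (pseudoConstants (shiftFun hU))
        (fun (i : Fin (M + 1)) (p : U) => rpIntegral q i.succ.castSucc (Fin.last (M + 2)) p.1) ∧
      ∀ y : U → ℂ, IsSolutionRP q (shiftFun hU) (coordA U) (coordB U) y ↔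
        y ∈ Submodule.span (pseudoConstants (shiftFun hU))
          (Set.range fun (i : Fin (M + 1)) (p : U) =>
            rpIntegral q i.succ.castSucc (Fin.last (M + 2)) p.1)) ∧
    ∃ Φ : Fin (M + 1) → Mero q M,
      (∀ i, Represents (Φ i) (rpIntegral q i.succ.castSucc (Fin.last (M + 2)))) ∧
      LinearIndependent (meroPseudoConstants q M) Φ ∧
      ∀ y : Mero q M,
        IsSolutionRP q (shiftMero q) (meroA q) (meroB q) y ↔
          y ∈ Submodule.span (meroPseudoConstants q M) (Set.range Φ) := by
  -- The field of meromorphic pseudo-constants has the ring of pseudo-constants as underlying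
  -- subring, so spans and independence over the two agree by definition.
  exact ⟨fun U hUg hU => rpIntegral_basis hq (NeZero.ne q) hUg hU, exists_mero_basis hq⟩
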